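/- Let $n\ge 1$ and $Q=2(n+1)$. On $\mathbb H^n=\mathbb R^{2n+1}$, with points $\xi=(z,t)$, $z=x+iy\in\mathbb C^n$, $t\in\mathbb R$, use the group law $\xi\circ\xi_0=(z+z_0,\ t+t_0+2\,\mathrm{Im}(\bar z z_0))$, where $\bar z z_0=\sum_k \bar z_k (z_0)_k$, the norm $|\xi|_{\mathbb H^n}=(|z|^4+t^2)^{1/4}$, the closed Korányi balls $B_r(\xi_0)=\{\xi:\ |\xi^{-1}\circ\xi_0|_{\mathbb H^n}\le r\}$, the left-invariant vector fields $X_k=\partial_{x_k}-2y_k\partial_t$, $Y_k=\partial_{y_k}+2x_k\partial_t$ $(1\le k\le n)$, and the intrinsic gradient $\nabla_{\mathbb H^n}u=(X_1u,\dots,X_nu,Y_1u,\dots,Y_nu)$, taken in the weak sense. $\mathcal L$ denotes Lebesgue measure on $\mathbb R^{2n+1}$. **Potentials.** Let $F:\mathbb H^n\times\mathbb R\to[0,\infty)$ be measurable, and let $M\in\mathbb R$, $\gamma:[0,1)\to(0,\infty)$ non-increasing, $d\in[0,2]$, $\ell,\kappa\in(0,1)$ and $a,b>0$ be such that, for all $\xi$: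 - $F(\xi,\pm1)=0$, and $F(\xi,u)\le M$ for $|u|\le 1$; - $F(\xi,u)\ge\gamma(\theta)$ for $|u|\le\theta$, for every $\theta\in[0,1)$; - $F(\xi,u)\ge a(1-|u|)^d$ if $\ell<|u|<1$; - $F(\xi,\cdot)$ is continuous and locally Lipschitz on $(-1,1)$; - if $d>0$, then $F(\xi,\cdot)$ is differentiable on $(-1,1)$ with continuous derivative $F_u(\xi,\cdot)$, and $F_u(\xi,-1+s)\ge b\,s^{d-1}$, $F_u(\xi,1-s)\le -b\,s^{d-1}$ for $0<s<\ell$; - if $d=2$, then $F(\xi,\cdot)$ is continuous on $[-1,1]$, and $F_u(\xi,\cdot)$ is non-decreasing on $(-1,-1+\kappa)$ and on $(1-\kappa,1)$. The *structural constants* are $n,M,\gamma,d,\ell,\kappa,a,b$. **Local minimizers.** For $A\subseteq\mathbb H^n$ put $\mathcal F_A(u)=\int_A\big(|\nabla_{\mathbb H^n}u|^2+F(\xi,u(\xi))\big)\,d\xi\in[0,\infty]$, where the weak gradient is taken in the interior of $A$, and $\mathcal F_A(u)=\infty$ if there is no locally integrable weak gradient. Let $\Omega\subseteq\mathbb R^{2n+1}$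 be a domain (open and connected). The function $u$ is a *local minimizer* for $\mathcal F$ in $\Omega$ if $\mathcal F_\Omega(u)<\infty$ and $\mathcal F_\Omega(u+\varphi)\ge\mathcal F_\Omega(u)$ for every bounded function $\varphi$ with compact support in $\Omega$ and weak gradient $\nabla_{\mathbb H^n}\varphi\in L^2(\Omega)$. **Theorem.** Let $\delta>0$, and let $u$ be a local minimizer for $\mathcal F$ in a domain $\Omega$, with $|u|\le1$ almost everywhere in $\Omega$. Then: (i) There are $c,r_0>0$, depending only on $\delta$ and on the structural constants, such that, for every $\xi$ and every $r\ge r_0$ with $B_{r+\delta}(\xi)\subseteq\Omega$, $$\mathcal F_{B_r(\xi)}(u)\le c\,r^{Q-1}.$$ (ii) Let $K>0$, $\mu_0>0$ and $\theta_0\in(0,1)$. There are $c^\star,r_0>0$, depending only on $K,\mu_0,\theta_0$ and on the structural constants, such that for every $\xi$ and every $\theta\in[-\theta_0,\theta_0]$ the following holds. If $$\mathcal L\big(B_K(\xi)\cap\{u\ge\theta\}\big)\ge\mu_0,$$ then $$\mathcal L\big(B_r(\xi)\cap\{u\ge\theta\}\big)\ge c^\star r^Q$$ for every $r\ge r_0$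 with $B_{r+\delta}(\xi)\subseteq\Omega$. Likewise, if $\mathcal L(B_K(\xi)\cap\{u\le\theta\})\ge\mu_0$, then $\mathcal L(B_r(\xi)\cap\{u\le\theta\})\ge c^\star r^Q$ for every $r\ge r_0$ with $B_{r+\delta}(\xi)\subseteq\Omega$. -/

import Mathlib

open MeasureTheory Set
open scoped ContDiff ENNReal

/-- Points `ξ = (x, y, t)` of `ℝ^{2n+1}`, the underlying space of the Heisenberg group `ℍⁿ`,
with its usual topology and Lebesgue measure `volume`. -/
abbrev Heis (n : ℕ) : Type := (Fin n → ℝ) × (Fin n → ℝ) × ℝ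

namespace Heis

variable {n : ℕ}

/-- The group law `ξ ∘ η = (z + w, t + s + 2 Im (z̄ w))` for `ξ = (z, t)`, `η = (w, s)`, where
`z = x + i y` and `z̄ w = ∑ₖ z̄ₖ wₖ`. -/
def mul (ξ η : Heis n) : Heis n :=
  (ξ.1 + η.1, ξ.2.1 + η.2.1,
    ξ.2.2 + η.2.2 + 2 * ∑ k, (ξ.1 k * η.2.1 k - ξ.2.1 k * η.1 k))

/-- The group inverse, `(z, t)⁻¹ = (-z, -t)`. -/
def inv (ξ : Heis n) : Heis n := -ξ

theorem mul_inv_self (ξ : Heis n) : mul ξ (inv ξ) = 0 := by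
  ext <;> simp [mul, inv, mul_comm]

theorem inv_mul_self (ξ : Heis n) : mul (inv ξ) ξ = 0 := by
  ext <;> simp [mul, inv, mul_comm]

/-- The homogeneous norm `|ξ| = (|z|⁴ + t²)^{1/4}`. -/
noncomputable def koranyiNorm (ξ : Heis n) : ℝ :=
  ((∑ k, (ξ.1 k ^ 2 + ξ.2.1 k ^ 2)) ^ 2 + ξ.2.2 ^ 2) ^ (1 / 4 : ℝ)

/-- The (closed) Korányi ball of centre `ξ₀` and radius `r`. -/
def ball (ξ₀ : Heis n) (r : ℝ) : Set (Heis n) :=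
  {ξ | koranyiNorm (mul (inv ξ) ξ₀) ≤ r}

/-- The homogeneous dimension `Q = 2(n + 1)`. -/
def homDim (n : ℕ) : ℕ := 2 * (n + 1)

/-- The horizontal coordinate directions at the origin: `inl k` is `∂_{xₖ}`, `inr k` is
`∂_{yₖ}`. -/
def horizDir : Fin n ⊕ Fin n → Heis n
  | Sum.inl k => (Pi.single k 1, 0, 0)
  | Sum.inr k => (0, Pi.single k 1, 0)

/-- The left-invariant horizontal vector fields: `inl k` is `Xₖ = ∂_{xₖ} - 2 yₖ ∂_t` and `inr k`
is `Yₖ = ∂_{yₖ} + 2 xₖ ∂_t`. -/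
def field : Fin n ⊕ Fin n → Heis n → Heis n
  | Sum.inl k, ξ => (Pi.single k 1, 0, -2 * ξ.2.1 k)
  | Sum.inr k, ξ => (0, Pi.single k 1, 2 * ξ.1 k)

/-- The fields are the ones generated by right multiplication with the horizontal directions,
i.e. they are left invariant for the group law `mul`. -/
theorem mul_smul_horizDir (j : Fin n ⊕ Fin n) (ξ : Heis n) (s : ℝ) :
    mul ξ (s • horizDir j) = ξ + s • field j ξ := by
  rcases j with k | k <;> ext <;>
    simp [mul, horizDir, field, Pi.single_apply] <;> ring

/-- `G` is the weak intrinsic (horizontal) gradient `(X₁u, …, Xₙu, Y₁u, …, Yₙu)` of `u` on the open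
set `U`. (The fields are divergence free, so the formal adjoint of each of them is its
negative.) -/
structure IsWeakGrad (U : Set (Heis n)) (u : Heis n → ℝ)
    (G : Heis n → EuclideanSpace ℝ (Fin n ⊕ Fin n)) : Prop where
  locallyIntegrable : LocallyIntegrableOn u U volume
  locallyIntegrable_grad : LocallyIntegrableOn G U volume
  integral_eq : ∀ φ : Heis n → ℝ, ContDiff ℝ ∞ φ → HasCompactSupport φ → tsupport φ ⊆ U →
    ∀ j, ∫ ξ in U, u ξ * fderiv ℝ φ ξ (field j ξ) = -∫ ξ in U, G ξ j * φ ξ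

/-- The energy `𝓕_A(u) = ∫_A |∇u|² + F(ξ, u) dξ`, with values in `[0, ∞]`; here `∇u` is the weak
intrinsic gradient of `u`. Weak gradients are unique almost everywhere, so that the infimum is over
a single value, or over the empty set (with value `∞`) when `u` has no weak gradient. -/
noncomputable def energy (F : Heis n → ℝ → ℝ) (A : Set (Heis n)) (u : Heis n → ℝ) : ℝ≥0∞ :=
  ⨅ (G : Heis n → EuclideanSpace ℝ (Fin n ⊕ Fin n)) (_ : IsWeakGrad (interior A) u G),
    ∫⁻ ξ in A, ENNReal.ofReal (‖G ξ‖ ^ 2 + F ξ (u ξ))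

/-- Admissible perturbations on the open set `Ω`: bounded functions with compact support in `Ω`
that have a square integrable weak intrinsic gradient. -/
structure IsPerturbation (Ω : Set (Heis n)) (φ : Heis n → ℝ) : Prop where
  hasCompactSupport : HasCompactSupport φ
  tsupport_subset : tsupport φ ⊆ Ω
  bounded : ∃ C : ℝ, ∀ ξ, |φ ξ| ≤ C
  grad : ∃ G : Heis n → EuclideanSpace ℝ (Fin n ⊕ Fin n),
    IsWeakGrad Ω φ G ∧ MemLp G 2 (volume.restrict Ω)

/-- `u` is a local minimizer of the energy in `Ω`. -/
structure IsLocalMinimizer (F : Heis n → ℝ → ℝ) (Ω : Set (Heis n)) (u : Heis n → ℝ) : Prop where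
  energy_ne_top : energy F Ω u ≠ ⊤
  le_energy_add : ∀ φ, IsPerturbation Ω φ → energy F Ω u ≤ energy F Ω (u + φ)

/-- The structural constants of a double-well potential. -/
structure StructuralConstants where
  /-- the bound on the potential -/
  M : ℝ
  /-- the lower bound on the potential away from the wells -/
  γ : ℝ → ℝ
  γ_pos : ∀ θ ∈ Ico (0 : ℝ) 1, 0 < γ θ
  γ_antitone : AntitoneOn γ (Ico (0 : ℝ) 1)
  /-- the growth exponent at the wells -/
  d : ℝ
  d_mem : d ∈ Icc (0 : ℝ) 2
  /-- the size of the neighbourhoods of the wells -/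
  ℓ : ℝ
  ℓ_mem : ℓ ∈ Ioo (0 : ℝ) 1
  /-- the constant in the lower bound on `F` near the wells -/
  a : ℝ
  a_pos : 0 < a
  /-- the constant in the bounds on `F_u` near the wells -/
  b : ℝ
  b_pos : 0 < b
  /-- the size of the neighbourhoods of the wells on which `F_u` is increasing if `d = 2` -/
  κ : ℝ
  κ_mem : κ ∈ Ioo (0 : ℝ) 1

/-- `F = F(ξ, t)` is a double-well potential with the structural constants `P`. Here `F_u` is the
derivative `deriv (F ξ)` in the second variable. -/
structure IsDoubleWell (P : StructuralConstants) (F : Heis n → ℝ → ℝ) : Prop where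
  measurable : Measurable (Function.uncurry F)
  nonneg : ∀ ξ t, 0 ≤ F ξ t
  le_bound : ∀ ξ t, |t| ≤ 1 → F ξ t ≤ P.M
  one : ∀ ξ, F ξ 1 = 0
  neg_one : ∀ ξ, F ξ (-1) = 0
  gamma_le : ∀ θ ∈ Ico (0 : ℝ) 1, ∀ ξ t, |t| ≤ θ → P.γ θ ≤ F ξ t
  growth : ∀ ξ t, P.ℓ < |t| → |t| < 1 → P.a * (1 - |t|) ^ P.d ≤ F ξ t
  continuousOn : ∀ ξ, ContinuousOn (F ξ) (Ioo (-1) 1)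
  locallyLipschitzOn : ∀ ξ, LocallyLipschitzOn (Ioo (-1) 1) (F ξ)
  differentiableOn : 0 < P.d → ∀ ξ, DifferentiableOn ℝ (F ξ) (Ioo (-1) 1)
  continuousOn_deriv : 0 < P.d → ∀ ξ, ContinuousOn (deriv (F ξ)) (Ioo (-1) 1)
  le_deriv : 0 < P.d → ∀ ξ s, 0 < s → s < P.ℓ →
    P.b * s ^ (P.d - 1) ≤ deriv (F ξ) (-1 + s)
  deriv_le : 0 < P.d → ∀ ξ s, 0 < s → s < P.ℓ →
    deriv (F ξ) (1 - s) ≤ -(P.b * s ^ (P.d - 1))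
  continuousOn_Icc : P.d = 2 → ∀ ξ, ContinuousOn (F ξ) (Icc (-1) 1)
  monotoneOn_left : P.d = 2 → ∀ ξ, MonotoneOn (deriv (F ξ)) (Ioo (-1) (-1 + P.κ))
  monotoneOn_right : P.d = 2 → ∀ ξ, MonotoneOn (deriv (F ξ)) (Ioo (1 - P.κ) 1)

end Heis

namespace Heis

variable {n : ℕ}

/-! Both parts rest on one comparison. With a cutoff ψ equal to 1 on a ball B_ρ and supported in
B_R, the competitor v = u - ψ²(1 + u) equals -1 on B_ρ, where it costs nothing, and equals u off
B_R. Minimality then bounds the energy in B_ρ by ∫ 4(1 + u)²|∇ψ|² + F(v) over the shell B_R \ B_ρ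
(`SatisfiesCaccioppoli.lintegral_ball_le`). For a shell of fixed thickness the integrand is bounded
and the volume is O(r^{Q-1}); this is (i).

For (ii), the reflection u ↦ -u, F(ξ, t) ↦ F(ξ, -t) reduces sublevel sets to superlevel sets. Let w
= F(u) + 1_{u ≥ θ}, let Y(ρ) be the integral of w over B_ρ, and let Z = Y(ρ + 2) - Y(ρ). Below the
level θ the potential dominates (1 + u)² because d ≤ 2, and F(v) ≤ C F(u) for -1 ≤ v ≤ u; at or
above θ the indicator dominates everything. So the shell integrand is at most a constant times w,
and the energy in B_{ρ+1} is O(Z).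

Let p = ζ(1 + u) with a second cutoff ζ, and f = 3p² - p³. Since f' = 3p(2 - p), the Modica–Mortola
trick bounds the L¹ variation of f by ∫ (p(2 - p))² + |∇p|² = O(Z). A weak isoperimetric inequality
(`mul_volume_le_of_translDist_le`) turns this into |B_ρ ∩ {u ≥ θ}| ≤ C S Z, for every integer S ≥ 1
with S^Q ≥ A Y(ρ + 2). Choosing S as small as possible gives a discrete form of Y ≤ C Y^{1/Q} Y'
(`exists_growth_step`), which forces Y(r) ≥ c r^Q (`exists_pow_le_of_growth_step`). By (i) the
potential part of Y is only O(r^{Q-1}), so the level set carries the remaining mass.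

The isoperimetric inequality uses only the L¹ distance between f and its right translates. Short
horizontal translates are controlled by the weak gradient. Any element of a box of size S is a
product of horizontal moves of total length O(S), the vertical one being a commutator, so its
translate costs O(S). If the mass of f is small compared with S^Q, averaging over the box bounds the
volume of {f ≥ c}. -/

/-! ### Group law and invariance of Lebesgue measure under translations. -/

theorem mul_mul_mul (a b c : Heis n) : mul (mul a b) c = mul a (mul b c) := by
  refine Prod.ext (by simp [mul, add_assoc]) (Prod.ext (by simp [mul, add_assoc]) ?_)
  have h : ∀ k, ((a.1 k + b.1 k) * c.2.1 k - (a.2.1 k + b.2.1 k) * c.1 k)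
      + (a.1 k * b.2.1 k - a.2.1 k * b.1 k)
      = (a.1 k * (b.2.1 k + c.2.1 k) - a.2.1 k * (b.1 k + c.1 k))
        + (b.1 k * c.2.1 k - b.2.1 k * c.1 k) := fun k => by ring
  have := Finset.sum_congr rfl fun k (_ : k ∈ Finset.univ) => h k
  simp only [Finset.sum_add_distrib] at this
  simp only [mul, Pi.add_apply]
  linarith

@[simp] theorem mul_zero_right (a : Heis n) : mul a 0 = a := by
  ext <;> simp [mul]

@[simp] theorem mul_zero_left (a : Heis n) : mul 0 a = a := by
  ext <;> simp [mul]

theorem inv_mul_cancel_left' (a b : Heis n) : mul (inv a) (mul a b) = b := by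
  rw [← mul_mul_mul, inv_mul_self, mul_zero_left]

theorem mul_inv_cancel_left' (a b : Heis n) : mul a (mul (inv a) b) = b := by
  rw [← mul_mul_mul, mul_inv_self, mul_zero_left]

theorem mul_inv_cancel_right' (a b : Heis n) : mul (mul a b) (inv b) = a := by
  rw [mul_mul_mul, mul_inv_self, mul_zero_right]

theorem inv_mul_cancel_right' (a b : Heis n) : mul (mul a (inv b)) b = a := by
  rw [mul_mul_mul, inv_mul_self, mul_zero_right]

@[fun_prop]
theorem continuous_mul_comp {X : Type*} [TopologicalSpace X] {f g : X → Heis n}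
    (hf : Continuous f) (hg : Continuous g) : Continuous fun x => mul (f x) (g x) := by
  unfold mul
  fun_prop

/-- Adding a vector, with a last component that depends on the others, preserves volume. -/
theorem measurePreserving_shear (a b : Fin n → ℝ) (c : (Fin n → ℝ) → (Fin n → ℝ) → ℝ)
    (hc : Continuous fun p : (Fin n → ℝ) × (Fin n → ℝ) => c p.1 p.2) :
    MeasurePreserving (fun ξ : Heis n => ((ξ.1 + a, ξ.2.1 + b, ξ.2.2 + c ξ.1 ξ.2.1) : Heis n))
      volume volume := by
  refine (measurePreserving_add_right volume a).skew_product (μc := volume) (μd := volume)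
    (g := fun x (p : (Fin n → ℝ) × ℝ) => (p.1 + b, p.2 + c x p.1)) ?_ ?_
  · refine Continuous.measurable ?_
    simp only [Function.uncurry_def]
    have : Continuous fun q : (Fin n → ℝ) × (Fin n → ℝ) × ℝ => c q.1 q.2.1 :=
      hc.comp (continuous_fst.prodMk (continuous_fst.comp continuous_snd))
    fun_prop
  · refine Filter.Eventually.of_forall fun x => ?_
    refine MeasurePreserving.map_eq (MeasurePreserving.skew_product
      (measurePreserving_add_right volume b) (g := fun y t => t + c x y) ?_ ?_)
    · refine Continuous.measurable ?_
      simp only [Function.uncurry_def]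
      have : Continuous fun q : (Fin n → ℝ) × ℝ => c x q.1 :=
        hc.comp (continuous_const.prodMk continuous_fst)
      fun_prop
    · exact Filter.Eventually.of_forall fun y => (measurePreserving_add_right volume _).map_eq

theorem measurePreserving_mul_right (η : Heis n) :
    MeasurePreserving (fun ξ : Heis n => mul ξ η) volume volume := by
  convert! measurePreserving_shear η.1 η.2.1
    (fun x y => η.2.2 + 2 * ∑ k, (x k * η.2.1 k - y k * η.1 k)) (by fun_prop) using 2
  simp [mul, add_assoc]

theorem measurePreserving_mul_left (η : Heis n) :
    MeasurePreserving (fun ξ : Heis n => mul η ξ) volume volume := by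
  convert! measurePreserving_shear η.1 η.2.1
    (fun x y => η.2.2 + 2 * ∑ k, (η.1 k * y k - η.2.1 k * x k)) (by fun_prop) using 2
  simp [mul, add_assoc, add_comm, add_left_comm]

/-- Right multiplication as a homeomorphism. -/
def mulRight (η : Heis n) : Heis n ≃ₜ Heis n where
  toFun ξ := mul ξ η
  invFun ξ := mul ξ (inv η)
  left_inv ξ := mul_inv_cancel_right' ξ η
  right_inv ξ := inv_mul_cancel_right' ξ η
  continuous_toFun := by fun_prop
  continuous_invFun := by fun_prop

/-- Left multiplication as a homeomorphism. -/
def mulLeft (η : Heis n) : Heis n ≃ₜ Heis n where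
  toFun ξ := mul η ξ
  invFun ξ := mul (inv η) ξ
  left_inv ξ := inv_mul_cancel_left' η ξ
  right_inv ξ := mul_inv_cancel_left' η ξ
  continuous_toFun := by fun_prop
  continuous_invFun := by fun_prop

/-! ### Korányi balls: compactness, volume, shells. -/

/-- The squared Euclidean norm of the horizontal part. -/
def normSqZ (ξ : Heis n) : ℝ := ∑ k, (ξ.1 k ^ 2 + ξ.2.1 k ^ 2)

/-- The fourth power of the homogeneous norm, a polynomial. -/
def quartic (ξ : Heis n) : ℝ := normSqZ ξ ^ 2 + ξ.2.2 ^ 2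

theorem normSqZ_nonneg (ξ : Heis n) : 0 ≤ normSqZ ξ :=
  Finset.sum_nonneg fun _ _ => by positivity

theorem quartic_nonneg (ξ : Heis n) : 0 ≤ quartic ξ := by
  unfold quartic; positivity

theorem quartic_inv (ξ : Heis n) : quartic (inv ξ) = quartic ξ := by
  simp [quartic, normSqZ, inv]

theorem inv_mul_eq (ξ ξ₀ : Heis n) : mul (inv ξ) ξ₀ = inv (mul (inv ξ₀) ξ) := by
  refine Prod.ext ?_ (Prod.ext ?_ ?_)
  · simp [mul, inv]
  · simp [mul, inv]
  · simp only [mul, inv, Prod.snd_neg, Prod.fst_neg, Pi.neg_apply]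
    have : ∑ k, (-ξ.1 k * ξ₀.2.1 k - -ξ.2.1 k * ξ₀.1 k)
        = - ∑ k, (-ξ₀.1 k * ξ.2.1 k - -ξ₀.2.1 k * ξ.1 k) := by
      rw [← Finset.sum_neg_distrib]
      exact Finset.sum_congr rfl fun k _ => by ring
    rw [this]; ring

/-- The elements ξ⁻¹ξ₀ and ξ₀⁻¹ξ are inverse to each other and the quartic is even. In this form a
ball is visibly a left translate of a ball at the origin, cut out by a polynomial. -/
theorem mem_ball_iff {ξ₀ ξ : Heis n} {r : ℝ} (hr : 0 ≤ r) :
    ξ ∈ ball ξ₀ r ↔ quartic (mul (inv ξ₀) ξ) ≤ r ^ 4 := by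
  have h : koranyiNorm (mul (inv ξ) ξ₀) = quartic (mul (inv ξ₀) ξ) ^ (1 / 4 : ℝ) := by
    rw [inv_mul_eq, ← quartic_inv (mul (inv ξ₀) ξ)]; rfl
  have hq := quartic_nonneg (mul (inv ξ₀) ξ)
  change koranyiNorm (mul (inv ξ) ξ₀) ≤ r ↔ _
  rw [h]
  rw [one_div, Real.rpow_inv_le_iff_of_pos hq hr (by norm_num)]
  norm_cast

theorem continuous_quartic : Continuous (quartic : Heis n → ℝ) := by
  unfold quartic normSqZ; fun_prop

theorem ball_subset_ball {ξ₀ : Heis n} {r s : ℝ} (h : r ≤ s) : ball ξ₀ r ⊆ ball ξ₀ s :=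
  fun _ hξ => le_trans hξ h

theorem isCompact_ball (ξ₀ : Heis n) {r : ℝ} (hr : 0 ≤ r) : IsCompact (ball ξ₀ r) := by
  have h0 : IsCompact {ξ : Heis n | quartic ξ ≤ r ^ 4} := by
    refine Metric.isCompact_of_isClosed_isBounded
      (isClosed_le continuous_quartic continuous_const) ?_
    refine (Metric.isBounded_closedBall (x := (0 : Heis n)) (r := r + r ^ 2)).subset ?_
    intro ξ hξ
    have hq : normSqZ ξ ^ 2 + ξ.2.2 ^ 2 ≤ r ^ 4 := hξ
    have hZ : normSqZ ξ ≤ r ^ 2 := by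
      refine le_of_sq_le_sq (by nlinarith [sq_nonneg ξ.2.2]) (by positivity)
    have hk : ∀ k, ξ.1 k ^ 2 + ξ.2.1 k ^ 2 ≤ r ^ 2 := fun k =>
      (Finset.single_le_sum (f := fun k => ξ.1 k ^ 2 + ξ.2.1 k ^ 2)
        (fun _ _ => by positivity) (Finset.mem_univ k)).trans hZ
    have ht : |ξ.2.2| ≤ r ^ 2 := abs_le_of_sq_le_sq (by nlinarith [sq_nonneg (normSqZ ξ)])
      (by positivity)
    rw [mem_closedBall_zero_iff, Prod.norm_def, Prod.norm_def]
    have h2 : 0 ≤ r ^ 2 := by positivity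
    refine max_le ?_ (max_le ?_ ?_)
    · refine (pi_norm_le_iff_of_nonneg (by positivity)).2 fun k => ?_
      have := abs_le_of_sq_le_sq (a := ξ.1 k) (b := r) (by nlinarith [hk k, sq_nonneg (ξ.2.1 k)]) hr
      rw [Real.norm_eq_abs]; linarith
    · refine (pi_norm_le_iff_of_nonneg (by positivity)).2 fun k => ?_
      have := abs_le_of_sq_le_sq (a := ξ.2.1 k) (b := r) (by nlinarith [hk k, sq_nonneg (ξ.1 k)]) hr
      rw [Real.norm_eq_abs]; linarith
    · rw [Real.norm_eq_abs]; linarith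
  have h1 : ball ξ₀ r = mulLeft (inv ξ₀) ⁻¹' {ξ : Heis n | quartic ξ ≤ r ^ 4} := by
    ext ξ; exact mem_ball_iff hr
  rw [h1]
  exact (mulLeft (inv ξ₀)).isCompact_preimage.2 h0

theorem measurableSet_ball (ξ₀ : Heis n) {r : ℝ} (hr : 0 ≤ r) : MeasurableSet (ball ξ₀ r) :=
  (isCompact_ball ξ₀ hr).isClosed.measurableSet

theorem volume_ball_eq_zero_center (ξ₀ : Heis n) {r : ℝ} (hr : 0 ≤ r) :
    volume (ball ξ₀ r) = volume (ball (0 : Heis n) r) := by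
  have h1 : ball ξ₀ r = (fun ξ => mul (inv ξ₀) ξ) ⁻¹' ball (0 : Heis n) r := by
    ext ξ
    rw [mem_preimage, mem_ball_iff hr, mem_ball_iff hr]
    simp [inv]
  rw [h1, (measurePreserving_mul_left (inv ξ₀)).measure_preimage
    (measurableSet_ball 0 hr).nullMeasurableSet]

/-- The anisotropic dilation `(z, t) ↦ (c z, c² t)`. -/
def dilation (c : ℝ) : Heis n →ₗ[ℝ] Heis n :=
  (c • LinearMap.id).prodMap ((c • LinearMap.id).prodMap (c ^ 2 • LinearMap.id))

theorem det_dilation (c : ℝ) : LinearMap.det (dilation c : Heis n →ₗ[ℝ] Heis n) = c ^ homDim n := by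
  rw [dilation, LinearMap.det_prodMap, LinearMap.det_prodMap]
  simp only [LinearMap.det_smul, LinearMap.det_id, homDim]
  simp
  ring

theorem quartic_dilation (c : ℝ) (ξ : Heis n) : quartic (dilation c ξ) = c ^ 4 * quartic ξ := by
  have : normSqZ (dilation c ξ) = c ^ 2 * normSqZ ξ := by
    simp only [normSqZ, dilation, Finset.mul_sum]
    exact Finset.sum_congr rfl fun k _ => by simp; ring
  simp only [quartic, this]
  simp [dilation]; ring

instance isAddHaarMeasure_volume : (volume : Measure (Heis n)).IsAddHaarMeasure :=
  haveI : (volume : Measure ((Fin n → ℝ) × ℝ)).IsAddHaarMeasure :=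
    Measure.prod.instIsAddHaarMeasure _ _
  Measure.prod.instIsAddHaarMeasure _ _

/-- Left translation moves the centre to the origin, and the dilation by 1/r, of determinant r^{-Q},
carries the ball to the unit ball. -/
theorem volume_ball (ξ₀ : Heis n) {r : ℝ} (hr : 0 < r) :
    volume (ball ξ₀ r) = ENNReal.ofReal (r ^ homDim n) * volume (ball (0 : Heis n) 1) := by
  have h1 : ball (0 : Heis n) r = dilation r⁻¹ ⁻¹' ball (0 : Heis n) 1 := by
    ext ξ
    rw [mem_preimage, mem_ball_iff hr.le, mem_ball_iff zero_le_one]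
    simp only [inv, neg_zero, mul_zero_left, quartic_dilation, one_pow]
    rw [inv_pow, inv_mul_le_iff₀ (by positivity), mul_one]
  rw [volume_ball_eq_zero_center ξ₀ hr.le, h1, Measure.addHaar_preimage_linearMap, det_dilation]
  · rw [inv_pow, inv_inv, abs_of_nonneg (by positivity)]
  · rw [det_dilation]; positivity

theorem exists_volume_ball (n : ℕ) : ∃ v₁ : ℝ, 0 ≤ v₁ ∧ ∀ (ξ₀ : Heis n) (r : ℝ), 0 < r →
    volume (ball ξ₀ r) = ENNReal.ofReal (v₁ * r ^ homDim n) := by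
  refine ⟨(volume (ball (0 : Heis n) 1)).toReal, ENNReal.toReal_nonneg, fun ξ₀ r hr => ?_⟩
  rw [volume_ball ξ₀ hr, ENNReal.ofReal_mul ENNReal.toReal_nonneg, mul_comm, ENNReal.ofReal_toReal]
  exact (isCompact_ball 0 zero_le_one).measure_lt_top.ne

/-- The volume of a shell of fixed thickness is of lower order. -/
theorem exists_volume_shell_le (n : ℕ) {δ : ℝ} (hδ : 0 < δ) :
    ∃ C : ℝ, 0 ≤ C ∧ ∀ (ξ₀ : Heis n) (r : ℝ), 1 ≤ r →
      volume (ball ξ₀ (r + δ) \ ball ξ₀ r) ≤ ENNReal.ofReal (C * r ^ (homDim n - 1)) := by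
  obtain ⟨v₁, hv₁, hvol⟩ := exists_volume_ball n
  refine ⟨v₁ * (δ * homDim n * (1 + δ) ^ (homDim n - 1)), by positivity, fun ξ₀ r hr => ?_⟩
  have hr0 : 0 < r := by linarith
  rw [measure_sdiff (ball_subset_ball (by linarith))
    (measurableSet_ball ξ₀ hr0.le).nullMeasurableSet
    (isCompact_ball ξ₀ hr0.le).measure_lt_top.ne, hvol ξ₀ _ (by linarith), hvol ξ₀ r hr0,
    ← ENNReal.ofReal_sub _ (by positivity)]
  refine ENNReal.ofReal_le_ofReal ?_
  have key : (r + δ) ^ homDim n - r ^ homDim n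
      ≤ δ * homDim n * (r + δ) ^ (homDim n - 1) := by
    have := abs_pow_sub_pow_le (r + δ) r (homDim n)
    rw [add_sub_cancel_left, abs_of_pos hδ, abs_of_pos hr0, abs_of_pos (by linarith : 0 < r + δ),
      max_eq_left (by linarith)] at this
    exact (le_abs_self _).trans this
  have h2 : (r + δ) ^ (homDim n - 1) ≤ ((1 + δ) * r) ^ (homDim n - 1) :=
    pow_le_pow_left₀ (by positivity) (by nlinarith) _
  rw [mul_pow] at h2
  calc v₁ * (r + δ) ^ homDim n - v₁ * r ^ homDim n
      = v₁ * ((r + δ) ^ homDim n - r ^ homDim n) := by ring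
    _ ≤ v₁ * (δ * homDim n * ((1 + δ) ^ (homDim n - 1) * r ^ (homDim n - 1))) := by
        gcongr
        exact key.trans (by gcongr)
    _ = _ := by ring

/-! ### Horizontal derivatives of smooth functions. -/

/-- The derivative of `φ` along the horizontal field with index `j`. -/
noncomputable abbrev hderiv (j : Fin n ⊕ Fin n) (φ : Heis n → ℝ) (ξ : Heis n) : ℝ :=
  fderiv ℝ φ ξ (field j ξ)

/-- The classical horizontal gradient. -/
noncomputable def hgrad (φ : Heis n → ℝ) (ξ : Heis n) : EuclideanSpace ℝ (Fin n ⊕ Fin n) :=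
  WithLp.toLp 2 fun j => hderiv j φ ξ

@[simp] theorem hgrad_apply (φ : Heis n → ℝ) (ξ : Heis n) (j : Fin n ⊕ Fin n) :
    hgrad φ ξ j = hderiv j φ ξ := rfl

theorem continuous_field (j : Fin n ⊕ Fin n) : Continuous (field j) := by
  rcases j with k | k
  · change Continuous fun ξ : Heis n => ((Pi.single k 1, 0, -2 * ξ.2.1 k) : Heis n)
    fun_prop
  · change Continuous fun ξ : Heis n => ((0, Pi.single k 1, 2 * ξ.1 k) : Heis n)
    fun_prop

theorem continuous_hderiv (j : Fin n ⊕ Fin n) {φ : Heis n → ℝ} (hφ : ContDiff ℝ ∞ φ) :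
    Continuous (hderiv j φ) :=
  (hφ.continuous_fderiv (by simp)).clm_apply (continuous_field j)

theorem hderiv_eq_zero_of_notMem (j : Fin n ⊕ Fin n) {φ : Heis n → ℝ} {ξ : Heis n}
    (h : ξ ∉ tsupport φ) : hderiv j φ ξ = 0 := by
  have : fderiv ℝ φ ξ = 0 := by
    by_contra h'
    exact h (support_fderiv_subset ℝ h')
  simp [hderiv, this]

theorem continuous_hgrad {φ : Heis n → ℝ} (hφ : ContDiff ℝ ∞ φ) : Continuous (hgrad φ) :=
  (PiLp.continuous_toLp 2 _).comp (continuous_pi fun j => continuous_hderiv j hφ)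

theorem hgrad_eq_zero_of_notMem {φ : Heis n → ℝ} {ξ : Heis n}
    (h : ξ ∉ tsupport φ) : hgrad φ ξ = 0 := by
  ext j; exact hderiv_eq_zero_of_notMem j h

theorem hderiv_mul (j : Fin n ⊕ Fin n) {φ ψ : Heis n → ℝ} (hφ : ContDiff ℝ ∞ φ)
    (hψ : ContDiff ℝ ∞ ψ) (ξ : Heis n) :
    hderiv j (fun ξ => φ ξ * ψ ξ) ξ = φ ξ * hderiv j ψ ξ + ψ ξ * hderiv j φ ξ := by
  have h1 := (hφ.differentiable (by simp)).differentiableAt (x := ξ)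
  have h2 := (hψ.differentiable (by simp)).differentiableAt (x := ξ)
  simp [hderiv, fderiv_fun_mul h1 h2]

theorem hasCompactSupport_hderiv (j : Fin n ⊕ Fin n) {φ : Heis n → ℝ} (hφ : HasCompactSupport φ) :
    HasCompactSupport (hderiv j φ) :=
  HasCompactSupport.intro hφ fun _ h => hderiv_eq_zero_of_notMem j h

theorem integrable_hderiv (j : Fin n ⊕ Fin n) {φ : Heis n → ℝ} (hφ : ContDiff ℝ ∞ φ)
    (hc : HasCompactSupport φ) : Integrable (hderiv j φ) :=
  (continuous_hderiv j hφ).integrable_of_hasCompactSupport (hasCompactSupport_hderiv j hc)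

/-- A linear function times a directional derivative, in a direction in which the linear function
is constant, has vanishing integral. -/
theorem integral_clm_mul_fderiv_eq_zero {φ : Heis n → ℝ} (hφ : ContDiff ℝ ∞ φ)
    (hc : HasCompactSupport φ) (L : Heis n → ℝ) (hL : ContDiff ℝ ∞ L) (v : Heis n)
    (hv : ∀ ξ, fderiv ℝ L ξ v = 0) : ∫ ξ, L ξ * fderiv ℝ φ ξ v = 0 := by
  have hcont : Continuous fun ξ => fderiv ℝ φ ξ v :=
    (hφ.continuous_fderiv (by simp)).clm_apply continuous_const
  rw [integral_mul_fderiv_eq_neg_fderiv_mul_of_integrable]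
  · simp [hv]
  · simp [hv]
  · refine (hL.continuous.mul hcont).integrable_of_hasCompactSupport
      (HasCompactSupport.intro hc fun ξ h => ?_)
    have : fderiv ℝ φ ξ = 0 := by
      by_contra h'
      exact h (support_fderiv_subset ℝ h')
    simp [this]
  · exact (hL.continuous.mul hφ.continuous).integrable_of_hasCompactSupport hc.mul_left
  · exact fun ξ _ => (hL.differentiable (by simp)).differentiableAt
  · exact fun ξ _ => (hφ.differentiable (by simp)).differentiableAt

theorem integral_hderiv_eq_zero (j : Fin n ⊕ Fin n) {φ : Heis n → ℝ} (hφ : ContDiff ℝ ∞ φ)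
    (hc : HasCompactSupport φ) : ∫ ξ, hderiv j φ ξ = 0 := by
  -- Each field is a constant vector plus L ∂_t with ∂_t L = 0. This is why it is divergence free.
  have split : ∃ (L : Heis n → ℝ) (v : Heis n), ContDiff ℝ ∞ L ∧
      (∀ ξ, fderiv ℝ L ξ (0, 0, 1) = 0) ∧ ∀ ξ, field j ξ = v + L ξ • (0, 0, 1) := by
    rcases j with k | k
    · refine ⟨fun ξ => -2 * ξ.2.1 k, (Pi.single k 1, 0, 0), by fun_prop, fun ξ => ?_, fun ξ => ?_⟩
      · rw [← DifferentiableAt.lineDeriv_eq_fderiv (by fun_prop)]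
        simp [lineDeriv]
      · simp [field]
    · refine ⟨fun ξ => 2 * ξ.1 k, (0, Pi.single k 1, 0), by fun_prop, fun ξ => ?_, fun ξ => ?_⟩
      · rw [← DifferentiableAt.lineDeriv_eq_fderiv (by fun_prop)]
        simp [lineDeriv]
      · simp [field]
  obtain ⟨L, v, hL, hL0, hf⟩ := split
  have h1 := integral_clm_mul_fderiv_eq_zero hφ hc L hL _ hL0
  have h2 := integral_clm_mul_fderiv_eq_zero hφ hc (fun _ => 1) contDiff_const v (by simp)
  have hcont : ∀ w, Continuous fun ξ => fderiv ℝ φ ξ w := fun w =>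
    (hφ.continuous_fderiv (by simp)).clm_apply continuous_const
  have hsupp : ∀ ξ, ξ ∉ tsupport φ → fderiv ℝ φ ξ = 0 := fun ξ h => by
    by_contra h'
    exact h (support_fderiv_subset ℝ h')
  simp only [hderiv, hf, map_add, map_smul, smul_eq_mul]
  rw [integral_add, h1]
  · simpa using h2
  · exact (hcont v).integrable_of_hasCompactSupport
      (HasCompactSupport.intro hc fun ξ h => by simp [hsupp ξ h])
  · exact (hL.continuous.mul (hcont _)).integrable_of_hasCompactSupport
      (HasCompactSupport.intro hc fun ξ h => by simp [hsupp ξ h])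

/-! ### Calculus of weak horizontal gradients. -/

theorem IsWeakGrad.mono {U V : Set (Heis n)} {u : Heis n → ℝ}
    {G : Heis n → EuclideanSpace ℝ (Fin n ⊕ Fin n)} (h : IsWeakGrad U u G) (hVU : V ⊆ U) :
    IsWeakGrad V u G := by
  refine ⟨h.locallyIntegrable.mono_set hVU, h.locallyIntegrable_grad.mono_set hVU,
    fun φ hφ hc hs j => ?_⟩
  have := h.integral_eq φ hφ hc (hs.trans hVU) j
  rw [setIntegral_eq_integral_of_forall_compl_eq_zero, setIntegral_eq_integral_of_forall_compl_eq_zero]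
  · rw [setIntegral_eq_integral_of_forall_compl_eq_zero,
      setIntegral_eq_integral_of_forall_compl_eq_zero] at this
    · exact this
    · intro ξ hξ
      rw [image_eq_zero_of_notMem_tsupport (fun h' => hξ (hVU (hs h'))), mul_zero]
    · intro ξ hξ
      rw [← hderiv, hderiv_eq_zero_of_notMem j (fun h' => hξ (hVU (hs h'))), mul_zero]
  · intro ξ hξ
    rw [image_eq_zero_of_notMem_tsupport (fun h' => hξ (hs h')), mul_zero]
  · intro ξ hξ
    rw [← hderiv, hderiv_eq_zero_of_notMem j (fun h' => hξ (hs h')), mul_zero]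

theorem locallyIntegrableOn_congr_ae {E : Type*} [NormedAddCommGroup E] {U : Set (Heis n)}
    {f g : Heis n → E} (h : f =ᵐ[volume.restrict U] g)
    (hf : LocallyIntegrableOn f U) : LocallyIntegrableOn g U := by
  intro ξ hξ
  obtain ⟨s, hs, hfs⟩ := hf ξ hξ
  refine ⟨s ∩ U, Filter.inter_mem hs self_mem_nhdsWithin, ?_⟩
  exact (hfs.mono_set inter_subset_left).congr
    (ae_restrict_of_ae_restrict_of_subset inter_subset_right h)

theorem IsWeakGrad.congr {U : Set (Heis n)} {u v : Heis n → ℝ}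
    {G H : Heis n → EuclideanSpace ℝ (Fin n ⊕ Fin n)} (h : IsWeakGrad U u G)
    (huv : u =ᵐ[volume.restrict U] v) (hGH : G =ᵐ[volume.restrict U] H) :
    IsWeakGrad U v H := by
  refine ⟨locallyIntegrableOn_congr_ae huv h.locallyIntegrable,
    locallyIntegrableOn_congr_ae hGH h.locallyIntegrable_grad, fun φ hφ hc hs j => ?_⟩
  have h1 : ∫ ξ in U, v ξ * fderiv ℝ φ ξ (field j ξ) = ∫ ξ in U, u ξ * fderiv ℝ φ ξ (field j ξ) :=
    integral_congr_ae (by filter_upwards [huv] with ξ h; rw [h])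
  have h2 : ∫ ξ in U, H ξ j * φ ξ = ∫ ξ in U, G ξ j * φ ξ :=
    integral_congr_ae (by filter_upwards [hGH] with ξ h; rw [h])
  rw [h1, h2]
  exact h.integral_eq φ hφ hc hs j

theorem integrableOn_mul_of_locallyIntegrableOn {U : Set (Heis n)}
    {f φ : Heis n → ℝ}
    (hf : LocallyIntegrableOn f U) (hφ : Continuous φ) (hc : HasCompactSupport φ)
    (hs : tsupport φ ⊆ U) : IntegrableOn (fun ξ => f ξ * φ ξ) U := by
  have h1 : IntegrableOn (fun ξ => f ξ * φ ξ) (tsupport φ) :=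
    (hf.integrableOn_compact_subset hs hc).mul_continuousOn hφ.continuousOn hc
  have h2 : Integrable (fun ξ => f ξ * φ ξ) := by
    rwa [integrableOn_iff_integrable_of_support_subset] at h1
    intro ξ hξ
    by_contra h
    exact hξ (by simp [image_eq_zero_of_notMem_tsupport h])
  exact h2.integrableOn

theorem locallyIntegrableOn_apply {U : Set (Heis n)}
    {G : Heis n → EuclideanSpace ℝ (Fin n ⊕ Fin n)}
    (h : LocallyIntegrableOn G U) (j : Fin n ⊕ Fin n) :
    LocallyIntegrableOn (fun ξ => G ξ j) U := by
  intro ξ hξ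
  obtain ⟨s, hs, hfs⟩ := h ξ hξ
  exact ⟨s, hs, (EuclideanSpace.proj (𝕜 := ℝ) j).integrable_comp hfs⟩

theorem IsWeakGrad.add {U : Set (Heis n)} {u v : Heis n → ℝ}
    {G H : Heis n → EuclideanSpace ℝ (Fin n ⊕ Fin n)} (hu : IsWeakGrad U u G)
    (hv : IsWeakGrad U v H) : IsWeakGrad U (u + v) (G + H) := by
  refine ⟨hu.locallyIntegrable.add hv.locallyIntegrable,
    hu.locallyIntegrable_grad.add hv.locallyIntegrable_grad, fun φ hφ hc hs j => ?_⟩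
  have hX : ∀ {f : Heis n → ℝ}, LocallyIntegrableOn f U →
      IntegrableOn (fun ξ => f ξ * fderiv ℝ φ ξ (field j ξ)) U := fun hf =>
    integrableOn_mul_of_locallyIntegrableOn hf (continuous_hderiv j hφ)
      (hasCompactSupport_hderiv j hc)
      ((closure_minimal (fun ξ h => by
        by_contra h'; exact h (hderiv_eq_zero_of_notMem j h')) (isClosed_tsupport φ)).trans hs)
  have hY : ∀ {f : Heis n → ℝ}, LocallyIntegrableOn f U →
      IntegrableOn (fun ξ => f ξ * φ ξ) U := fun hf =>
    integrableOn_mul_of_locallyIntegrableOn hf hφ.continuous hc hs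
  simp only [Pi.add_apply, PiLp.add_apply, add_mul]
  rw [integral_add (hX hu.locallyIntegrable) (hX hv.locallyIntegrable),
    integral_add (hY (locallyIntegrableOn_apply hu.locallyIntegrable_grad j))
      (hY (locallyIntegrableOn_apply hv.locallyIntegrable_grad j)),
    hu.integral_eq φ hφ hc hs j, hv.integral_eq φ hφ hc hs j]
  ring

theorem IsWeakGrad.neg {U : Set (Heis n)} {u : Heis n → ℝ}
    {G : Heis n → EuclideanSpace ℝ (Fin n ⊕ Fin n)} (hu : IsWeakGrad U u G) :
    IsWeakGrad U (-u) (-G) := by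
  refine ⟨hu.locallyIntegrable.neg, hu.locallyIntegrable_grad.neg, fun φ hφ hc hs j => ?_⟩
  simp only [Pi.neg_apply, PiLp.neg_apply, neg_mul, integral_neg]
  rw [hu.integral_eq φ hφ hc hs j]

theorem IsWeakGrad.ae_eq {U : Set (Heis n)} (hU : IsOpen U) {u : Heis n → ℝ}
    {G H : Heis n → EuclideanSpace ℝ (Fin n ⊕ Fin n)} (hG : IsWeakGrad U u G)
    (hH : IsWeakGrad U u H) : G =ᵐ[volume.restrict U] H := by
  have key : ∀ j, ∀ᵐ ξ, ξ ∈ U → G ξ j - H ξ j = 0 := fun j => by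
    refine hU.ae_eq_zero_of_integral_contDiff_smul_eq_zero
      ((locallyIntegrableOn_apply hG.locallyIntegrable_grad j).sub
        (locallyIntegrableOn_apply hH.locallyIntegrable_grad j)) fun φ hφ hc hs => ?_
    have h1 := hG.integral_eq φ hφ hc hs j
    rw [hH.integral_eq φ hφ hc hs j, neg_inj] at h1
    have h2 : ∫ ξ in U, (H ξ j * φ ξ - G ξ j * φ ξ) = 0 := by
      rw [integral_sub, h1, sub_self]
      · exact integrableOn_mul_of_locallyIntegrableOn
          (locallyIntegrableOn_apply hH.locallyIntegrable_grad j) hφ.continuous hc hs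
      · exact integrableOn_mul_of_locallyIntegrableOn
          (locallyIntegrableOn_apply hG.locallyIntegrable_grad j) hφ.continuous hc hs
    rw [setIntegral_eq_integral_of_forall_compl_eq_zero] at h2
    · rw [← neg_eq_zero, ← integral_neg, ← h2]
      exact integral_congr_ae (Filter.Eventually.of_forall fun ξ => by simp; ring)
    · intro ξ hξ
      simp [image_eq_zero_of_notMem_tsupport (fun h' => hξ (hs h'))]
  rw [Filter.EventuallyEq, ae_restrict_iff' hU.measurableSet]
  filter_upwards [ae_all_iff.2 key] with ξ h hξ
  ext j
  exact sub_eq_zero.1 (h j hξ)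

/-- Leibniz rule for `ψ (1 + u)`, with a smooth cutoff `ψ` supported where `u` is weakly
differentiable. -/
theorem IsWeakGrad.cutoff_mul {U : Set (Heis n)} {u ψ : Heis n → ℝ}
    {G : Heis n → EuclideanSpace ℝ (Fin n ⊕ Fin n)} (hu : IsWeakGrad U u G)
    (hψ : ContDiff ℝ ∞ ψ) (hψc : HasCompactSupport ψ) (hψU : tsupport ψ ⊆ U) :
    Integrable (fun ξ => ψ ξ * (1 + u ξ)) ∧
    Integrable (fun ξ => ψ ξ • G ξ + (1 + u ξ) • hgrad ψ ξ) ∧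
    IsWeakGrad univ (fun ξ => ψ ξ * (1 + u ξ))
      (fun ξ => ψ ξ • G ξ + (1 + u ξ) • hgrad ψ ξ) := by
  have h1u : LocallyIntegrableOn (fun ξ => 1 + u ξ) U :=
    (locallyIntegrable_const (1 : ℝ)).locallyIntegrableOn U |>.add hu.locallyIntegrable
  have hi1 : Integrable (fun ξ => ψ ξ * (1 + u ξ)) := by
    have := (h1u.integrableOn_compact_subset hψU hψc).continuousOn_mul
      hψ.continuous.continuousOn hψc
    rwa [integrableOn_iff_integrable_of_support_subset] at this
    intro ξ hξ
    by_contra h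
    exact hξ (by simp [image_eq_zero_of_notMem_tsupport h])
  have hi2 : Integrable (fun ξ => ψ ξ • G ξ + (1 + u ξ) • hgrad ψ ξ) := by
    have ha := (hu.locallyIntegrable_grad.integrableOn_compact_subset hψU hψc).continuousOn_smul
      hψ.continuous.continuousOn hψc
    have hb := (h1u.integrableOn_compact_subset hψU hψc).smul_continuousOn
      (continuous_hgrad hψ).continuousOn hψc
    have := ha.add hb
    rwa [integrableOn_iff_integrable_of_support_subset] at this
    intro ξ hξ
    by_contra h
    exact hξ (by simp [image_eq_zero_of_notMem_tsupport h, hgrad_eq_zero_of_notMem h])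
  refine ⟨hi1, hi2, hi1.locallyIntegrable.locallyIntegrableOn _,
    hi2.locallyIntegrable.locallyIntegrableOn _, fun φ hφ hc _ j => ?_⟩
  rw [setIntegral_univ, setIntegral_univ]
  have hsψφ : tsupport (fun ξ => ψ ξ * φ ξ) ⊆ U :=
    (tsupport_mul_subset_left (f := ψ) (g := φ)).trans hψU
  have hcψφ : HasCompactSupport (fun ξ => ψ ξ * φ ξ) := hψc.mul_right
  have hmul := hu.integral_eq (fun ξ => ψ ξ * φ ξ) (hψ.mul hφ) hcψφ hsψφ j
  -- The summand 1 in 1 + u is tested against X(ψφ), whose integral vanishes; the summand u is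
  -- tested with the definition of its weak gradient, as ψφ is supported in U.
  have hzero := integral_hderiv_eq_zero j (hψ.mul hφ) hcψφ
  rw [setIntegral_eq_integral_of_forall_compl_eq_zero,
      setIntegral_eq_integral_of_forall_compl_eq_zero] at hmul
  rotate_left
  · intro ξ hξ
    simp [image_eq_zero_of_notMem_tsupport (fun h' => hξ (hψU h'))]
  · intro ξ hξ
    rw [← hderiv, hderiv_eq_zero_of_notMem j (fun h' => hξ (hsψφ h')), mul_zero]
  have hK : ∀ {f ζ : Heis n → ℝ}, LocallyIntegrableOn f U → Continuous ζ →
      (∀ ξ, ξ ∉ tsupport ψ → ζ ξ = 0) → Integrable fun ξ => f ξ * ζ ξ := by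
    intro f ζ hf hζ h0
    have := (hf.integrableOn_compact_subset hψU hψc).mul_continuousOn hζ.continuousOn hψc
    rwa [integrableOn_iff_integrable_of_support_subset] at this
    intro ξ hξ
    by_contra h
    exact hξ (by simp [h0 ξ h])
  have hc1 := continuous_hderiv j (hψ.mul hφ)
  have hc2 := continuous_hderiv j hψ
  have ia : Integrable fun ξ => u ξ * hderiv j (fun ξ => ψ ξ * φ ξ) ξ :=
    hK hu.locallyIntegrable hc1 fun ξ h => hderiv_eq_zero_of_notMem j
      (fun h' => h (tsupport_mul_subset_left (f := ψ) (g := φ) h'))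
  have ib : Integrable fun ξ => (1 + u ξ) * (φ ξ * hderiv j ψ ξ) :=
    hK h1u (hφ.continuous.mul hc2) fun ξ h => by rw [hderiv_eq_zero_of_notMem j h, mul_zero]
  have ic : Integrable fun ξ => G ξ j * (ψ ξ * φ ξ) :=
    hK (locallyIntegrableOn_apply hu.locallyIntegrable_grad j) (hψ.continuous.mul hφ.continuous)
      fun ξ h => by simp [image_eq_zero_of_notMem_tsupport h]
  have id' := integrable_hderiv j (hψ.mul hφ) hcψφ
  have e1 : ∫ ξ, ψ ξ * (1 + u ξ) * fderiv ℝ φ ξ (field j ξ)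
      = ∫ ξ, (hderiv j (fun ξ => ψ ξ * φ ξ) ξ + u ξ * hderiv j (fun ξ => ψ ξ * φ ξ) ξ
          - (1 + u ξ) * (φ ξ * hderiv j ψ ξ)) := by
    refine integral_congr_ae (Filter.Eventually.of_forall fun ξ => ?_)
    simp only [hderiv_mul j hψ hφ ξ]
    ring
  have e2 : ∫ ξ, (ψ ξ • G ξ + (1 + u ξ) • hgrad ψ ξ) j * φ ξ
      = ∫ ξ, (G ξ j * (ψ ξ * φ ξ) + (1 + u ξ) * (φ ξ * hderiv j ψ ξ)) := by
    refine integral_congr_ae (Filter.Eventually.of_forall fun ξ => ?_)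
    simp
    ring
  have iai : Integrable fun ξ => hderiv j (fun ξ => ψ ξ * φ ξ) ξ
      + u ξ * hderiv j (fun ξ => ψ ξ * φ ξ) ξ := id'.add ia
  rw [e1, e2, integral_sub iai ib, integral_add id' ia, hzero, integral_add ic ib]
  rw [hmul]
  ring

/-! ### Smooth cutoffs with horizontal gradient bounded independently of the radius. -/

theorem contDiff_quartic_mul (ζ : Heis n) : ContDiff ℝ ∞ fun ξ => quartic (mul ζ ξ) := by
  unfold quartic normSqZ mul
  simp only [Pi.add_apply]
  fun_prop

/-- Along a horizontal line |z|² becomes |z|² + 2sp + s² and t becomes t + 2sq, where p and q are,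
up to sign, coordinates of z. The derivative 4|z|²p + 4tq has homogeneous degree 3, whence the bound
8R³ in the ball of radius R. -/
theorem hasDerivAt_quartic_add_smul_field (j : Fin n ⊕ Fin n) (ζ : Heis n) :
    ∃ D : ℝ, HasDerivAt (fun s : ℝ => quartic (ζ + s • field j ζ)) D 0 ∧
      ∀ R : ℝ, 0 ≤ R → quartic ζ ≤ R ^ 4 → |D| ≤ 8 * R ^ 3 := by
  have bounds : ∀ R : ℝ, 0 ≤ R → quartic ζ ≤ R ^ 4 → normSqZ ζ ≤ R ^ 2 ∧ |ζ.2.2| ≤ R ^ 2 ∧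
      ∀ k, |ζ.1 k| ≤ R ∧ |ζ.2.1 k| ≤ R := by
    intro R hR hq
    have hq' : normSqZ ζ ^ 2 + ζ.2.2 ^ 2 ≤ R ^ 4 := hq
    have hZ : normSqZ ζ ≤ R ^ 2 :=
      le_of_sq_le_sq (by nlinarith [sq_nonneg ζ.2.2]) (by positivity)
    refine ⟨hZ, abs_le_of_sq_le_sq (by nlinarith [sq_nonneg (normSqZ ζ)]) (by positivity),
      fun k => ?_⟩
    have hk : ζ.1 k ^ 2 + ζ.2.1 k ^ 2 ≤ R ^ 2 :=
      (Finset.single_le_sum (f := fun k => ζ.1 k ^ 2 + ζ.2.1 k ^ 2)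
        (fun _ _ => by positivity) (Finset.mem_univ k)).trans hZ
    exact ⟨abs_le_of_sq_le_sq (by nlinarith [sq_nonneg (ζ.2.1 k)]) hR,
      abs_le_of_sq_le_sq (by nlinarith [sq_nonneg (ζ.1 k)]) hR⟩
  have finish : ∀ (p q : ℝ), (∀ s : ℝ, quartic (ζ + s • field j ζ)
      = (normSqZ ζ + 2 * s * p + s ^ 2) ^ 2 + (ζ.2.2 + 2 * s * q) ^ 2) →
      (∀ R : ℝ, 0 ≤ R → quartic ζ ≤ R ^ 4 → |p| ≤ R ∧ |q| ≤ R) →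
      ∃ D : ℝ, HasDerivAt (fun s : ℝ => quartic (ζ + s • field j ζ)) D 0 ∧
      ∀ R : ℝ, 0 ≤ R → quartic ζ ≤ R ^ 4 → |D| ≤ 8 * R ^ 3 := by
    intro p q hpq hb
    refine ⟨4 * normSqZ ζ * p + 4 * ζ.2.2 * q, ?_, fun R hR hq => ?_⟩
    · simp only [hpq]
      have h1 : HasDerivAt (fun s : ℝ => normSqZ ζ + 2 * s * p + s ^ 2)
          (2 * 1 * p + (2 : ℕ) * (0 : ℝ) ^ (2 - 1) * 1) 0 :=
        ((((hasDerivAt_id (0 : ℝ)).const_mul 2).mul_const p).const_add _).add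
          ((hasDerivAt_id (0 : ℝ)).pow 2)
      have h2 : HasDerivAt (fun s : ℝ => ζ.2.2 + 2 * s * q) (2 * 1 * q) 0 :=
        (((hasDerivAt_id (0 : ℝ)).const_mul 2).mul_const q).const_add _
      refine ((h1.pow 2).add (h2.pow 2)).congr_deriv ?_
      simp; ring
    · obtain ⟨hZ, ht, -⟩ := bounds R hR hq
      obtain ⟨hp, hq'⟩ := hb R hR hq
      have hz0 := normSqZ_nonneg ζ
      calc |4 * normSqZ ζ * p + 4 * ζ.2.2 * q|
          ≤ |4 * normSqZ ζ * p| + |4 * ζ.2.2 * q| := abs_add_le _ _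
        _ = 4 * (normSqZ ζ * |p|) + 4 * (|ζ.2.2| * |q|) := by
            simp only [abs_mul, abs_of_nonneg hz0]; norm_num; ring
        _ ≤ 4 * (R ^ 2 * R) + 4 * (R ^ 2 * R) := by gcongr
        _ = 8 * R ^ 3 := by ring
  rcases j with k | k
  · refine finish (ζ.1 k) (-ζ.2.1 k) (fun s => ?_) (fun R hR hq => ?_)
    · have : normSqZ (ζ + s • field (Sum.inl k) ζ) = normSqZ ζ + 2 * s * ζ.1 k + s ^ 2 := by
        have h1 : ∀ i, ((ζ + s • field (Sum.inl k) ζ).1 i ^ 2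
            + (ζ + s • field (Sum.inl k) ζ).2.1 i ^ 2)
            = (ζ.1 i ^ 2 + ζ.2.1 i ^ 2) + if i = k then 2 * s * ζ.1 k + s ^ 2 else 0 := by
          intro i
          by_cases h : i = k
          · subst h; simp [field]; ring
          · simp [field, h]
        simp only [normSqZ, h1, Finset.sum_add_distrib]
        simp; ring
      rw [quartic, this]
      simp [field]; ring
    · have := (bounds R hR hq).2.2 k
      rw [abs_neg]; exact this
  · refine finish (ζ.2.1 k) (ζ.1 k) (fun s => ?_) (fun R hR hq => ?_)
    · have : normSqZ (ζ + s • field (Sum.inr k) ζ) = normSqZ ζ + 2 * s * ζ.2.1 k + s ^ 2 := by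
        have h1 : ∀ i, ((ζ + s • field (Sum.inr k) ζ).1 i ^ 2
            + (ζ + s • field (Sum.inr k) ζ).2.1 i ^ 2)
            = (ζ.1 i ^ 2 + ζ.2.1 i ^ 2) + if i = k then 2 * s * ζ.2.1 k + s ^ 2 else 0 := by
          intro i
          by_cases h : i = k
          · subst h; simp [field]; ring
          · simp [field, h]
        simp only [normSqZ, h1, Finset.sum_add_distrib]
        simp; ring
      rw [quartic, this]
      simp [field]; ring
    · exact ((bounds R hR hq).2.2 k).symm

theorem hderiv_eq_deriv (j : Fin n ⊕ Fin n) {φ : Heis n → ℝ} {ξ : Heis n}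
    (hφ : DifferentiableAt ℝ φ ξ) :
    hderiv j φ ξ = deriv (fun s : ℝ => φ (mul ξ (s • horizDir j))) 0 := by
  rw [hderiv, ← hφ.lineDeriv_eq_fderiv, lineDeriv]
  simp only [mul_smul_horizDir]

theorem abs_hderiv_quartic_mul_le (j : Fin n ⊕ Fin n) (ζ ξ : Heis n) {R : ℝ} (hR : 0 ≤ R)
    (h : quartic (mul ζ ξ) ≤ R ^ 4) : |hderiv j (fun ξ => quartic (mul ζ ξ)) ξ| ≤ 8 * R ^ 3 := by
  obtain ⟨D, hD, hb⟩ := hasDerivAt_quartic_add_smul_field j (mul ζ ξ)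
  rw [hderiv_eq_deriv j ((contDiff_quartic_mul ζ).differentiable (by simp)).differentiableAt]
  simp only [← mul_mul_mul]
  simp only [mul_smul_horizDir]
  rw [hD.deriv]
  exact hb R hR h

/-- The function is constant outside [0, 1], so its continuous derivative only has to be bounded on
a compact interval. -/
theorem exists_deriv_smoothTransition_le : ∃ L : ℝ, 0 ≤ L ∧ ∀ x, |deriv Real.smoothTransition x| ≤ L := by
  have hc : Continuous (deriv Real.smoothTransition) :=
    Real.smoothTransition.contDiff (n := 1).continuous_deriv le_rfl
  obtain ⟨L, hL⟩ := (isCompact_Icc (a := (0 : ℝ)) (b := 1)).exists_bound_of_continuousOn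
    hc.continuousOn
  refine ⟨max L 0, le_max_right _ _, fun x => ?_⟩
  by_cases hx : x ∈ Icc (0 : ℝ) 1
  · exact (hL x hx).trans (le_max_left _ _)
  · have : deriv Real.smoothTransition x = 0 := by
      rcases not_and_or.1 hx with h | h
      · have : IsLocalMin Real.smoothTransition x := by
          refine Filter.Eventually.of_forall fun y => ?_
          rw [Real.smoothTransition.zero_of_nonpos (le_of_not_ge h)]
          exact Real.smoothTransition.nonneg y
        exact this.deriv_eq_zero
      · have : IsLocalMax Real.smoothTransition x := by
          refine Filter.Eventually.of_forall fun y => ?_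
          rw [Real.smoothTransition.one_of_one_le (le_of_not_ge h)]
          exact Real.smoothTransition.le_one y
        exact this.deriv_eq_zero
    simp [this]

/-- A smooth cutoff between two concentric balls. -/
structure IsCutoff (ξ₀ : Heis n) (ρ R L : ℝ) (ψ : Heis n → ℝ) : Prop where
  contDiff : ContDiff ℝ ∞ ψ
  nonneg : ∀ ξ, 0 ≤ ψ ξ
  le_one : ∀ ξ, ψ ξ ≤ 1
  eq_one : ∀ ξ ∈ ball ξ₀ ρ, ψ ξ = 1
  tsupport_subset : tsupport ψ ⊆ ball ξ₀ R
  norm_hgrad_le : ∀ ξ, ‖hgrad ψ ξ‖ ^ 2 ≤ L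

theorem IsCutoff.hgrad_eq_zero {ξ₀ : Heis n} {ρ R L : ℝ} {ψ : Heis n → ℝ}
    (h : IsCutoff ξ₀ ρ R L ψ) {ξ : Heis n} (hξ : ξ ∈ ball ξ₀ ρ) : hgrad ψ ξ = 0 := by
  have : IsLocalMax ψ ξ := by
    refine Filter.Eventually.of_forall fun y => ?_
    rw [h.eq_one ξ hξ]; exact h.le_one y
  ext j
  simp [hderiv, this.fderiv_eq_zero]

theorem IsCutoff.hasCompactSupport {ξ₀ : Heis n} {ρ R L : ℝ} {ψ : Heis n → ℝ}
    (h : IsCutoff ξ₀ ρ R L ψ) (hR : 0 ≤ R) : HasCompactSupport ψ :=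
  (isCompact_ball ξ₀ hR).of_isClosed_subset (isClosed_tsupport ψ) h.tsupport_subset

/-- The cutoff is a transition function of (R⁴ - quartic)/(R⁴ - ρ⁴) with R = ρ + δ. The numerator
has horizontal derivatives at most 8R³ and the denominator is at least R³δ, so L depends only on n
and δ and not on ρ. -/
theorem exists_isCutoff (n : ℕ) {δ : ℝ} (hδ : 0 < δ) : ∃ L : ℝ, 0 ≤ L ∧
    ∀ (ξ₀ : Heis n) (ρ : ℝ), 0 ≤ ρ → ∃ ψ, IsCutoff ξ₀ ρ (ρ + δ) L ψ := by
  obtain ⟨L, hL0, hL⟩ := exists_deriv_smoothTransition_le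
  refine ⟨(2 * n) * (L * (8 / δ)) ^ 2, by positivity, fun ξ₀ ρ hρ => ?_⟩
  set R := ρ + δ with hR
  have hRpos : 0 < R := by positivity
  set d := R ^ 4 - ρ ^ 4 with hd
  have hdδ : R ^ 3 * δ ≤ d := by
    have : d = R ^ 3 * δ + ρ * (R ^ 3 - ρ ^ 3) := by rw [hd, hR]; ring
    rw [this]
    have : ρ ^ 3 ≤ R ^ 3 := pow_le_pow_left₀ hρ (by linarith) 3
    nlinarith
  have hdpos : 0 < d := lt_of_lt_of_le (by positivity) hdδ
  set Q : Heis n → ℝ := fun ξ => quartic (mul (inv ξ₀) ξ) with hQ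
  have hQc : ContDiff ℝ ∞ Q := contDiff_quartic_mul _
  set ψ : Heis n → ℝ := fun ξ => Real.smoothTransition ((R ^ 4 - Q ξ) / d) with hψ
  have hψc : ContDiff ℝ ∞ ψ :=
    Real.smoothTransition.contDiff.comp ((contDiff_const.sub hQc).div_const _)
  have h0 : ∀ ξ, ξ ∉ ball ξ₀ R → ψ ξ = 0 := by
    intro ξ hξ
    rw [mem_ball_iff hRpos.le, not_le] at hξ
    refine Real.smoothTransition.zero_of_nonpos (div_nonpos_of_nonpos_of_nonneg ?_ hdpos.le)
    exact (sub_neg_of_lt hξ).le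
  have hnn : ∀ ξ, 0 ≤ ψ ξ := fun ξ => Real.smoothTransition.nonneg _
  have hgr : ∀ ξ j, |hderiv j ψ ξ| ≤ L * (8 / δ) := by
    intro ξ j
    by_cases hξ : ξ ∈ ball ξ₀ R
    · have hA : HasFDerivAt (fun ξ => (R ^ 4 - Q ξ) / d) (d⁻¹ • (-fderiv ℝ Q ξ)) ξ := by
        have := ((hQc.differentiable (by simp)).differentiableAt (x := ξ)).hasFDerivAt
        simpa [div_eq_mul_inv] using (this.const_sub (R ^ 4)).mul_const d⁻¹
      have hS : HasDerivAt Real.smoothTransition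
          (deriv Real.smoothTransition ((R ^ 4 - Q ξ) / d)) ((R ^ 4 - Q ξ) / d) :=
        ((Real.smoothTransition.contDiff (n := 1)).differentiable
          (by simp)).differentiableAt.hasDerivAt
      have hcomp := (hS.comp_hasFDerivAt ξ hA).fderiv
      have hval : hderiv j ψ ξ
          = deriv Real.smoothTransition ((R ^ 4 - Q ξ) / d) * (d⁻¹ * (-hderiv j Q ξ)) := by
        rw [hderiv]
        change fderiv ℝ (Real.smoothTransition ∘ fun ξ => (R ^ 4 - Q ξ) / d) ξ (field j ξ) = _
        rw [hcomp]; simp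
      rw [hval, abs_mul, abs_mul, abs_neg, abs_of_pos (inv_pos.2 hdpos)]
      have hq := abs_hderiv_quartic_mul_le j (inv ξ₀) ξ hRpos.le ((mem_ball_iff hRpos.le).1 hξ)
      refine mul_le_mul (hL _) ?_ (by positivity) hL0
      rw [inv_mul_le_iff₀ hdpos]
      calc |hderiv j Q ξ| ≤ 8 * R ^ 3 := hq
        _ = R ^ 3 * δ * (8 / δ) := by field_simp
        _ ≤ d * (8 / δ) := by gcongr
    · have : IsLocalMin ψ ξ := by
        refine Filter.Eventually.of_forall fun y => ?_
        rw [h0 ξ hξ]; exact hnn y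
      simp only [hderiv, this.fderiv_eq_zero]
      simp; positivity
  refine ⟨ψ, hψc, hnn, fun ξ => Real.smoothTransition.le_one _, fun ξ hξ => ?_, ?_, fun ξ => ?_⟩
  · rw [mem_ball_iff hρ] at hξ
    refine Real.smoothTransition.one_of_one_le ?_
    rw [one_le_div hdpos]
    linarith
  · refine closure_minimal (fun ξ hξ => ?_) (isCompact_ball ξ₀ hRpos.le).isClosed
    by_contra h
    exact hξ (h0 ξ h)
  · rw [EuclideanSpace.norm_sq_eq]
    calc ∑ j, ‖hgrad ψ ξ j‖ ^ 2 ≤ ∑ _j : Fin n ⊕ Fin n, (L * (8 / δ)) ^ 2 := by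
          refine Finset.sum_le_sum fun j _ => ?_
          rw [hgrad_apply, Real.norm_eq_abs]
          exact pow_le_pow_left₀ (abs_nonneg _) (hgr ξ j) 2
      _ = _ := by
          rw [Finset.sum_const, Finset.card_univ, Fintype.card_sum, Fintype.card_fin, nsmul_eq_mul]
          push_cast; ring

/-! ### Flows of the horizontal fields and difference quotients. -/

theorem smul_mul_smul (j : Fin n ⊕ Fin n) (ξ : Heis n) (s t : ℝ) :
    mul (mul ξ (s • horizDir j)) (t • horizDir j) = mul ξ ((s + t) • horizDir j) := by
  rw [mul_mul_mul]
  congr 1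
  rcases j with k | k <;> simp [mul, horizDir, add_smul, Pi.single_apply]

theorem mul_smul_cancel (j : Fin n ⊕ Fin n) (ξ : Heis n) (s : ℝ) :
    mul (mul ξ (s • horizDir j)) ((-s) • horizDir j) = ξ := by
  rw [smul_mul_smul, add_neg_cancel, zero_smul, mul_zero_right]

theorem contDiff_mul_right (η : Heis n) : ContDiff ℝ ∞ fun ξ => mul ξ η := by
  unfold mul
  fun_prop

theorem hasDerivAt_flow (j : Fin n ⊕ Fin n) {φ : Heis n → ℝ} (hφ : ContDiff ℝ ∞ φ) (ξ : Heis n)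
    (s : ℝ) : HasDerivAt (fun s : ℝ => φ (mul ξ (s • horizDir j)))
      (hderiv j φ (mul ξ (s • horizDir j))) s := by
  have h1 : HasDerivAt (fun s : ℝ => mul ξ (s • horizDir j)) (field j ξ) s := by
    simp only [mul_smul_horizDir]
    simpa using ((hasDerivAt_id s).smul_const (field j ξ)).const_add ξ
  have h2 : field j (mul ξ (s • horizDir j)) = field j ξ := by
    rcases j with k | k <;> simp [mul, horizDir, field]
  have h3 := ((hφ.differentiable (by simp)).differentiableAt
    (x := mul ξ (s • horizDir j))).hasFDerivAt.comp_hasDerivAt s h1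
  rw [hderiv, h2]
  exact h3

/-- A field commutes with its own flow, which is right multiplication by the one-parameter group of
`horizDir j`. Hence a translated test function can be inserted in the definition of the weak
derivative. -/
theorem hderiv_comp_flow (j : Fin n ⊕ Fin n) {φ : Heis n → ℝ} (hφ : ContDiff ℝ ∞ φ) (ξ : Heis n)
    (s : ℝ) : hderiv j (fun ξ => φ (mul ξ (s • horizDir j))) ξ
      = hderiv j φ (mul ξ (s • horizDir j)) := by
  have hc : ContDiff ℝ ∞ fun ξ => φ (mul ξ (s • horizDir j)) := hφ.comp (contDiff_mul_right _)
  rw [hderiv_eq_deriv j (hc.differentiable (by simp)).differentiableAt]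
  have : (fun t : ℝ => φ (mul (mul ξ (t • horizDir j)) (s • horizDir j)))
      = fun t : ℝ => φ (mul (mul ξ (s • horizDir j)) (t • horizDir j)) := by
    ext t; rw [smul_mul_smul, smul_mul_smul, add_comm]
  rw [this]
  have h := hasDerivAt_flow j hφ (mul ξ (s • horizDir j)) 0
  rw [zero_smul, mul_zero_right] at h
  exact h.deriv

theorem hasCompactSupport_comp_mulRight {φ : Heis n → ℝ} (hφ : HasCompactSupport φ) (η : Heis n) :
    HasCompactSupport fun ξ => φ (mul ξ η) :=
  hφ.comp_homeomorph (mulRight η)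

theorem integral_comp_mul_right (f : Heis n → ℝ) (η : Heis n) :
    ∫ ξ, f (mul ξ η) = ∫ ξ, f ξ :=
  (measurePreserving_mul_right η).integral_comp (mulRight η).measurableEmbedding f

theorem lintegral_comp_mul_right (f : Heis n → ℝ≥0∞) (η : Heis n) :
    ∫⁻ ξ, f (mul ξ η) = ∫⁻ ξ, f ξ :=
  (measurePreserving_mul_right η).lintegral_comp_emb (mulRight η).measurableEmbedding f

/-- The product flow `(τ, ξ) ↦ (τ, ξ ∘ (τ eⱼ))` preserves the product measure. -/
theorem measurePreserving_flow (j : Fin n ⊕ Fin n) (s c : ℝ) :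
    MeasurePreserving (fun q : ℝ × Heis n => (q.1, mul q.2 ((c * q.1) • horizDir j)))
      ((volume.restrict (Ioc 0 s)).prod volume) ((volume.restrict (Ioc 0 s)).prod volume) := by
  refine (MeasurePreserving.id _).skew_product
    (g := fun (τ : ℝ) (ξ : Heis n) => mul ξ ((c * τ) • horizDir j)) ?_ ?_
  · refine Continuous.measurable ?_
    simp only [Function.uncurry_def]
    fun_prop
  · exact Filter.Eventually.of_forall fun τ => (measurePreserving_mul_right _).map_eq

/-- A weakly differentiable function is the integral of its derivative along almost every line of
the flow. -/
theorem flow_sub_ae_eq (j : Fin n ⊕ Fin n) {p g : Heis n → ℝ} (hp : Integrable p)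
    (hg : Integrable g)
    (hw : ∀ φ : Heis n → ℝ, ContDiff ℝ ∞ φ → HasCompactSupport φ →
      ∫ ξ, p ξ * hderiv j φ ξ = -∫ ξ, g ξ * φ ξ) {s : ℝ} (hs : 0 ≤ s) :
    (fun ξ => p (mul ξ (s • horizDir j)) - p ξ)
      =ᵐ[volume] fun ξ => ∫ τ in Ioc 0 s, g (mul ξ (τ • horizDir j)) := by
  have hps : Integrable fun ξ => p (mul ξ (s • horizDir j)) :=
    (measurePreserving_mul_right _).integrable_comp_of_integrable hp
  have hgprod : Integrable (fun q : ℝ × Heis n => g (mul q.2 (q.1 • horizDir j)))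
      ((volume.restrict (Ioc 0 s)).prod volume) := by
    have h1 : Integrable (fun q : ℝ × Heis n => g q.2)
        ((volume.restrict (Ioc 0 s)).prod volume) := hg.comp_snd _
    simpa [Function.comp_def] using
      (measurePreserving_flow j s 1).integrable_comp_of_integrable h1
  have hrhs : Integrable fun ξ => ∫ τ in Ioc 0 s, g (mul ξ (τ • horizDir j)) :=
    hgprod.integral_prod_right
  refine ae_eq_of_integral_contDiff_smul_eq (hps.sub hp).locallyIntegrable
    hrhs.locallyIntegrable fun φ hφ hc => ?_
  simp only [smul_eq_mul]
  have hbdd : ∀ {f : Heis n → ℝ}, Continuous f → HasCompactSupport f →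
      ∃ C, ∀ ξ, ‖f ξ‖ ≤ C := fun hf hfc => hfc.exists_bound_of_continuous hf
  have hint : ∀ {f k : Heis n → ℝ}, Continuous f → HasCompactSupport f → Integrable k →
      Integrable fun ξ => f ξ * k ξ := by
    intro f k hf hfc hk
    obtain ⟨C, hC⟩ := hbdd hf hfc
    exact hk.bdd_mul hf.aestronglyMeasurable (Filter.Eventually.of_forall hC)
  have hφs : Continuous fun ξ => φ (mul ξ ((-s) • horizDir j)) :=
    hφ.continuous.comp (contDiff_mul_right _).continuous
  -- the left side
  have e1 : ∫ ξ, φ ξ * (p (mul ξ (s • horizDir j)) - p ξ)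
      = ∫ ξ, p ξ * (φ (mul ξ ((-s) • horizDir j)) - φ ξ) := by
    have a1 : ∫ ξ, φ ξ * p (mul ξ (s • horizDir j))
        = ∫ ξ, φ (mul ξ ((-s) • horizDir j)) * p ξ := by
      rw [← integral_comp_mul_right (fun ξ => φ (mul ξ ((-s) • horizDir j)) * p ξ)
        (s • horizDir j)]
      simp only [mul_smul_cancel]
    have i1 := hint hφ.continuous hc hps
    have i2 := hint hφ.continuous hc hp
    have i3 := hint hφs (hasCompactSupport_comp_mulRight hc _) hp
    simp only [mul_sub]
    rw [integral_sub i1 i2, a1, ← integral_sub i3 i2, integral_sub i3 i2, integral_sub]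
    · simp only [mul_comm]
    · simpa only [mul_comm] using i3
    · simpa only [mul_comm] using i2
  have ftc : ∀ ξ, φ (mul ξ ((-s) • horizDir j)) - φ ξ
      = ∫ τ in Ioc 0 s, -hderiv j φ (mul ξ ((-τ) • horizDir j)) := by
    intro ξ
    have hd : ∀ τ : ℝ, HasDerivAt (fun τ : ℝ => φ (mul ξ ((-τ) • horizDir j)))
        (-hderiv j φ (mul ξ ((-τ) • horizDir j))) τ := by
      intro τ
      have := (hasDerivAt_flow j hφ ξ (-τ)).scomp τ (hasDerivAt_neg τ)
      simpa [Function.comp_def] using this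
    have hcont : Continuous fun τ : ℝ => -hderiv j φ (mul ξ ((-τ) • horizDir j)) :=
      ((continuous_hderiv j hφ).comp (by fun_prop)).neg
    rw [← intervalIntegral.integral_of_le hs,
      intervalIntegral.integral_eq_sub_of_hasDerivAt (fun τ _ => hd τ)
        (hcont.intervalIntegrable _ _)]
    simp
  -- The increment of φ is the integral of its derivative along the flow. After Fubini, for each τ,
  -- the weak derivative of p is tested with φ translated by -τ.
  have e2 : ∫ ξ, p ξ * (φ (mul ξ ((-s) • horizDir j)) - φ ξ)
      = ∫ τ in Ioc 0 s, ∫ ξ, g ξ * φ (mul ξ ((-τ) • horizDir j)) := by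
    simp only [ftc, ← integral_const_mul]
    rw [integral_integral_swap (f := fun ξ τ => p ξ * -hderiv j φ (mul ξ ((-τ) • horizDir j)))]
    · refine integral_congr_ae (Filter.Eventually.of_forall fun τ => ?_)
      have h := hw (fun ξ => φ (mul ξ ((-τ) • horizDir j))) (hφ.comp (contDiff_mul_right _))
        (hasCompactSupport_comp_mulRight hc _)
      simp only [hderiv_comp_flow j hφ] at h
      simp only [mul_neg, integral_neg, h, neg_neg]
    · obtain ⟨C, hC⟩ := hbdd (continuous_hderiv j hφ) (hasCompactSupport_hderiv j hc)
      have h1 : Integrable (fun q : Heis n × ℝ => p q.1)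
          (volume.prod (volume.restrict (Ioc 0 s))) := hp.comp_fst _
      refine h1.mul_bdd (c := C) ?_ (Filter.Eventually.of_forall fun q => ?_)
      · refine Continuous.aestronglyMeasurable ?_
        exact ((continuous_hderiv j hφ).comp (by fun_prop)).neg
      · rw [norm_neg]; exact hC _
  have e3 : ∫ ξ, φ ξ * ∫ τ in Ioc 0 s, g (mul ξ (τ • horizDir j))
      = ∫ τ in Ioc 0 s, ∫ ξ, g ξ * φ (mul ξ ((-τ) • horizDir j)) := by
    simp only [← integral_const_mul]
    rw [← integral_integral_swap (f := fun τ ξ => φ ξ * g (mul ξ (τ • horizDir j)))]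
    · refine integral_congr_ae (Filter.Eventually.of_forall fun τ => ?_)
      change ∫ ξ, φ ξ * g (mul ξ (τ • horizDir j))
        = ∫ ξ, g ξ * φ (mul ξ ((-τ) • horizDir j))
      rw [← integral_comp_mul_right (fun ξ => g ξ * φ (mul ξ ((-τ) • horizDir j)))
        (τ • horizDir j)]
      simp only [mul_smul_cancel, mul_comm]
    · obtain ⟨C, hC⟩ := hbdd hφ.continuous hc
      exact hgprod.bdd_mul (c := C)
        (hφ.continuous.comp continuous_snd).aestronglyMeasurable
        (Filter.Eventually.of_forall fun q => hC _)
  rw [e1, e2, e3]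

theorem sq_lintegral_le {α : Type*} [MeasurableSpace α] (μ : Measure α) {f : α → ℝ≥0∞}
    (hf : AEMeasurable f μ) : (∫⁻ x, f x ∂μ) ^ 2 ≤ μ univ * ∫⁻ x, f x ^ 2 ∂μ := by
  have h := ENNReal.lintegral_mul_le_Lp_mul_Lq μ Real.HolderConjugate.two_two hf
    (aemeasurable_const (b := (1 : ℝ≥0∞)))
  simp only [Pi.mul_apply, mul_one, ENNReal.one_rpow, lintegral_const, one_mul] at h
  have h2 := pow_le_pow_left' h 2
  refine h2.trans (le_of_eq ?_)
  rw [mul_pow, ← ENNReal.rpow_natCast, ← ENNReal.rpow_mul, ← ENNReal.rpow_natCast,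
    ← ENNReal.rpow_mul]
  norm_num
  rw [mul_comm]

/-- Differences along the flow are bounded in `L²` by the weak derivative. -/
theorem lintegral_flow_sub_sq_le (j : Fin n ⊕ Fin n) {p g : Heis n → ℝ} (hp : Integrable p)
    (hg : Integrable g)
    (hw : ∀ φ : Heis n → ℝ, ContDiff ℝ ∞ φ → HasCompactSupport φ →
      ∫ ξ, p ξ * hderiv j φ ξ = -∫ ξ, g ξ * φ ξ) {s : ℝ} (hs : 0 ≤ s) (hs1 : s ≤ 1) :
    ∫⁻ ξ, ‖p (mul ξ (s • horizDir j)) - p ξ‖ₑ ^ 2 ≤ ∫⁻ ξ, ‖g ξ‖ₑ ^ 2 := by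
  have hv : volume (Ioc 0 s) ≤ 1 := by
    rw [Real.volume_Ioc, sub_zero]; exact ENNReal.ofReal_le_one.2 hs1
  have hgm : AEMeasurable (fun q : ℝ × Heis n => ‖g (mul q.2 (q.1 • horizDir j))‖ₑ)
      ((volume.restrict (Ioc 0 s)).prod volume) := by
    have h1 : Integrable (fun q : ℝ × Heis n => g q.2)
        ((volume.restrict (Ioc 0 s)).prod volume) := hg.comp_snd _
    have := (measurePreserving_flow j s 1).integrable_comp_of_integrable h1
    simpa [Function.comp_def] using this.aestronglyMeasurable.enorm
  have hgm' : AEMeasurable (fun q : Heis n × ℝ => ‖g (mul q.1 (q.2 • horizDir j))‖ₑ)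
      (volume.prod (volume.restrict (Ioc 0 s))) := hgm.prod_swap
  calc ∫⁻ ξ, ‖p (mul ξ (s • horizDir j)) - p ξ‖ₑ ^ 2
      = ∫⁻ ξ, ‖∫ τ in Ioc 0 s, g (mul ξ (τ • horizDir j))‖ₑ ^ 2 := by
        refine lintegral_congr_ae ?_
        filter_upwards [flow_sub_ae_eq j hp hg hw hs] with ξ h
        rw [h]
    _ ≤ ∫⁻ ξ, ∫⁻ τ in Ioc 0 s, ‖g (mul ξ (τ • horizDir j))‖ₑ ^ 2 := by
        refine lintegral_mono_ae ?_
        filter_upwards [hgm'.aestronglyMeasurable.prodMk_left] with ξ h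
        refine (pow_le_pow_left' (enorm_integral_le_lintegral_enorm _) 2).trans ?_
        refine (sq_lintegral_le _ h.aemeasurable).trans ?_
        rw [Measure.restrict_apply_univ]
        exact mul_le_of_le_one_left' hv
    _ = ∫⁻ τ in Ioc 0 s, ∫⁻ ξ, ‖g (mul ξ (τ • horizDir j))‖ₑ ^ 2 :=
        lintegral_lintegral_swap (hgm'.pow_const 2)
    _ = ∫⁻ _ in Ioc 0 s, ∫⁻ ξ, ‖g ξ‖ₑ ^ 2 := by
        refine lintegral_congr fun τ => ?_
        exact lintegral_comp_mul_right (fun ξ => ‖g ξ‖ₑ ^ 2) _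
    _ ≤ ∫⁻ ξ, ‖g ξ‖ₑ ^ 2 := by
        rw [setLIntegral_const]
        exact mul_le_of_le_one_right' hv

/-! ### L¹ variation under translations and the weak isoperimetric inequality. -/

/-- The `L¹` distance between a function and its right translate. -/
noncomputable def translDist (f : Heis n → ℝ) (η : Heis n) : ℝ≥0∞ :=
  ∫⁻ ξ, ‖f (mul ξ η) - f ξ‖ₑ

/-- Triangle inequality through ξη, followed by right invariance of the measure. Factoring η into
simple moves therefore bounds its cost by the sum of their costs. -/
theorem translDist_mul_le {f : Heis n → ℝ} (hf : Measurable f) (η ζ : Heis n) :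
    translDist f (mul η ζ) ≤ translDist f η + translDist f ζ := by
  have hm : ∀ η : Heis n, Measurable fun ξ => f (mul ξ η) := fun η =>
    hf.comp (measurePreserving_mul_right η).measurable
  calc translDist f (mul η ζ)
      ≤ ∫⁻ ξ, (‖f (mul ξ η) - f ξ‖ₑ + ‖f (mul (mul ξ η) ζ) - f (mul ξ η)‖ₑ) := by
        refine lintegral_mono fun ξ => ?_
        rw [mul_mul_mul]
        convert enorm_add_le (f (mul ξ η) - f ξ) (f (mul ξ (mul η ζ)) - f (mul ξ η)) using 2
        ring
    _ = _ := by
        have hm' : Measurable fun ξ => ‖f (mul ξ η) - f ξ‖ₑ := ((hm η).sub hf).enorm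
        rw [lintegral_add_left hm']
        congr 1
        exact lintegral_comp_mul_right (fun ξ => ‖f (mul ξ ζ) - f ξ‖ₑ) η

theorem translDist_inv (f : Heis n → ℝ) (η : Heis n) : translDist f (inv η) = translDist f η := by
  rw [translDist, ← lintegral_comp_mul_right _ η]
  simp only [mul_inv_cancel_right']
  exact lintegral_congr fun ξ => by rw [← enorm_neg, neg_sub]

theorem translDist_zero (f : Heis n → ℝ) : translDist f 0 = 0 := by
  simp [translDist]

theorem smul_horizDir_mul (j : Fin n ⊕ Fin n) (s t : ℝ) :
    mul (s • horizDir j) (t • horizDir j) = (s + t) • horizDir j := by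
  have := smul_mul_smul j 0 s t
  simpa using this

theorem translDist_natCast_mul_smul_le {f : Heis n → ℝ} (hf : Measurable f) (j : Fin n ⊕ Fin n)
    (N : ℕ) (h : ℝ) : translDist f ((N * h) • horizDir j) ≤ N * translDist f (h • horizDir j) := by
  induction N with
  | zero => simp [translDist_zero]
  | succ N ih =>
    have : ((N + 1 : ℕ) * h) • horizDir j = mul ((N * h) • horizDir j) (h • horizDir j) := by
      rw [smul_horizDir_mul]; push_cast; ring_nf
    rw [this]
    refine (translDist_mul_le hf _ _).trans ?_
    push_cast
    rw [add_mul, one_mul]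
    gcongr

theorem translDist_smul_le {f : Heis n → ℝ} (hf : Measurable f) {D : ℝ≥0∞}
    (hD : ∀ (j : Fin n ⊕ Fin n) (h : ℝ), 0 ≤ h → h ≤ 1 → translDist f (h • horizDir j) ≤ D)
    (j : Fin n ⊕ Fin n) {N : ℕ} {s : ℝ} (hs : |s| ≤ N) :
    translDist f (s • horizDir j) ≤ N * D := by
  have nonneg : ∀ s : ℝ, 0 ≤ s → s ≤ N → translDist f (s • horizDir j) ≤ N * D := by
    intro s hs0 hsN
    rcases Nat.eq_zero_or_pos N with rfl | hN
    · have : s = 0 := le_antisymm (by simpa using hsN) hs0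
      simp [this, translDist_zero]
    · have hN' : (0 : ℝ) < N := by exact_mod_cast hN
      have : s = N * (s / N) := by field_simp
      rw [this]
      refine (translDist_natCast_mul_smul_le hf j N _).trans ?_
      gcongr
      exact hD j _ (by positivity) ((div_le_one hN').2 hsN)
  rcases le_total 0 s with h | h
  · exact nonneg s h (by rwa [abs_of_nonneg h] at hs)
  · have : s • horizDir j = inv ((-s) • horizDir j) := by simp [inv]
    rw [this, translDist_inv]
    exact nonneg _ (by linarith) (by rwa [abs_of_nonpos h] at hs)

theorem translDist_fst_le {f : Heis n → ℝ} (hf : Measurable f) {A : ℝ≥0∞} (x : Fin n → ℝ)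
    (h : ∀ k, translDist f (x k • horizDir (Sum.inl k)) ≤ A) :
    translDist f (x, 0, 0) ≤ n * A := by
  classical
  have key : ∀ s : Finset (Fin n),
      translDist f ((fun k => if k ∈ s then x k else 0), 0, 0) ≤ s.card * A := by
    intro s
    induction s using Finset.induction_on with
    | empty =>
      have : ((fun k => if k ∈ (∅ : Finset (Fin n)) then x k else 0, 0, 0) : Heis n) = 0 := by
        ext <;> simp
      rw [this, translDist_zero]; exact zero_le
    | insert k s hk ih =>
      have : ((fun i => if i ∈ insert k s then x i else 0, 0, 0) : Heis n)
          = mul ((fun i => if i ∈ s then x i else 0), 0, 0) (x k • horizDir (Sum.inl k)) := by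
        refine Prod.ext ?_ (Prod.ext ?_ ?_)
        · funext i
          by_cases h : i = k
          · subst h; simp [mul, horizDir, hk]
          · simp [mul, horizDir, h]
        · simp [mul, horizDir]
        · simp [mul, horizDir]
      rw [this, Finset.card_insert_of_notMem hk]
      refine (translDist_mul_le hf _ _).trans ?_
      push_cast
      rw [add_mul, one_mul]
      gcongr
      exact h k
  simpa using key Finset.univ

theorem translDist_snd_le {f : Heis n → ℝ} (hf : Measurable f) {A : ℝ≥0∞} (y : Fin n → ℝ)
    (h : ∀ k, translDist f (y k • horizDir (Sum.inr k)) ≤ A) :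
    translDist f (0, y, 0) ≤ n * A := by
  classical
  have key : ∀ s : Finset (Fin n),
      translDist f (0, (fun k => if k ∈ s then y k else 0), 0) ≤ s.card * A := by
    intro s
    induction s using Finset.induction_on with
    | empty =>
      have : ((0, fun k => if k ∈ (∅ : Finset (Fin n)) then y k else 0, 0) : Heis n) = 0 := by
        ext <;> simp
      rw [this, translDist_zero]; exact zero_le
    | insert k s hk ih =>
      have : ((0, fun i => if i ∈ insert k s then y i else 0, 0) : Heis n)
          = mul (0, (fun i => if i ∈ s then y i else 0), 0) (y k • horizDir (Sum.inr k)) := by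
        refine Prod.ext ?_ (Prod.ext ?_ ?_)
        · simp [mul, horizDir]
        · funext i
          by_cases h : i = k
          · subst h; simp [mul, horizDir, hk]
          · simp [mul, horizDir, h]
        · simp [mul, horizDir]
      rw [this, Finset.card_insert_of_notMem hk]
      refine (translDist_mul_le hf _ _).trans ?_
      push_cast
      rw [add_mul, one_mul]
      gcongr
      exact h k
  simpa using key Finset.univ

/-- Vertical moves are commutators of horizontal ones. -/
theorem commutator_eq (k : Fin n) (a b : ℝ) :
    mul (mul (a • horizDir (Sum.inl k)) (b • horizDir (Sum.inr k)))
      (mul (inv (a • horizDir (Sum.inl k))) (inv (b • horizDir (Sum.inr k))))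
      = ((0, 0, 4 * (a * b)) : Heis n) := by
  refine Prod.ext ?_ (Prod.ext ?_ ?_)
  · simp [mul, inv, horizDir]
  · simp [mul, inv, horizDir]
  · simp [mul, inv, horizDir, Pi.single_apply]
    rw [show (∑ x : Fin n, ((-if x = k then if x = k then a * b else 0 else 0)
      + if x = k then if x = k then b * a else 0 else 0)) = 0 from
        Finset.sum_eq_zero fun x _ => by split_ifs <;> ring]
    ring

/-- Factor η = (x, 0, 0)(0, y, 0)(0, 0, τ). The first two factors cost nSD each. As |τ| is of order
S², the vertical factor is a commutator of two horizontal moves of length O(S), at cost (4n + 4)SD;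
this needs at least one pair of conjugate directions. -/
theorem translDist_le_of_box (hn : 1 ≤ n) {f : Heis n → ℝ} (hf : Measurable f) {D : ℝ≥0∞}
    (hD : ∀ (j : Fin n ⊕ Fin n) (h : ℝ), 0 ≤ h → h ≤ 1 → translDist f (h • horizDir j) ≤ D)
    {S : ℕ} (hS : 1 ≤ S) {η : Heis n} (hx : ∀ k, |η.1 k| ≤ S) (hy : ∀ k, |η.2.1 k| ≤ S)
    (ht : |η.2.2| ≤ (S : ℝ) ^ 2) : translDist f η ≤ (6 * n + 4 : ℕ) * (S * D) := by
  have hS' : (1 : ℝ) ≤ S := by exact_mod_cast hS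
  set τ : ℝ := η.2.2 - 2 * ∑ k, η.1 k * η.2.1 k with hτ
  have hτb : |τ| ≤ (2 * n + 1) * (S : ℝ) ^ 2 := by
    have : |∑ k, η.1 k * η.2.1 k| ≤ n * (S : ℝ) ^ 2 := by
      refine (Finset.abs_sum_le_sum_abs _ _).trans ?_
      refine (Finset.sum_le_card_nsmul _ _ ((S : ℝ) ^ 2) fun k _ => ?_).trans (by simp)
      rw [abs_mul, sq]
      exact mul_le_mul (hx k) (hy k) (abs_nonneg _) (by positivity)
    calc |τ| ≤ |η.2.2| + |2 * ∑ k, η.1 k * η.2.1 k| := abs_sub _ _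
      _ ≤ (S : ℝ) ^ 2 + 2 * (n * (S : ℝ) ^ 2) := by
          rw [abs_mul, abs_two]; gcongr
      _ = _ := by ring
  have hη : η = mul (η.1, 0, 0) (mul (0, η.2.1, 0) (0, 0, τ)) := by
    refine Prod.ext ?_ (Prod.ext ?_ ?_)
    · simp [mul]
    · simp [mul]
    · simp [mul, hτ]
  have h1 : translDist f (η.1, 0, 0) ≤ n * (S * D) :=
    translDist_fst_le hf _ fun k => translDist_smul_le hf hD _ (hx k)
  have h2 : translDist f (0, η.2.1, 0) ≤ n * (S * D) :=
    translDist_snd_le hf _ fun k => translDist_smul_le hf hD _ (hy k)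
  have h3 : translDist f (0, 0, τ) ≤ (4 * n + 4 : ℕ) * (S * D) := by
    set k : Fin n := ⟨0, hn⟩
    -- This N makes the other side b = τ/(4N) of the commutator satisfy |b| ≤ S, since |τ| ≤ (2n +
    -- 1)S².
    set N : ℕ := (2 * n + 1) * S with hN
    have hNr : (N : ℝ) = (2 * n + 1) * S := by rw [hN]; push_cast; ring
    have hNpos : (0 : ℝ) < N := by rw [hNr]; positivity
    set b : ℝ := τ / (4 * N) with hb
    have hab : τ = 4 * ((N : ℝ) * b) := by rw [hb]; field_simp
    have ha' : translDist f ((N : ℝ) • horizDir (Sum.inl k)) ≤ N * D :=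
      translDist_smul_le hf hD _ (by simp)
    have hb' : translDist f (b • horizDir (Sum.inr k)) ≤ S * D := by
      refine translDist_smul_le hf hD _ ?_
      rw [hb, abs_div, abs_of_pos (by positivity : 0 < 4 * (N : ℝ)), div_le_iff₀ (by positivity)]
      calc |τ| ≤ (2 * n + 1) * (S : ℝ) ^ 2 := hτb
        _ ≤ S * (4 * N) := by rw [hNr]; nlinarith [sq_nonneg (S : ℝ), (n.cast_nonneg : (0 : ℝ) ≤ n)]
    rw [hab, ← commutator_eq k]
    calc _ ≤ (translDist f ((N : ℝ) • horizDir (Sum.inl k))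
          + translDist f (b • horizDir (Sum.inr k)))
          + (translDist f ((N : ℝ) • horizDir (Sum.inl k))
          + translDist f (b • horizDir (Sum.inr k))) := by
          refine (translDist_mul_le hf _ _).trans (add_le_add (translDist_mul_le hf _ _) ?_)
          refine (translDist_mul_le hf _ _).trans ?_
          rw [translDist_inv, translDist_inv]
      _ ≤ (N * D + S * D) + (N * D + S * D) := by gcongr
      _ = _ := by rw [hN]; push_cast; ring
  rw [hη]
  calc _ ≤ n * (S * D) + (n * (S * D) + (4 * n + 4 : ℕ) * (S * D)) := by
        refine (translDist_mul_le hf _ _).trans (add_le_add h1 ?_)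
        exact (translDist_mul_le hf _ _).trans (add_le_add h2 h3)
    _ = _ := by push_cast; ring

/-- The anisotropic box of size `S` at the origin. -/
def box (n S : ℕ) : Set (Heis n) :=
  Icc (fun _ => -(S : ℝ)) (fun _ => (S : ℝ)) ×ˢ Icc (fun _ => -(S : ℝ)) (fun _ => (S : ℝ)) ×ˢ
    Icc (-(S : ℝ) ^ 2) ((S : ℝ) ^ 2)

theorem measurableSet_box (n S : ℕ) : MeasurableSet (box n S) :=
  measurableSet_Icc.prod (measurableSet_Icc.prod measurableSet_Icc)

theorem volume_box (n S : ℕ) :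
    volume (box n S) = (2 * S) ^ n * ((2 * S) ^ n * (2 * S ^ 2)) := by
  have h2 : ENNReal.ofReal ((S : ℝ) - -S) = 2 * S := by
    rw [sub_neg_eq_add, ← two_mul, ENNReal.ofReal_mul (by norm_num)]; simp
  have h3 : ENNReal.ofReal ((S : ℝ) ^ 2 - -(S : ℝ) ^ 2) = 2 * S ^ 2 := by
    rw [sub_neg_eq_add, ← two_mul, ENNReal.ofReal_mul (by norm_num),
      ENNReal.ofReal_pow (by positivity)]; simp
  rw [box, Measure.volume_eq_prod, Measure.prod_prod, Measure.volume_eq_prod, Measure.prod_prod,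
    Real.volume_Icc_pi, Real.volume_Icc, h3]
  simp only [h2]
  simp

theorem pow_homDim_le_volume_box (n S : ℕ) : (S : ℝ≥0∞) ^ homDim n ≤ volume (box n S) := by
  rw [volume_box, homDim]
  have h : (S : ℝ≥0∞) ≤ 2 * S := le_mul_of_one_le_left' (by norm_num)
  calc (S : ℝ≥0∞) ^ (2 * (n + 1)) = S ^ n * (S ^ n * (1 * S ^ 2)) := by ring
    _ ≤ _ := by gcongr; norm_num

theorem volume_box_ne_top (n S : ℕ) : volume (box n S) ≠ ⊤ := by
  rw [volume_box]; finiteness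

/-- A weak isoperimetric inequality: super-level sets of an integrable function are controlled by
its variation at unit scale. -/
theorem mul_volume_le_of_translDist_le (hn : 1 ≤ n) {f : Heis n → ℝ} (hf : Measurable f)
    {D : ℝ≥0∞}
    (hD : ∀ (j : Fin n ⊕ Fin n) (h : ℝ), 0 ≤ h → h ≤ 1 → translDist f (h • horizDir j) ≤ D)
    {c : ℝ≥0∞} (hc : c ≠ ⊤) {E : Set (Heis n)} (hE : MeasurableSet E)
    (hfE : ∀ ξ ∈ E, c ≤ ‖f ξ‖ₑ) {S : ℕ} (hS : 1 ≤ S)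
    (hm : 2 * ∫⁻ ξ, ‖f ξ‖ₑ ≤ c * (S : ℝ≥0∞) ^ homDim n) :
    c * volume E ≤ 2 * ((6 * n + 4 : ℕ) * (S * D)) := by
  set B := volume (box n S) with hB
  have hBpos : B ≠ 0 := by
    have := pow_homDim_le_volume_box n S
    refine (lt_of_lt_of_le ?_ this).ne'
    exact pos_of_ne_zero (pow_ne_zero _ (by positivity))
  have hBtop : B ≠ ⊤ := volume_box_ne_top n S
  have hmeas : Measurable fun q : Heis n × Heis n => ‖f (mul q.1 q.2) - f q.1‖ₑ := by
    refine Measurable.enorm (Measurable.sub (hf.comp ?_) (hf.comp measurable_fst))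
    exact (continuous_mul_comp continuous_fst continuous_snd).measurable
  -- At a point of E the function has size at least c, but its total mass is at most half of c times
  -- the volume of the box. So on average over the box, f(ξη) differs from f(ξ) by at least c/2.
  have pointwise : ∀ ξ ∈ E, c * B ≤ 2 * ∫⁻ η in box n S, ‖f (mul ξ η) - f ξ‖ₑ := by
    intro ξ hξ
    have hm' : ∫⁻ η in box n S, ‖f (mul ξ η)‖ₑ ≤ ∫⁻ ξ, ‖f ξ‖ₑ :=
      (setLIntegral_le_lintegral _ _).trans_eq
        ((measurePreserving_mul_left ξ).lintegral_comp hf.enorm)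
    have h1 : c * B ≤ (∫⁻ η in box n S, ‖f (mul ξ η) - f ξ‖ₑ) + ∫⁻ ξ, ‖f ξ‖ₑ := by
      calc c * B = ∫⁻ _ in box n S, c := by rw [setLIntegral_const]
        _ ≤ ∫⁻ η in box n S, (‖f (mul ξ η) - f ξ‖ₑ + ‖f (mul ξ η)‖ₑ) := by
            refine lintegral_mono fun η => (hfE ξ hξ).trans ?_
            rw [← enorm_neg (f (mul ξ η) - f ξ)]
            convert! enorm_add_le (-(f (mul ξ η) - f ξ)) (f (mul ξ η)) using 2
            ring
        _ ≤ _ := by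
            rw [lintegral_add_left]
            · gcongr
            · exact hmeas.comp measurable_prodMk_left
    have h2 : 2 * (c * B) ≤ 2 * (∫⁻ η in box n S, ‖f (mul ξ η) - f ξ‖ₑ) + c * B := by
      calc 2 * (c * B) ≤ 2 * ((∫⁻ η in box n S, ‖f (mul ξ η) - f ξ‖ₑ) + ∫⁻ ξ, ‖f ξ‖ₑ) := by
            gcongr
        _ = 2 * (∫⁻ η in box n S, ‖f (mul ξ η) - f ξ‖ₑ) + 2 * ∫⁻ ξ, ‖f ξ‖ₑ := mul_add _ _ _
        _ ≤ _ := by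
            exact add_le_add_right
              (hm.trans (mul_le_mul_right (pow_homDim_le_volume_box n S) c)) _
    rw [two_mul (c * B)] at h2
    exact (ENNReal.add_le_add_iff_right (ENNReal.mul_ne_top hc hBtop)).1 h2
  -- Integrate over E and exchange the integrals: the inner integral becomes the translation
  -- distance for η in the box. The volume of the box then cancels.
  have total : c * volume E * B ≤ 2 * ((6 * n + 4 : ℕ) * (S * D)) * B := by
    calc c * volume E * B = ∫⁻ _ in E, c * B := by rw [setLIntegral_const]; ring
      _ ≤ ∫⁻ ξ in E, 2 * ∫⁻ η in box n S, ‖f (mul ξ η) - f ξ‖ₑ :=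
          setLIntegral_mono' hE pointwise
      _ ≤ ∫⁻ ξ, 2 * ∫⁻ η in box n S, ‖f (mul ξ η) - f ξ‖ₑ := setLIntegral_le_lintegral _ _
      _ = 2 * ∫⁻ η in box n S, translDist f η := by
          rw [lintegral_const_mul' _ _ (by norm_num), lintegral_lintegral_swap hmeas.aemeasurable]
          rfl
      _ ≤ 2 * ∫⁻ _ in box n S, (6 * n + 4 : ℕ) * (S * D) := by
          gcongr 2 * ?_
          refine setLIntegral_mono' (measurableSet_box n S) fun η hη => ?_
          obtain ⟨h1, h2, h3⟩ := hη
          refine translDist_le_of_box hn hf hD hS (fun k => ?_) (fun k => ?_) ?_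
          · exact abs_le.2 ⟨h1.1 k, h1.2 k⟩
          · exact abs_le.2 ⟨h2.1 k, h2.2 k⟩
          · exact abs_le.2 ⟨h3.1, h3.2⟩
      _ = _ := by rw [setLIntegral_const]; ring
  exact (ENNReal.mul_le_mul_iff_left hBpos hBtop).1 total

/-! ### Consequences of the assumptions on the potential. -/

theorem mul_sq_le_mul_rpow {a x d : ℝ} (ha : 0 ≤ a) (hx : 0 < x) (hx1 : x ≤ 1) (hd : d ≤ 2) :
    a * x ^ 2 ≤ a * x ^ d := by
  refine mul_le_mul_of_nonneg_left ?_ ha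
  rw [← Real.rpow_natCast]
  exact Real.rpow_le_rpow_of_exponent_ge hx hx1 (by exact_mod_cast hd)

theorem IsDoubleWell.monotoneOn {P : StructuralConstants} {F : Heis n → ℝ → ℝ}
    (hF : IsDoubleWell P F) (hd : 0 < P.d) (ξ : Heis n) :
    MonotoneOn (F ξ) (Ioo (-1) (-1 + P.ℓ)) := by
  have hsub : Ioo (-1) (-1 + P.ℓ) ⊆ Ioo (-1 : ℝ) 1 :=
    Ioo_subset_Ioo_right (by linarith [P.ℓ_mem.2])
  refine monotoneOn_of_deriv_nonneg (convex_Ioo _ _) ((hF.continuousOn ξ).mono hsub)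
    (((hF.differentiableOn hd ξ).mono hsub).mono interior_subset) fun t ht => ?_
  rw [interior_Ioo] at ht
  have h1 : 0 < t + 1 := by linarith [ht.1]
  have := hF.le_deriv hd ξ (t + 1) h1 (by linarith [ht.2])
  rw [show -1 + (t + 1) = t by ring] at this
  exact le_trans (mul_nonneg P.b_pos.le (Real.rpow_nonneg h1.le _)) this

/-- Consequences of the structural assumptions: away from the well at `1`, the potential controls
the squared distance to the well at `-1`, and it is almost monotone. -/
structure PotentialBounds (F : Heis n → ℝ → ℝ) (θ₀ C : ℝ) : Prop where
  sq_le : ∀ ξ t, -1 ≤ t → t < θ₀ → (1 + t) ^ 2 ≤ C * F ξ t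
  le_mul : ∀ ξ t s, -1 ≤ s → s ≤ t → t < θ₀ → F ξ s ≤ C * F ξ t
  sq_one_sub_sq_le : ∀ ξ t, |t| ≤ 1 → (1 - t ^ 2) ^ 2 ≤ C * F ξ t
  le_const : ∀ ξ t, |t| ≤ 1 → F ξ t ≤ C

/-- Where |t| ≤ m, F is bounded below by γ(m). Closer to the wells the growth condition gives a(1 -
|t|)^d ≥ a(1 - |t|)². For almost monotonicity near -1, F is monotone if d > 0 and is at least a if d
= 0. -/
theorem exists_potentialBounds (P : StructuralConstants) {θ₀ : ℝ} (h0 : 0 < θ₀) (h1 : θ₀ < 1) :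
    ∃ C : ℝ, 4 ≤ C ∧ ∀ (n : ℕ) (F : Heis n → ℝ → ℝ), IsDoubleWell P F →
      PotentialBounds F θ₀ C := by
  set M := max P.M 0
  have hM : 0 ≤ M := le_max_right _ _
  -- If t < θ₀ and |t| > m, then t is negative, lies in the range |t| > ℓ of the growth condition,
  -- and satisfies t < -1 + ℓ, where F is monotone if d > 0.
  set m := max θ₀ (max P.ℓ (1 - P.ℓ)) with hm
  obtain ⟨hℓ0, hℓ1⟩ := P.ℓ_mem
  have hmθ : θ₀ ≤ m := le_max_left _ _
  have hmℓ : P.ℓ ≤ m := (le_max_left _ _).trans (le_max_right _ _)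
  have hmℓ' : 1 - P.ℓ ≤ m := (le_max_right _ _).trans (le_max_right _ _)
  have hmI : m ∈ Ico (0 : ℝ) 1 :=
    ⟨h0.le.trans hmθ, max_lt h1 (max_lt hℓ1 (by linarith))⟩
  have hγ := P.γ_pos m hmI
  have ha := P.a_pos
  set γ := P.γ m
  set a := P.a
  -- The numerator 4 + M dominates both (1 + t)² ≤ 4 and F ≤ M; the divisors γ and a serve the
  -- regions away from the wells and near them.
  refine ⟨4 + M + (4 + M) / γ + (4 + M) / a, ?_, fun n F hF => ?_⟩
  · have : 0 ≤ (4 + M) / γ := by positivity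
    have : 0 ≤ (4 + M) / a := by positivity
    linarith
  set C := 4 + M + (4 + M) / γ + (4 + M) / a with hC
  have hle : ∀ ξ t, |t| ≤ 1 → F ξ t ≤ M := fun ξ t ht =>
    (hF.le_bound ξ t ht).trans (le_max_left _ _)
  have hCγ : ∀ ξ t, |t| ≤ m → 4 + M ≤ C * F ξ t := by
    intro ξ t ht
    have hg := hF.gamma_le m hmI ξ t ht
    have hC' : (4 + M) / γ ≤ C := by
      have : 0 ≤ (4 + M) / a := by positivity
      linarith
    calc 4 + M = (4 + M) / γ * γ := by field_simp
      _ ≤ C * F ξ t := mul_le_mul hC' hg hγ.le (le_trans (by positivity) hC')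
  have hCa : ∀ ξ t, P.ℓ < |t| → |t| < 1 → (4 + M) * (1 - |t|) ^ 2 ≤ C * F ξ t := by
    intro ξ t ht ht1
    have hg := (mul_sq_le_mul_rpow ha.le (sub_pos.2 ht1) (by linarith [abs_nonneg t])
      P.d_mem.2).trans (hF.growth ξ t ht ht1)
    have hC' : (4 + M) / a ≤ C := by
      have : 0 ≤ (4 + M) / γ := by positivity
      linarith
    calc (4 + M) * (1 - |t|) ^ 2 = (4 + M) / a * (a * (1 - |t|) ^ 2) := by field_simp
      _ ≤ C * F ξ t := mul_le_mul hC' hg (by positivity) (le_trans (by positivity) hC')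
  have hC0 : 0 ≤ C := by positivity
  have hC1 : 1 ≤ C := by
    have : 0 ≤ (4 + M) / γ := by positivity
    have : 0 ≤ (4 + M) / a := by positivity
    linarith
  have hCF : ∀ ξ t, 0 ≤ C * F ξ t := fun ξ t => mul_nonneg hC0 (hF.nonneg ξ t)
  refine ⟨fun ξ t ht1 ht2 => ?_, fun ξ t s hs hst ht => ?_, fun ξ t ht => ?_, fun ξ t ht => ?_⟩
  · by_cases hcase : |t| ≤ m
    · have := hCγ ξ t hcase
      nlinarith
    · rcases eq_or_lt_of_le ht1 with h | h
      · rw [← h]; simpa using hCF ξ (-1)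
      · have htneg : t < 0 := by
          by_contra h'
          exact hcase (by rw [abs_of_nonneg (not_lt.1 h')]; linarith)
        have := hCa ξ t (lt_of_le_of_lt hmℓ (not_le.1 hcase)) (by rw [abs_of_neg htneg]; linarith)
        rw [abs_of_neg htneg] at this
        nlinarith [sq_nonneg (1 + t)]
  · rcases eq_or_lt_of_le hs with h | h
    · rw [← h, hF.neg_one]; exact hCF ξ t
    · by_cases hcase : |t| ≤ m
      · have := hCγ ξ t hcase
        have := hle ξ s (abs_le.2 ⟨hs, by linarith⟩)
        linarith
      · have htneg : t < 0 := by
          by_contra h'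
          exact hcase (by rw [abs_of_nonneg (not_lt.1 h')]; linarith)
        have habs : |t| = -t := abs_of_neg htneg
        have hmt : m < -t := by rw [← habs]; exact not_le.1 hcase
        rcases eq_or_lt_of_le P.d_mem.1 with hd | hd
        · have h2 := hF.growth ξ t (by linarith) (by linarith)
          rw [← hd, Real.rpow_zero, mul_one] at h2
          have hC' : (4 + M) / a ≤ C := by
            have : 0 ≤ (4 + M) / γ := by positivity
            linarith
          have h3 : 4 + M ≤ C * F ξ t := by
            calc 4 + M = (4 + M) / a * a := by field_simp
              _ ≤ C * F ξ t := mul_le_mul hC' h2 ha.le (le_trans (by positivity) hC')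
          have := hle ξ s (abs_le.2 ⟨hs, by linarith⟩)
          linarith
        · have hmono := hF.monotoneOn hd ξ (a := s) (b := t) ⟨h, by linarith⟩
            ⟨by linarith, by linarith⟩ hst
          nlinarith [hF.nonneg ξ t]
  · have habs := abs_le.1 ht
    by_cases hcase : |t| ≤ m
    · have h2 := hCγ ξ t hcase
      have h3 : t ^ 2 ≤ 1 := (sq_le_one_iff_abs_le_one t).2 ht
      have h4 : (1 - t ^ 2) ^ 2 ≤ 1 := pow_le_one₀ (by linarith) (by linarith [sq_nonneg t])
      linarith
    · rcases eq_or_lt_of_le ht with h | h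
      · have : t ^ 2 = 1 := by rw [← sq_abs, h, one_pow]
        rw [this]; simpa using hCF ξ t
      · have h2 := hCa ξ t (lt_of_le_of_lt hmℓ (not_le.1 hcase)) h
        have h3 : (1 - t ^ 2) ^ 2 ≤ 4 * (1 - |t|) ^ 2 := by
          rw [← sq_abs t, show 1 - |t| ^ 2 = (1 - |t|) * (1 + |t|) by ring, mul_pow, mul_comm]
          gcongr
          nlinarith [abs_nonneg t]
        nlinarith [sq_nonneg (1 - |t|)]
  · have := hle ξ t ht
    have : 0 ≤ (4 + M) / γ := by positivity
    have : 0 ≤ (4 + M) / a := by positivity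
    linarith

/-! ### Comparison with u - ψ²(1 + u). -/

theorem energy_eq {F : Heis n → ℝ → ℝ} {Ω : Set (Heis n)} (hΩ : IsOpen Ω) {u : Heis n → ℝ}
    {G : Heis n → EuclideanSpace ℝ (Fin n ⊕ Fin n)} (hG : IsWeakGrad Ω u G) :
    energy F Ω u = ∫⁻ ξ in Ω, ENNReal.ofReal (‖G ξ‖ ^ 2 + F ξ (u ξ)) := by
  refine le_antisymm ?_ ?_
  · exact iInf₂_le G (by rwa [hΩ.interior_eq])
  · refine le_iInf₂ fun H hH => ?_
    rw [hΩ.interior_eq] at hH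
    refine le_of_eq (lintegral_congr_ae ?_)
    filter_upwards [hG.ae_eq hΩ hH] with ξ h
    rw [h]

/-- A measurable function with values in `[-1, 1]`, with a weak gradient and finite energy, that
satisfies the energy inequality obtained by comparison with `u - ψ² (1 + u)`. -/
structure SatisfiesCaccioppoli (F : Heis n → ℝ → ℝ) (Ω : Set (Heis n)) (u : Heis n → ℝ)
    (G : Heis n → EuclideanSpace ℝ (Fin n ⊕ Fin n)) : Prop where
  measurable : Measurable u
  abs_le_one : ∀ ξ, |u ξ| ≤ 1
  measurable_grad : Measurable G
  isWeakGrad : IsWeakGrad Ω u G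
  lintegral_ne_top : ∫⁻ ξ in Ω, ENNReal.ofReal (‖G ξ‖ ^ 2 + F ξ (u ξ)) ≠ ⊤
  lintegral_le : ∀ ψ : Heis n → ℝ, ContDiff ℝ ∞ ψ → (∀ ξ, 0 ≤ ψ ξ) → (∀ ξ, ψ ξ ≤ 1) →
    HasCompactSupport ψ → ∀ T, MeasurableSet T → tsupport ψ ⊆ T → T ⊆ Ω →
    (∫⁻ ξ in T, ENNReal.ofReal (ψ ξ ^ 2 * ‖G ξ‖ ^ 2)) + ∫⁻ ξ in T, ENNReal.ofReal (F ξ (u ξ)) ≤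
      ∫⁻ ξ in T, ENNReal.ofReal
        (4 * (1 + u ξ) ^ 2 * ‖hgrad ψ ξ‖ ^ 2 + F ξ (u ξ - ψ ξ ^ 2 * (1 + u ξ)))

theorem hgrad_sq {ψ : Heis n → ℝ} (hψ : ContDiff ℝ ∞ ψ) (ξ : Heis n) :
    hgrad (fun ξ => ψ ξ ^ 2) ξ = (2 * ψ ξ) • hgrad ψ ξ := by
  ext j
  have := hderiv_mul j hψ hψ ξ
  simp only [← sq] at this
  simp only [hgrad_apply, PiLp.smul_apply, smul_eq_mul, this]
  ring

/-- This is where squaring the cutoff pays: the right side minus the square of the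
triangle-inequality bound is exactly (1 - p²)(p‖A‖ - 2U‖B‖)². The term (1 - p²)‖A‖² can be cancelled
against the energy of the minimizer, which leaves p²‖A‖² there. -/
theorem norm_sq_competitor_le {E : Type*} [NormedAddCommGroup E] [NormedSpace ℝ E] (A B : E)
    {p U : ℝ} (hp : 0 ≤ p) (hp1 : p ≤ 1) (hU : 0 ≤ U) :
    ‖A - (p ^ 2 • A + U • (2 * p) • B)‖ ^ 2 ≤ (1 - p ^ 2) * ‖A‖ ^ 2 + 4 * U ^ 2 * ‖B‖ ^ 2 := by
  have hg : 0 ≤ 1 - p ^ 2 := by nlinarith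
  have h1 : ‖A - (p ^ 2 • A + U • (2 * p) • B)‖ ≤ (1 - p ^ 2) * ‖A‖ + 2 * p * (U * ‖B‖) := by
    have : A - (p ^ 2 • A + U • (2 * p) • B) = (1 - p ^ 2) • A - (2 * p * U) • B := by module
    rw [this]
    refine (norm_sub_le _ _).trans (le_of_eq ?_)
    rw [norm_smul, norm_smul, Real.norm_of_nonneg hg, Real.norm_of_nonneg (by positivity)]
    ring
  calc _ ≤ ((1 - p ^ 2) * ‖A‖ + 2 * p * (U * ‖B‖)) ^ 2 := pow_le_pow_left₀ (norm_nonneg _) h1 2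
    _ = (1 - p ^ 2) * ‖A‖ ^ 2 + 4 * U ^ 2 * ‖B‖ ^ 2
        - (1 - p ^ 2) * (p * ‖A‖ - 2 * (U * ‖B‖)) ^ 2 := by ring
    _ ≤ _ := by
        have := mul_nonneg hg (sq_nonneg (p * ‖A‖ - 2 * (U * ‖B‖)))
        linarith

/-- Insert φ = -ψ²(1 + u) in the minimality condition. The contributions off T agree and are finite,
and so is the integral of (1 - ψ²)|∇u|² over T; both are subtracted from the two sides, and what
remains is the stated inequality. -/
theorem IsLocalMinimizer.exists_satisfiesCaccioppoli {P : StructuralConstants}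
    {F : Heis n → ℝ → ℝ} (hF : IsDoubleWell P F) {Ω : Set (Heis n)} (hΩ : IsOpen Ω)
    {u₀ : Heis n → ℝ} (hmin : IsLocalMinimizer F Ω u₀)
    (hb : ∀ᵐ ξ ∂(volume.restrict Ω), |u₀ ξ| ≤ 1) :
    ∃ u G, u₀ =ᵐ[volume.restrict Ω] u ∧ SatisfiesCaccioppoli F Ω u G := by
  have hfin := hmin.energy_ne_top
  obtain ⟨G₀, hG₀⟩ : ∃ G, IsWeakGrad Ω u₀ G := by
    by_contra hno
    refine hfin ?_
    simp only [energy, hΩ.interior_eq]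
    refine iInf₂_eq_top.2 fun G hG => absurd ⟨G, hG⟩ hno
  have hu₀m : AEMeasurable u₀ (volume.restrict Ω) :=
    hG₀.locallyIntegrable.aestronglyMeasurable.aemeasurable
  have hG₀m : AEMeasurable G₀ (volume.restrict Ω) :=
    hG₀.locallyIntegrable_grad.aestronglyMeasurable.aemeasurable
  -- Clamping a measurable representative makes the bound |u| ≤ 1 hold at every point without
  -- changing u almost everywhere in Ω.
  set u : Heis n → ℝ := fun ξ => max (-1) (min 1 (hu₀m.mk u₀ ξ)) with hu
  set G := hG₀m.mk G₀ with hGdef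
  have hum : Measurable u := measurable_const.max (measurable_const.min hu₀m.measurable_mk)
  have hGm : Measurable G := hG₀m.measurable_mk
  have huu : u₀ =ᵐ[volume.restrict Ω] u := by
    filter_upwards [hu₀m.ae_eq_mk, hb] with ξ h1 h2
    rw [abs_le] at h2
    simp only [hu]
    rw [← h1, min_eq_right h2.2, max_eq_right h2.1]
  have hu1 : ∀ ξ, |u ξ| ≤ 1 := fun ξ =>
    abs_le.2 ⟨le_max_left _ _, max_le (by norm_num) (min_le_left _ _)⟩
  have hw₀ : IsWeakGrad Ω u₀ G := hG₀.congr (Filter.EventuallyEq.refl _ _) hG₀m.ae_eq_mk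
  have hw : IsWeakGrad Ω u G := hG₀.congr huu hG₀m.ae_eq_mk
  have hen : energy F Ω u₀ = ∫⁻ ξ in Ω, ENNReal.ofReal (‖G ξ‖ ^ 2 + F ξ (u ξ)) := by
    rw [energy_eq hΩ hw₀]
    refine lintegral_congr_ae ?_
    filter_upwards [huu] with ξ h
    rw [h]
  have hfin' : ∫⁻ ξ in Ω, ENNReal.ofReal (‖G ξ‖ ^ 2 + F ξ (u ξ)) ≠ ⊤ := hen ▸ hfin
  have hG2 : MemLp G 2 (volume.restrict Ω) := by
    rw [memLp_two_iff_integrable_sq_norm hGm.aestronglyMeasurable]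
    refine ⟨(hGm.norm.pow_const 2).aestronglyMeasurable, ?_⟩
    rw [hasFiniteIntegral_iff_ofReal (Filter.Eventually.of_forall fun ξ => by positivity)]
    refine lt_of_le_of_lt (lintegral_mono fun ξ => ?_) hfin'.lt_top
    exact ENNReal.ofReal_le_ofReal (by linarith [hF.nonneg ξ (u ξ)])
  refine ⟨u, G, huu, hum, hu1, hGm, hw, hfin', ?_⟩
  intro ψ hψ hψ0 hψ1 hψc T hT hψT hTΩ
  have hU : ∀ ξ, 0 ≤ 1 + u ξ := fun ξ => by linarith [(abs_le.1 (hu1 ξ)).1]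
  have hψ2 : ContDiff ℝ ∞ fun ξ => ψ ξ ^ 2 := hψ.pow 2
  have hts : tsupport (fun ξ => ψ ξ ^ 2) ⊆ tsupport ψ :=
    closure_mono fun ξ h h' => h (by simp [h'])
  have hψ2c : HasCompactSupport fun ξ => ψ ξ ^ 2 :=
    hψc.of_isClosed_subset (isClosed_tsupport _) hts
  obtain ⟨-, -, hcut⟩ := hw.cutoff_mul hψ2 hψ2c (hts.trans (hψT.trans hTΩ))
  set φ : Heis n → ℝ := -fun ξ => ψ ξ ^ 2 * (1 + u ξ) with hφ
  set H : Heis n → EuclideanSpace ℝ (Fin n ⊕ Fin n) :=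
    -fun ξ => ψ ξ ^ 2 • G ξ + (1 + u ξ) • hgrad (fun ξ => ψ ξ ^ 2) ξ with hH
  have hφH : IsWeakGrad Ω φ H := hcut.neg.mono (subset_univ _)
  have hφsupp : tsupport φ ⊆ tsupport ψ :=
    closure_mono fun ξ h h' => h (by simp [hφ, h'])
  have hpert : IsPerturbation Ω φ := by
    refine ⟨hψc.of_isClosed_subset (isClosed_tsupport _) hφsupp,
      hφsupp.trans (hψT.trans hTΩ), ⟨2, fun ξ => ?_⟩, H, hφH, ?_⟩
    · have h2 : ψ ξ ^ 2 ≤ 1 := pow_le_one₀ (hψ0 ξ) (hψ1 ξ)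
      have h3 : 1 + u ξ ≤ 2 := by linarith [(abs_le.1 (hu1 ξ)).2]
      simp only [hφ, Pi.neg_apply, abs_neg]
      rw [abs_of_nonneg (mul_nonneg (sq_nonneg _) (hU ξ))]
      nlinarith [hU ξ, sq_nonneg (ψ ξ)]
    · refine MemLp.neg (MemLp.add ?_ ?_)
      · refine hG2.of_le ((hψ2.continuous.measurable.smul hGm).aestronglyMeasurable)
          (Filter.Eventually.of_forall fun ξ => ?_)
        rw [norm_smul, Real.norm_of_nonneg (sq_nonneg _)]
        exact mul_le_of_le_one_left (norm_nonneg _) (pow_le_one₀ (hψ0 ξ) (hψ1 ξ))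
      · have hgc : HasCompactSupport (hgrad fun ξ => ψ ξ ^ 2) :=
          HasCompactSupport.intro hψ2c fun ξ h => hgrad_eq_zero_of_notMem h
        have hgL : MemLp (hgrad fun ξ => ψ ξ ^ 2) 2 (volume.restrict Ω) :=
          ((continuous_hgrad hψ2).memLp_of_hasCompactSupport hgc).restrict Ω
        refine (hgL.const_smul (2 : ℝ)).of_le ?_ (Filter.Eventually.of_forall fun ξ => ?_)
        · exact ((measurable_const.add hum).smul
            (continuous_hgrad hψ2).measurable).aestronglyMeasurable
        · rw [Pi.smul_apply, norm_smul, norm_smul, Real.norm_of_nonneg (hU ξ), Real.norm_two]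
          gcongr
          linarith [(abs_le.1 (hu1 ξ)).2]
  have hcmp := hmin.le_energy_add φ hpert
  rw [hen, energy_eq hΩ (hw₀.add hφH)] at hcmp
  set v : Heis n → ℝ := fun ξ => u ξ - ψ ξ ^ 2 * (1 + u ξ) with hv
  have hvm : Measurable v := hum.sub (hψ2.continuous.measurable.mul (measurable_const.add hum))
  have hFm : ∀ {w : Heis n → ℝ}, Measurable w → Measurable fun ξ => F ξ (w ξ) := fun hw =>
    hF.measurable.comp (measurable_id.prodMk hw)
  have hHm : Measurable H :=
    ((hψ2.continuous.measurable.smul hGm).add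
      ((measurable_const.add hum).smul (continuous_hgrad hψ2).measurable)).neg
  have hcmp' : ∫⁻ ξ in Ω, ENNReal.ofReal (‖G ξ‖ ^ 2 + F ξ (u ξ))
      ≤ ∫⁻ ξ in Ω, ENNReal.ofReal (‖G ξ + H ξ‖ ^ 2 + F ξ (v ξ)) := by
    refine hcmp.trans (le_of_eq (lintegral_congr_ae ?_))
    filter_upwards [huu] with ξ h
    simp only [Pi.add_apply, h, hφ, hv, Pi.neg_apply, sub_eq_add_neg]
  have hsplit : ∀ f : Heis n → ℝ≥0∞, ∫⁻ ξ in Ω, f ξ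
      = (∫⁻ ξ in T, f ξ) + ∫⁻ ξ in Ω \ T, f ξ := by
    intro f
    rw [← lintegral_inter_add_sdiff f Ω hT, inter_eq_self_of_subset_right hTΩ]
  have hout : ∫⁻ ξ in Ω \ T, ENNReal.ofReal (‖G ξ + H ξ‖ ^ 2 + F ξ (v ξ))
      = ∫⁻ ξ in Ω \ T, ENNReal.ofReal (‖G ξ‖ ^ 2 + F ξ (u ξ)) := by
    refine setLIntegral_congr_fun (hΩ.measurableSet.diff hT) fun ξ hξ => ?_
    have h1 : ξ ∉ tsupport ψ := fun h => hξ.2 (hψT h)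
    have h2 : ψ ξ = 0 := image_eq_zero_of_notMem_tsupport h1
    simp [hH, hv, h2, hgrad_eq_zero_of_notMem (fun h => h1 (hts h))]
  rw [hsplit, hsplit, hout] at hcmp'
  have hcT := (ENNReal.add_le_add_iff_right (ne_top_of_le_ne_top hfin'
    (lintegral_mono_set sdiff_subset))).1 hcmp'
  have hmid : ∫⁻ ξ in T, ENNReal.ofReal ((1 - ψ ξ ^ 2) * ‖G ξ‖ ^ 2) ≠ ⊤ := by
    refine ne_top_of_le_ne_top hfin' ((lintegral_mono_set hTΩ).trans
      (lintegral_mono fun ξ => ENNReal.ofReal_le_ofReal ?_))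
    nlinarith [hF.nonneg ξ (u ξ), sq_nonneg (ψ ξ * ‖G ξ‖)]
  have hsq1 : ∀ ξ, 0 ≤ 1 - ψ ξ ^ 2 := fun ξ => by
    linarith [pow_le_one₀ (n := 2) (hψ0 ξ) (hψ1 ξ)]
  have hmeas1 : Measurable fun ξ => ENNReal.ofReal ((1 - ψ ξ ^ 2) * ‖G ξ‖ ^ 2) :=
    ((measurable_const.sub hψ2.continuous.measurable).mul (hGm.norm.pow_const 2)).ennreal_ofReal
  have hmeas2 : Measurable fun ξ => ENNReal.ofReal (ψ ξ ^ 2 * ‖G ξ‖ ^ 2) :=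
    (hψ2.continuous.measurable.mul (hGm.norm.pow_const 2)).ennreal_ofReal
  have hL : ∫⁻ ξ in T, ENNReal.ofReal (‖G ξ‖ ^ 2 + F ξ (u ξ))
      = (∫⁻ ξ in T, ENNReal.ofReal ((1 - ψ ξ ^ 2) * ‖G ξ‖ ^ 2))
        + ((∫⁻ ξ in T, ENNReal.ofReal (ψ ξ ^ 2 * ‖G ξ‖ ^ 2))
          + ∫⁻ ξ in T, ENNReal.ofReal (F ξ (u ξ))) := by
    rw [← lintegral_add_left hmeas2, ← lintegral_add_left hmeas1]
    refine lintegral_congr fun ξ => ?_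
    rw [← ENNReal.ofReal_add (by positivity) (hF.nonneg _ _),
      ← ENNReal.ofReal_add (mul_nonneg (hsq1 ξ) (by positivity))
        (add_nonneg (by positivity) (hF.nonneg _ _))]
    congr 1
    ring
  have hR : ∫⁻ ξ in T, ENNReal.ofReal (‖G ξ + H ξ‖ ^ 2 + F ξ (v ξ))
      ≤ (∫⁻ ξ in T, ENNReal.ofReal ((1 - ψ ξ ^ 2) * ‖G ξ‖ ^ 2))
        + ∫⁻ ξ in T, ENNReal.ofReal
          (4 * (1 + u ξ) ^ 2 * ‖hgrad ψ ξ‖ ^ 2 + F ξ (v ξ)) := by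
    rw [← lintegral_add_left hmeas1]
    refine lintegral_mono fun ξ => ?_
    rw [← ENNReal.ofReal_add (mul_nonneg (hsq1 ξ) (by positivity))
      (add_nonneg (by positivity) (hF.nonneg _ _))]
    refine ENNReal.ofReal_le_ofReal ?_
    have := norm_sq_competitor_le (G ξ) (hgrad ψ ξ) (hψ0 ξ) (hψ1 ξ) (hU ξ)
    rw [← hgrad_sq hψ ξ] at this
    have h2 : G ξ + H ξ = G ξ - (ψ ξ ^ 2 • G ξ + (1 + u ξ) • hgrad (fun ξ => ψ ξ ^ 2) ξ) := by
      simp only [hH, Pi.neg_apply, sub_eq_add_neg]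
    rw [h2]
    linarith
  rw [hL] at hcT
  exact (ENNReal.add_le_add_iff_left hmid).1 (hcT.trans hR)

theorem IsDoubleWell.measurable_comp {P : StructuralConstants} {F : Heis n → ℝ → ℝ}
    (hF : IsDoubleWell P F) {w : Heis n → ℝ} (hw : Measurable w) :
    Measurable fun ξ => F ξ (w ξ) :=
  hF.measurable.comp (measurable_id.prodMk hw)

namespace SatisfiesCaccioppoli

variable {P : StructuralConstants} {F : Heis n → ℝ → ℝ} {Ω : Set (Heis n)} {u : Heis n → ℝ}
  {G : Heis n → EuclideanSpace ℝ (Fin n ⊕ Fin n)}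

theorem one_add_mem (h : SatisfiesCaccioppoli F Ω u G) (ξ : Heis n) :
    0 ≤ 1 + u ξ ∧ 1 + u ξ ≤ 2 := by
  have := abs_le.1 (h.abs_le_one ξ)
  constructor <;> linarith

theorem competitor_mem (h : SatisfiesCaccioppoli F Ω u G) {p : ℝ} (hp0 : 0 ≤ p) (hp1 : p ≤ 1)
    (ξ : Heis n) : -1 ≤ u ξ - p ^ 2 * (1 + u ξ) ∧ u ξ - p ^ 2 * (1 + u ξ) ≤ u ξ := by
  obtain ⟨hU, -⟩ := h.one_add_mem ξ
  have hp2 : p ^ 2 ≤ 1 := pow_le_one₀ hp0 hp1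
  constructor <;> nlinarith [sq_nonneg p]

/-- The energy in a ball is controlled by the contribution of a shell around it. -/
theorem lintegral_ball_le (h : SatisfiesCaccioppoli F Ω u G) (hF : IsDoubleWell P F)
    {ξ₀ : Heis n} {ρ R L : ℝ} {ψ : Heis n → ℝ} (hψ : IsCutoff ξ₀ ρ R L ψ) (hρ : 0 ≤ ρ)
    (hρR : ρ ≤ R) (hR : ball ξ₀ R ⊆ Ω) :
    (∫⁻ ξ in ball ξ₀ ρ, ENNReal.ofReal (‖G ξ‖ ^ 2))
        + ∫⁻ ξ in ball ξ₀ ρ, ENNReal.ofReal (F ξ (u ξ)) ≤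
      ∫⁻ ξ in ball ξ₀ R \ ball ξ₀ ρ, ENNReal.ofReal
        (4 * (1 + u ξ) ^ 2 * L + F ξ (u ξ - ψ ξ ^ 2 * (1 + u ξ))) := by
  have hsub := ball_subset_ball (ξ₀ := ξ₀) hρR
  have hmρ := measurableSet_ball ξ₀ hρ
  have hmR := measurableSet_ball ξ₀ (hρ.trans hρR)
  have hmain := h.lintegral_le ψ hψ.contDiff hψ.nonneg hψ.le_one
    (hψ.hasCompactSupport (hρ.trans hρR)) (ball ξ₀ R) hmR hψ.tsupport_subset hR
  calc _ ≤ (∫⁻ ξ in ball ξ₀ R, ENNReal.ofReal (ψ ξ ^ 2 * ‖G ξ‖ ^ 2))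
        + ∫⁻ ξ in ball ξ₀ R, ENNReal.ofReal (F ξ (u ξ)) := by
        refine add_le_add ?_ (lintegral_mono_set hsub)
        refine le_trans (le_of_eq ?_) (lintegral_mono_set hsub)
        refine setLIntegral_congr_fun hmρ fun ξ hξ => ?_
        simp [hψ.eq_one ξ hξ]
    _ ≤ _ := hmain
    _ = ∫⁻ ξ in ball ξ₀ R \ ball ξ₀ ρ, ENNReal.ofReal
          (4 * (1 + u ξ) ^ 2 * ‖hgrad ψ ξ‖ ^ 2 + F ξ (u ξ - ψ ξ ^ 2 * (1 + u ξ))) := by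
        rw [← lintegral_inter_add_sdiff _ _ hmρ, inter_eq_self_of_subset_right hsub]
        convert zero_add _
        refine setLIntegral_eq_zero hmρ fun ξ hξ => ?_
        -- On the inner ball the competitor sits in the well, so only the shell contributes to the
        -- right side.
        have : u ξ - 1 ^ 2 * (1 + u ξ) = -1 := by ring
        simp only [hψ.hgrad_eq_zero hξ, hψ.eq_one ξ hξ, this, hF.neg_one]
        simp
    _ ≤ _ := by
        refine lintegral_mono fun ξ => ENNReal.ofReal_le_ofReal ?_
        gcongr
        exact hψ.norm_hgrad_le ξ

end SatisfiesCaccioppoli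

/-! ### The upper energy bound of order r^{Q-1}. -/

/-- On the shell (1 + u)² ≤ 4 and F ≤ M, so the integrand is at most 16L + M, and a shell of
thickness δ has volume O(r^{Q-1}). -/
theorem exists_lintegral_ball_le (n : ℕ) (P : StructuralConstants) {δ : ℝ} (hδ : 0 < δ) :
    ∃ c : ℝ, 0 < c ∧ ∀ (F : Heis n → ℝ → ℝ), IsDoubleWell P F →
      ∀ Ω u G, SatisfiesCaccioppoli F Ω u G → ∀ (ξ₀ : Heis n) (r : ℝ), 1 ≤ r →
      ball ξ₀ (r + δ) ⊆ Ω →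
      (∫⁻ ξ in ball ξ₀ r, ENNReal.ofReal (‖G ξ‖ ^ 2))
        + (∫⁻ ξ in ball ξ₀ r, ENNReal.ofReal (F ξ (u ξ)))
        ≤ ENNReal.ofReal (c * r ^ (homDim n - 1)) := by
  obtain ⟨L, hL, hcut⟩ := exists_isCutoff n hδ
  obtain ⟨C, hC, hvol⟩ := exists_volume_shell_le n hδ
  set M := max P.M 0
  have hM : 0 ≤ M := le_max_right _ _
  refine ⟨(16 * L + M) * C + 1, by positivity, fun F hF Ω u G h ξ₀ r hr hball => ?_⟩
  obtain ⟨ψ, hψ⟩ := hcut ξ₀ r (by linarith)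
  refine (h.lintegral_ball_le hF hψ (by linarith) (by linarith) hball).trans ?_
  calc _ ≤ ∫⁻ _ in ball ξ₀ (r + δ) \ ball ξ₀ r, ENNReal.ofReal (16 * L + M) := by
        refine lintegral_mono fun ξ => ENNReal.ofReal_le_ofReal ?_
        obtain ⟨h0, h2⟩ := h.one_add_mem ξ
        obtain ⟨hv1, hv2⟩ := h.competitor_mem (hψ.nonneg ξ) (hψ.le_one ξ) ξ
        refine add_le_add ?_ ?_
        · have : (1 + u ξ) ^ 2 ≤ 4 := by nlinarith
          nlinarith
        · refine (hF.le_bound ξ _ (abs_le.2 ⟨hv1, ?_⟩)).trans (le_max_left _ _)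
          linarith
    _ = ENNReal.ofReal (16 * L + M) * volume (ball ξ₀ (r + δ) \ ball ξ₀ r) := by
        rw [setLIntegral_const]
    _ ≤ ENNReal.ofReal (16 * L + M) * ENNReal.ofReal (C * r ^ (homDim n - 1)) := by
        gcongr
        exact hvol ξ₀ r hr
    _ ≤ _ := by
        rw [← ENNReal.ofReal_mul (by positivity)]
        refine ENNReal.ofReal_le_ofReal ?_
        have : 0 ≤ r ^ (homDim n - 1) := by positivity
        nlinarith

/-! ### The growth inequality for the integral of the density. -/

/-- The density `F(ξ, u) + 1_{u ≥ θ}`. -/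
noncomputable def density (F : Heis n → ℝ → ℝ) (u : Heis n → ℝ) (θ : ℝ) (ξ : Heis n) : ℝ≥0∞ :=
  ENNReal.ofReal (F ξ (u ξ)) + {η | θ ≤ u η}.indicator 1 ξ

theorem measurable_density {P : StructuralConstants} {F : Heis n → ℝ → ℝ}
    (hF : IsDoubleWell P F) {u : Heis n → ℝ} (hu : Measurable u) (θ : ℝ) :
    Measurable (density F u θ) :=
  (hF.measurable_comp hu).ennreal_ofReal.add
    (measurable_one.indicator (measurableSet_le measurable_const hu))

theorem ofReal_le_mul_density {F : Heis n → ℝ → ℝ} {u : Heis n → ℝ} {θ : ℝ} {ξ : Heis n}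
    {A x : ℝ} (hA : 0 ≤ A) (h1 : u ξ < θ → x ≤ A * F ξ (u ξ))
    (h2 : θ ≤ u ξ → x ≤ A) : ENNReal.ofReal x ≤ ENNReal.ofReal A * density F u θ ξ := by
  rcases lt_or_ge (u ξ) θ with h | h
  · calc ENNReal.ofReal x ≤ ENNReal.ofReal A * ENNReal.ofReal (F ξ (u ξ)) := by
          rw [← ENNReal.ofReal_mul hA]; exact ENNReal.ofReal_le_ofReal (h1 h)
      _ ≤ _ := by gcongr; exact le_self_add
  · calc ENNReal.ofReal x ≤ ENNReal.ofReal A * {η | θ ≤ u η}.indicator 1 ξ := by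
          rw [indicator_of_mem (show ξ ∈ {η | θ ≤ u η} from h), Pi.one_apply, mul_one]
          exact ENNReal.ofReal_le_ofReal (h2 h)
      _ ≤ _ := by gcongr; exact le_add_self

theorem lintegral_density {P : StructuralConstants} {F : Heis n → ℝ → ℝ}
    (hF : IsDoubleWell P F) {u : Heis n → ℝ} (hu : Measurable u) (θ : ℝ) (T : Set (Heis n)) :
    ∫⁻ ξ in T, density F u θ ξ
      = (∫⁻ ξ in T, ENNReal.ofReal (F ξ (u ξ))) + volume (T ∩ {η | θ ≤ u η}) := by
  have hm : MeasurableSet {η | θ ≤ u η} := measurableSet_le measurable_const hu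
  simp only [density]
  rw [lintegral_add_left (hF.measurable_comp hu).ennreal_ofReal, lintegral_indicator_one hm,
    Measure.restrict_apply hm, inter_comm]

theorem sq_one_add_le_mul_density {F : Heis n → ℝ → ℝ} {θ₀ C θ : ℝ}
    (hB : PotentialBounds F θ₀ C) (hC : 4 ≤ C) {Ω : Set (Heis n)} {u : Heis n → ℝ}
    {G : Heis n → EuclideanSpace ℝ (Fin n ⊕ Fin n)} (h : SatisfiesCaccioppoli F Ω u G)
    (hθ : θ ≤ θ₀) (ξ : Heis n) :
    ENNReal.ofReal ((1 + u ξ) ^ 2) ≤ ENNReal.ofReal C * density F u θ ξ := by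
  obtain ⟨h0, h2⟩ := h.one_add_mem ξ
  refine ofReal_le_mul_density (by linarith) (fun hu => ?_) (fun _ => by nlinarith)
  exact hB.sq_le ξ _ (by linarith) (by linarith)

/-- The shell integrand is bounded by the density itself instead of by a constant. Where u < θ, both
(1 + u)² and the potential of the competitor are at most C F(u), the competitor lying between -1 and
u; where u ≥ θ, the indicator absorbs them. -/
theorem lintegral_ball_le_density {P : StructuralConstants} {F : Heis n → ℝ → ℝ}
    (hF : IsDoubleWell P F) {θ₀ C θ : ℝ} (hB : PotentialBounds F θ₀ C) (hC : 4 ≤ C)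
    {Ω : Set (Heis n)} {u : Heis n → ℝ}
    {G : Heis n → EuclideanSpace ℝ (Fin n ⊕ Fin n)} (h : SatisfiesCaccioppoli F Ω u G)
    (hθ : θ ≤ θ₀) {ξ₀ : Heis n} {ρ R L : ℝ} {ψ : Heis n → ℝ} (hψ : IsCutoff ξ₀ ρ R L ψ)
    (hρ : 0 ≤ ρ) (hρR : ρ ≤ R) (hL : 0 ≤ L) (hR : ball ξ₀ R ⊆ Ω) :
    (∫⁻ ξ in ball ξ₀ ρ, ENNReal.ofReal (‖G ξ‖ ^ 2))
        + ∫⁻ ξ in ball ξ₀ ρ, ENNReal.ofReal (F ξ (u ξ)) ≤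
      ENNReal.ofReal ((4 * L + 1) * C) * ∫⁻ ξ in ball ξ₀ R \ ball ξ₀ ρ, density F u θ ξ := by
  refine (h.lintegral_ball_le hF hψ hρ hρR hR).trans ?_
  rw [← lintegral_const_mul _ (measurable_density hF h.measurable θ)]
  refine lintegral_mono fun ξ => ?_
  obtain ⟨h0, h2⟩ := h.one_add_mem ξ
  obtain ⟨hv1, hv2⟩ := h.competitor_mem (hψ.nonneg ξ) (hψ.le_one ξ) ξ
  refine ofReal_le_mul_density (by positivity) (fun hu => ?_) (fun _ => ?_)
  · have e1 := hB.sq_le ξ (u ξ) (by linarith) (by linarith)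
    have e2 := hB.le_mul ξ (u ξ) _ hv1 hv2 (by linarith)
    calc _ ≤ 4 * (C * F ξ (u ξ)) * L + C * F ξ (u ξ) := by gcongr
      _ = _ := by ring
  · have e1 : (1 + u ξ) ^ 2 ≤ C := by nlinarith
    have e2 := hB.le_const ξ (u ξ - ψ ξ ^ 2 * (1 + u ξ)) (abs_le.2 ⟨hv1, by linarith⟩)
    calc _ ≤ 4 * C * L + C := by gcongr
      _ = _ := by ring

/-- The cubic g(a) = 3a² - a³ has g'(a) = 3a(2 - a), so its expansion at a is 3xy + (3 - 2a - b)y²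
with x = a(2 - a) and y = b - a. Young's inequality on xy separates the potential term from the
difference. -/
theorem abs_cubic_sub_le {a b : ℝ} (ha0 : 0 ≤ a) (ha2 : a ≤ 2) (hb0 : 0 ≤ b) (hb2 : b ≤ 2) :
    |(3 * b ^ 2 - b ^ 3) - (3 * a ^ 2 - a ^ 3)| ≤ 5 * (a * (2 - a)) ^ 2 + 6 * (b - a) ^ 2 := by
  set x := a * (2 - a)
  set y := b - a with hy
  have e : (3 * b ^ 2 - b ^ 3) - (3 * a ^ 2 - a ^ 3) = 3 * x * y + (3 - 2 * a - b) * y ^ 2 := by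
    simp only [x, y]; ring
  have hk : |3 - 2 * a - b| ≤ 3 := abs_le.2 ⟨by linarith, by linarith⟩
  rw [e]
  calc |3 * x * y + (3 - 2 * a - b) * y ^ 2|
      ≤ |3 * x * y| + |3 - 2 * a - b| * y ^ 2 := by
        refine (abs_add_le _ _).trans (le_of_eq ?_)
        rw [abs_mul (3 - 2 * a - b), abs_of_nonneg (sq_nonneg y)]
    _ ≤ (5 * x ^ 2 + 3 * y ^ 2) + 3 * y ^ 2 := by
        refine add_le_add (abs_le.2 ⟨?_, ?_⟩) (by gcongr)
        · nlinarith [sq_nonneg (x + y), sq_nonneg x, sq_nonneg y]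
        · nlinarith [sq_nonneg (x - y), sq_nonneg x, sq_nonneg y]
    _ = _ := by ring

/-- The variation of `3p² - p³` at unit scale is controlled by the Modica–Mortola energy of `p`. -/
theorem translDist_cubic_le {p : Heis n → ℝ} {H : Heis n → EuclideanSpace ℝ (Fin n ⊕ Fin n)}
    (hp : Measurable p) (hp0 : ∀ ξ, 0 ≤ p ξ) (hp2 : ∀ ξ, p ξ ≤ 2) (hpi : Integrable p)
    (hHi : Integrable H) (hw : IsWeakGrad univ p H) (j : Fin n ⊕ Fin n) {s : ℝ} (hs : 0 ≤ s)
    (hs1 : s ≤ 1) :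
    translDist (fun ξ => 3 * p ξ ^ 2 - p ξ ^ 3) (s • horizDir j) ≤
      5 * (∫⁻ ξ, ENNReal.ofReal ((p ξ * (2 - p ξ)) ^ 2))
        + 6 * ∫⁻ ξ, ENNReal.ofReal (‖H ξ‖ ^ 2) := by
  have hHj : Integrable fun ξ => H ξ j := (EuclideanSpace.proj (𝕜 := ℝ) j).integrable_comp hHi
  have hdiff := lintegral_flow_sub_sq_le j hpi hHj (fun φ hφ hc => by
    simpa using hw.integral_eq φ hφ hc (subset_univ _) j) hs hs1
  have hm : Measurable fun ξ => ENNReal.ofReal ((p ξ * (2 - p ξ)) ^ 2) :=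
    ((hp.mul (measurable_const.sub hp)).pow_const 2).ennreal_ofReal
  calc translDist (fun ξ => 3 * p ξ ^ 2 - p ξ ^ 3) (s • horizDir j)
      ≤ ∫⁻ ξ, (5 * ENNReal.ofReal ((p ξ * (2 - p ξ)) ^ 2)
          + 6 * ‖p (mul ξ (s • horizDir j)) - p ξ‖ₑ ^ 2) := by
        refine lintegral_mono fun ξ => ?_
        set b := p (mul ξ (s • horizDir j))
        have h6 : ‖b - p ξ‖ₑ ^ 2 = ENNReal.ofReal ((b - p ξ) ^ 2) := by
          rw [Real.enorm_eq_ofReal_abs, ← ENNReal.ofReal_pow (abs_nonneg _), sq_abs]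
        have h5 : (5 : ℝ≥0∞) = ENNReal.ofReal 5 := by norm_num
        have h6' : (6 : ℝ≥0∞) = ENNReal.ofReal 6 := by norm_num
        rw [Real.enorm_eq_ofReal_abs, h6, h5, h6', ← ENNReal.ofReal_mul (by norm_num),
          ← ENNReal.ofReal_mul (by norm_num), ← ENNReal.ofReal_add (by positivity) (by positivity)]
        exact ENNReal.ofReal_le_ofReal (abs_cubic_sub_le (hp0 _) (hp2 _) (hp0 _) (hp2 _))
    _ = 5 * (∫⁻ ξ, ENNReal.ofReal ((p ξ * (2 - p ξ)) ^ 2))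
          + 6 * ∫⁻ ξ, ‖p (mul ξ (s • horizDir j)) - p ξ‖ₑ ^ 2 := by
        rw [lintegral_add_left (hm.const_mul _), lintegral_const_mul _ hm,
          lintegral_const_mul' _ _ (by norm_num)]
    _ ≤ _ := by
        refine add_le_add le_rfl (mul_le_mul' le_rfl ?_)
        refine hdiff.trans (lintegral_mono fun ξ => ?_)
        rw [← enorm_norm, Real.enorm_eq_ofReal (norm_nonneg _),
          ← ENNReal.ofReal_pow (norm_nonneg _)]
        exact ENNReal.ofReal_le_ofReal
          (pow_le_pow_left₀ (norm_nonneg _) (PiLp.norm_apply_le (H ξ) j) 2)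

theorem norm_add_sq_le {E : Type*} [NormedAddCommGroup E] [NormedSpace ℝ E] (A B : E) {p U : ℝ}
    (hp : 0 ≤ p) (hp1 : p ≤ 1) :
    ‖p • A + U • B‖ ^ 2 ≤ 2 * ‖A‖ ^ 2 + 2 * (U ^ 2 * ‖B‖ ^ 2) := by
  have h1 : ‖p • A + U • B‖ ≤ ‖A‖ + |U| * ‖B‖ := by
    refine (norm_add_le _ _).trans ?_
    rw [norm_smul, norm_smul, Real.norm_of_nonneg hp, Real.norm_eq_abs]
    gcongr
    exact mul_le_of_le_one_left (norm_nonneg _) hp1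
  calc _ ≤ (‖A‖ + |U| * ‖B‖) ^ 2 := pow_le_pow_left₀ (norm_nonneg _) h1 2
    _ ≤ 2 * ‖A‖ ^ 2 + 2 * (|U| * ‖B‖) ^ 2 := by nlinarith [sq_nonneg (‖A‖ - |U| * ‖B‖)]
    _ = _ := by rw [mul_pow, sq_abs]

theorem lintegral_eq_add_of_eq_zero_outside {f : Heis n → ℝ≥0∞} {A B : Set (Heis n)}
    (hA : MeasurableSet A) (hAB : A ⊆ B) (h0 : ∀ ξ, ξ ∉ B → f ξ = 0) :
    ∫⁻ ξ, f ξ = (∫⁻ ξ in A, f ξ) + ∫⁻ ξ in B \ A, f ξ := by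
  have h1 : ∫⁻ ξ, f ξ = ∫⁻ ξ in B, f ξ := by
    rw [setLIntegral_eq_of_support_subset]
    intro ξ hξ
    by_contra h
    exact hξ (h0 ξ h)
  rw [h1, ← lintegral_inter_add_sdiff _ _ hA, inter_eq_self_of_subset_right hAB]

/-- The differential inequality, in discrete form, behind the density estimate. -/
theorem exists_growth_step (hn : 1 ≤ n) {θ₀ C : ℝ} (h0 : 0 < θ₀) (h1 : θ₀ < 1) (hC : 4 ≤ C) :
    ∃ A B : ℝ, 0 < A ∧ 0 < B ∧ ∀ (P : StructuralConstants) (F : Heis n → ℝ → ℝ),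
      IsDoubleWell P F → PotentialBounds F θ₀ C →
      ∀ Ω u G, SatisfiesCaccioppoli F Ω u G → ∀ (ξ₀ : Heis n) (θ : ℝ), -θ₀ ≤ θ → θ ≤ θ₀ →
      ∀ ρ : ℝ, 0 ≤ ρ → ball ξ₀ (ρ + 2) ⊆ Ω → ∀ S : ℕ, 1 ≤ S →
      ENNReal.ofReal A * ∫⁻ ξ in ball ξ₀ (ρ + 2), density F u θ ξ ≤ (S : ℝ≥0∞) ^ homDim n →
      ∫⁻ ξ in ball ξ₀ ρ, density F u θ ξ ≤ ENNReal.ofReal B *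
        (S * ∫⁻ ξ in ball ξ₀ (ρ + 2) \ ball ξ₀ ρ, density F u θ ξ) := by
  obtain ⟨L, hL, hcut⟩ := exists_isCutoff n one_pos
  set c : ℝ := (1 - θ₀) ^ 2 with hc
  have hcpos : 0 < c := by have : 0 < 1 - θ₀ := by linarith
                           positivity
  set K : ℝ := (4 * L + 1) * C with hK
  have hKpos : 0 < K := by positivity
  set D : ℝ := 5 * (C * K + 4 * C) + 6 * (2 * K + 2 * L * C) with hD
  have hDpos : 0 < D := by positivity
  -- The first constant is what the mass condition 2∫f ≤ c S^Q requires, given ∫f ≤ 3C Y(ρ + 2). In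
  -- the second, K handles the potential part of the density and the other term comes from the
  -- isoperimetric inequality.
  refine ⟨6 * C / c, K + 2 * (6 * n + 4 : ℕ) * D / c, by positivity, by positivity, ?_⟩
  intro P F hF hB Ω u G h ξ₀ θ hθ1 hθ2 ρ hρ hball S hS hYS
  set w := density F u θ with hw
  have hwm : Measurable w := measurable_density hF h.measurable θ
  -- Thickness 2 leaves room for two cutoffs: one from ρ + 1 to ρ + 2 for the energy estimate, and
  -- one from ρ to ρ + 1 to truncate 1 + u.
  set Z := ∫⁻ ξ in ball ξ₀ (ρ + 2) \ ball ξ₀ ρ, w ξ with hZ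
  have hs1 : ball ξ₀ ρ ⊆ ball ξ₀ (ρ + 1) := ball_subset_ball (by linarith)
  have hs2 : ball ξ₀ (ρ + 1) ⊆ ball ξ₀ (ρ + 2) := ball_subset_ball (by linarith)
  have hm0 := measurableSet_ball ξ₀ hρ
  have hm1 := measurableSet_ball ξ₀ (by linarith : 0 ≤ ρ + 1)
  have hsq : ∀ ξ, ENNReal.ofReal ((1 + u ξ) ^ 2) ≤ ENNReal.ofReal C * w ξ :=
    sq_one_add_le_mul_density hB hC h hθ2
  -- energy in the intermediate ball
  obtain ⟨ψ, hψ⟩ := hcut ξ₀ (ρ + 1) (by linarith)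
  have hen : (∫⁻ ξ in ball ξ₀ (ρ + 1), ENNReal.ofReal (‖G ξ‖ ^ 2))
        + ∫⁻ ξ in ball ξ₀ (ρ + 1), ENNReal.ofReal (F ξ (u ξ)) ≤ ENNReal.ofReal K * Z := by
    rw [show ρ + 1 + 1 = ρ + 2 by ring] at hψ
    refine (lintegral_ball_le_density hF hB hC h hθ2 hψ (by linarith) (by linarith) hL hball).trans
      ?_
    gcongr
    exact lintegral_mono_set (sdiff_subset_sdiff_right hs1)
  have hG1 : ∫⁻ ξ in ball ξ₀ (ρ + 1), ENNReal.ofReal (‖G ξ‖ ^ 2) ≤ ENNReal.ofReal K * Z :=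
    le_self_add.trans hen
  have hF1 : ∫⁻ ξ in ball ξ₀ (ρ + 1), ENNReal.ofReal (F ξ (u ξ)) ≤ ENNReal.ofReal K * Z :=
    le_add_self.trans hen
  have hF0 : ∫⁻ ξ in ball ξ₀ ρ, ENNReal.ofReal (F ξ (u ξ)) ≤ ENNReal.ofReal K * Z :=
    (lintegral_mono_set hs1).trans hF1
  have hUshell : ∫⁻ ξ in ball ξ₀ (ρ + 1) \ ball ξ₀ ρ, ENNReal.ofReal ((1 + u ξ) ^ 2)
      ≤ ENNReal.ofReal C * Z := by
    rw [hZ, ← lintegral_const_mul _ hwm]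
    refine (lintegral_mono_set (sdiff_subset_sdiff_left hs2)).trans (lintegral_mono hsq)
  -- the truncated function
  obtain ⟨ζ, hζ⟩ := hcut ξ₀ ρ hρ
  have hζ0 : ∀ ξ, ξ ∉ ball ξ₀ (ρ + 1) → ζ ξ = 0 := fun ξ hξ =>
    image_eq_zero_of_notMem_tsupport fun h => hξ (hζ.tsupport_subset h)
  have hζg : ∀ ξ, ξ ∉ ball ξ₀ (ρ + 1) → hgrad ζ ξ = 0 := fun ξ hξ =>
    hgrad_eq_zero_of_notMem fun h => hξ (hζ.tsupport_subset h)
  obtain ⟨hpi, hHi, hpw⟩ := h.isWeakGrad.cutoff_mul hζ.contDiff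
    (hζ.hasCompactSupport (by linarith)) (hζ.tsupport_subset.trans (hs2.trans hball))
  set p : Heis n → ℝ := fun ξ => ζ ξ * (1 + u ξ) with hp
  set H : Heis n → EuclideanSpace ℝ (Fin n ⊕ Fin n) :=
    fun ξ => ζ ξ • G ξ + (1 + u ξ) • hgrad ζ ξ with hH
  have hpm : Measurable p := hζ.contDiff.continuous.measurable.mul
    (measurable_const.add h.measurable)
  have hp0 : ∀ ξ, 0 ≤ p ξ := fun ξ => mul_nonneg (hζ.nonneg ξ) (h.one_add_mem ξ).1
  have hpU : ∀ ξ, p ξ ≤ 1 + u ξ := fun ξ =>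
    mul_le_of_le_one_left (h.one_add_mem ξ).1 (hζ.le_one ξ)
  have hp2 : ∀ ξ, p ξ ≤ 2 := fun ξ => (hpU ξ).trans (h.one_add_mem ξ).2
  have hpball : ∀ ξ ∈ ball ξ₀ ρ, p ξ = 1 + u ξ := fun ξ hξ => by simp [hp, hζ.eq_one ξ hξ]
  -- On B_ρ, p(2 - p) = 1 - u², which the potential controls near both wells. On the shell p ≤ 1 +
  -- u, and (2 - p)² ≤ 4 suffices.
  have hpot : ∫⁻ ξ, ENNReal.ofReal ((p ξ * (2 - p ξ)) ^ 2)
      ≤ ENNReal.ofReal (C * K + 4 * C) * Z := by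
    rw [lintegral_eq_add_of_eq_zero_outside hm0 hs1 (fun ξ hξ => by simp [hp, hζ0 ξ hξ]),
      ENNReal.ofReal_add (by positivity) (by positivity), add_mul]
    refine add_le_add ?_ ?_
    · rw [ENNReal.ofReal_mul (by positivity), mul_assoc]
      calc _ ≤ ∫⁻ ξ in ball ξ₀ ρ, ENNReal.ofReal C * ENNReal.ofReal (F ξ (u ξ)) := by
            refine setLIntegral_mono' hm0 fun ξ hξ => ?_
            rw [← ENNReal.ofReal_mul (by positivity), hpball ξ hξ]
            refine ENNReal.ofReal_le_ofReal (le_trans (le_of_eq ?_)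
              (hB.sq_one_sub_sq_le ξ _ (h.abs_le_one ξ)))
            ring
        _ ≤ _ := by
            rw [lintegral_const_mul _ (hF.measurable_comp h.measurable).ennreal_ofReal]
            gcongr
    · rw [ENNReal.ofReal_mul (by positivity), mul_assoc]
      calc _ ≤ ∫⁻ ξ in ball ξ₀ (ρ + 1) \ ball ξ₀ ρ,
              ENNReal.ofReal 4 * ENNReal.ofReal ((1 + u ξ) ^ 2) := by
            refine lintegral_mono fun ξ => ?_
            rw [← ENNReal.ofReal_mul (by positivity)]
            refine ENNReal.ofReal_le_ofReal ?_
            rw [mul_pow, mul_comm]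
            have e1 : p ξ ^ 2 ≤ (1 + u ξ) ^ 2 := pow_le_pow_left₀ (hp0 ξ) (hpU ξ) 2
            have e2 : (2 - p ξ) ^ 2 ≤ 4 := by nlinarith [hp0 ξ, hp2 ξ]
            exact mul_le_mul e2 e1 (sq_nonneg _) (by norm_num)
        _ ≤ _ := by
            rw [lintegral_const_mul' _ _ ENNReal.ofReal_ne_top]
            gcongr
  -- The gradient of ζ vanishes on B_ρ, so (1 + u)² enters only on the shell, where it is bounded by
  -- the density.
  have hgrad2 : ∫⁻ ξ, ENNReal.ofReal (‖H ξ‖ ^ 2) ≤ ENNReal.ofReal (2 * K + 2 * L * C) * Z := by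
    have hbound : ∀ ξ, ENNReal.ofReal (‖H ξ‖ ^ 2)
        ≤ (ball ξ₀ (ρ + 1)).indicator (fun ξ => ENNReal.ofReal 2 * ENNReal.ofReal (‖G ξ‖ ^ 2)) ξ
          + (ball ξ₀ (ρ + 1) \ ball ξ₀ ρ).indicator
            (fun ξ => ENNReal.ofReal (2 * L) * ENNReal.ofReal ((1 + u ξ) ^ 2)) ξ := by
      intro ξ
      have hraw := norm_add_sq_le (G ξ) (hgrad ζ ξ) (U := 1 + u ξ) (hζ.nonneg ξ) (hζ.le_one ξ)
      by_cases hξ1 : ξ ∈ ball ξ₀ (ρ + 1)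
      · rw [indicator_of_mem hξ1, ← ENNReal.ofReal_mul (by norm_num)]
        by_cases hξ0 : ξ ∈ ball ξ₀ ρ
        · refine le_trans (ENNReal.ofReal_le_ofReal ?_) le_self_add
          rw [hζ.hgrad_eq_zero hξ0] at hraw
          simp only [hH, hζ.hgrad_eq_zero hξ0]
          simpa using hraw
        · rw [indicator_of_mem (show ξ ∈ ball ξ₀ (ρ + 1) \ ball ξ₀ ρ from ⟨hξ1, hξ0⟩),
            ← ENNReal.ofReal_mul (by positivity),
            ← ENNReal.ofReal_add (by positivity) (by positivity)]
          refine ENNReal.ofReal_le_ofReal (hraw.trans ?_)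
          have := mul_le_mul_of_nonneg_left (hζ.norm_hgrad_le ξ) (sq_nonneg (1 + u ξ))
          linarith
      · have : H ξ = 0 := by simp [hH, hζ0 ξ hξ1, hζg ξ hξ1]
        simp [this]
    have hGm : Measurable fun ξ => ENNReal.ofReal 2 * ENNReal.ofReal (‖G ξ‖ ^ 2) :=
      (h.measurable_grad.norm.pow_const 2).ennreal_ofReal.const_mul _
    calc _ ≤ (∫⁻ ξ in ball ξ₀ (ρ + 1), ENNReal.ofReal 2 * ENNReal.ofReal (‖G ξ‖ ^ 2))
          + ∫⁻ ξ in ball ξ₀ (ρ + 1) \ ball ξ₀ ρ,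
            ENNReal.ofReal (2 * L) * ENNReal.ofReal ((1 + u ξ) ^ 2) := by
          refine (lintegral_mono hbound).trans (le_of_eq ?_)
          rw [lintegral_add_left (hGm.indicator hm1), lintegral_indicator hm1,
            lintegral_indicator (hm1.diff hm0)]
      _ ≤ ENNReal.ofReal 2 * (ENNReal.ofReal K * Z)
          + ENNReal.ofReal (2 * L) * (ENNReal.ofReal C * Z) := by
          rw [lintegral_const_mul' _ _ ENNReal.ofReal_ne_top,
            lintegral_const_mul' _ _ ENNReal.ofReal_ne_top]
          gcongr
      _ = _ := by
          rw [← mul_assoc, ← mul_assoc, ← ENNReal.ofReal_mul (by norm_num),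
            ← ENNReal.ofReal_mul (by positivity), ← add_mul,
            ← ENNReal.ofReal_add (by positivity) (by positivity)]
  -- the isoperimetric inequality for the cubic of `p`
  set f : Heis n → ℝ := fun ξ => 3 * p ξ ^ 2 - p ξ ^ 3 with hf
  have hfm : Measurable f := ((hpm.pow_const 2).const_mul 3).sub (hpm.pow_const 3)
  have hf0 : ∀ ξ, 0 ≤ f ξ := fun ξ => by
    have : f ξ = p ξ ^ 2 * (3 - p ξ) := by simp only [hf]; ring
    rw [this]
    exact mul_nonneg (sq_nonneg _) (by linarith [hp2 ξ])
  have hvar : ∀ (j : Fin n ⊕ Fin n) (s : ℝ), 0 ≤ s → s ≤ 1 →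
      translDist f (s • horizDir j) ≤ ENNReal.ofReal D * Z := by
    intro j s hs hs'
    refine (translDist_cubic_le hpm hp0 hp2 hpi hHi hpw j hs hs').trans ?_
    calc _ ≤ 5 * (ENNReal.ofReal (C * K + 4 * C) * Z)
          + 6 * (ENNReal.ofReal (2 * K + 2 * L * C) * Z) := by gcongr
      _ = _ := by
          have e5 : ENNReal.ofReal (5 * (C * K + 4 * C)) = 5 * ENNReal.ofReal (C * K + 4 * C) := by
            rw [ENNReal.ofReal_mul (by norm_num), ENNReal.ofReal_ofNat]
          have e6 : ENNReal.ofReal (6 * (2 * K + 2 * L * C))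
              = 6 * ENNReal.ofReal (2 * K + 2 * L * C) := by
            rw [ENNReal.ofReal_mul (by norm_num), ENNReal.ofReal_ofNat]
          have eD : ENNReal.ofReal D = 5 * ENNReal.ofReal (C * K + 4 * C)
              + 6 * ENNReal.ofReal (2 * K + 2 * L * C) := by
            rw [hD, ENNReal.ofReal_add (by positivity) (by positivity), e5, e6]
          rw [eD]
          ring
  set E := ball ξ₀ ρ ∩ {η | θ ≤ u η} with hE
  have hEm : MeasurableSet E := hm0.inter (measurableSet_le measurable_const h.measurable)
  have hfE : ∀ ξ ∈ E, ENNReal.ofReal c ≤ ‖f ξ‖ₑ := by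
    intro ξ hξ
    have hu : θ ≤ u ξ := hξ.2
    rw [Real.enorm_eq_ofReal (hf0 ξ)]
    refine ENNReal.ofReal_le_ofReal ?_
    have e : f ξ = p ξ ^ 2 * (3 - p ξ) := by simp only [hf]; ring
    have e1 : 1 - θ₀ ≤ p ξ := by rw [hpball ξ hξ.1]; linarith
    have e2 : c ≤ p ξ ^ 2 := pow_le_pow_left₀ (by linarith) e1 2
    rw [e]
    nlinarith [hp2 ξ, sq_nonneg (p ξ)]
  have hmass : 2 * ∫⁻ ξ, ‖f ξ‖ₑ ≤ ENNReal.ofReal c * (S : ℝ≥0∞) ^ homDim n := by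
    have e1 : ∫⁻ ξ, ‖f ξ‖ₑ ≤ ENNReal.ofReal (3 * C) * ∫⁻ ξ in ball ξ₀ (ρ + 2), w ξ := by
      rw [← lintegral_const_mul _ hwm, ← lintegral_indicator (measurableSet_ball ξ₀ (by linarith))]
      refine lintegral_mono fun ξ => ?_
      by_cases hξ : ξ ∈ ball ξ₀ (ρ + 1)
      · rw [indicator_of_mem (hs2 hξ), Real.enorm_eq_ofReal (hf0 ξ)]
        have : f ξ ≤ 3 * (1 + u ξ) ^ 2 := by
          have e1 : p ξ ^ 2 ≤ (1 + u ξ) ^ 2 := pow_le_pow_left₀ (hp0 ξ) (hpU ξ) 2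
          have e2 : 0 ≤ p ξ ^ 3 := pow_nonneg (hp0 ξ) 3
          simp only [hf]; linarith
        refine (ENNReal.ofReal_le_ofReal this).trans ?_
        rw [ENNReal.ofReal_mul (by norm_num), ENNReal.ofReal_mul (by norm_num), mul_assoc]
        gcongr
        exact hsq ξ
      · have : f ξ = 0 := by simp [hf, hp, hζ0 ξ hξ]
        simp [this]
    calc 2 * ∫⁻ ξ, ‖f ξ‖ₑ
        ≤ ENNReal.ofReal 2 * (ENNReal.ofReal (3 * C) * ∫⁻ ξ in ball ξ₀ (ρ + 2), w ξ) := by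
          rw [ENNReal.ofReal_ofNat]; gcongr
      _ = ENNReal.ofReal c * (ENNReal.ofReal (6 * C / c)
            * ∫⁻ ξ in ball ξ₀ (ρ + 2), w ξ) := by
          rw [← mul_assoc, ← mul_assoc, ← ENNReal.ofReal_mul (by norm_num),
            ← ENNReal.ofReal_mul hcpos.le]
          congr 2
          field_simp
          norm_num
      _ ≤ _ := by gcongr
  have hiso := mul_volume_le_of_translDist_le hn hfm hvar ENNReal.ofReal_ne_top hEm hfE hS hmass
  have hvolE : volume E ≤ ENNReal.ofReal (2 * (6 * n + 4 : ℕ) * D / c) * (S * Z) := by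
    have hc0 : ENNReal.ofReal c ≠ 0 := by simpa using hcpos
    refine (ENNReal.mul_le_mul_iff_right hc0 ENNReal.ofReal_ne_top).1 (hiso.trans (le_of_eq ?_))
    rw [← mul_assoc (ENNReal.ofReal c), ← ENNReal.ofReal_mul hcpos.le,
      mul_div_cancel₀ _ hcpos.ne', ENNReal.ofReal_mul (by positivity),
      ENNReal.ofReal_mul (by positivity), ENNReal.ofReal_natCast, ENNReal.ofReal_ofNat]
    ring
  rw [lintegral_density hF h.measurable, ENNReal.ofReal_add (by positivity) (by positivity),
    add_mul]
  refine add_le_add (hF0.trans ?_) hvolE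
  gcongr
  exact le_mul_of_one_le_left' (by exact_mod_cast hS)

/-! ### Iteration of the growth inequality and the density estimate. -/

theorem exists_nat_pow_ge {A : ℝ} (hA : 0 ≤ A) {q : ℕ} (hq : q ≠ 0) {t : ℝ} (ht : 0 < t) :
    ∃ S : ℕ, 1 ≤ S ∧ A * t ^ q ≤ (S : ℝ) ^ q ∧ (S : ℝ) ≤ (A + 1) * t + 1 := by
  have hpos : 0 < (A + 1) * t := by positivity
  refine ⟨⌈(A + 1) * t⌉₊, Nat.one_le_iff_ne_zero.2 (Nat.ceil_pos.2 hpos).ne', ?_,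
    (Nat.ceil_lt_add_one hpos.le).le⟩
  calc A * t ^ q ≤ (A + 1) ^ q * t ^ q := by
        gcongr
        calc A ≤ A + 1 := by linarith
          _ ≤ (A + 1) ^ q := le_self_pow₀ (by linarith) hq
    _ = ((A + 1) * t) ^ q := (mul_pow _ _ _).symm
    _ ≤ _ := by
        gcongr
        exact Nat.le_ceil _

/-- A sequence that satisfies `yₖ ≤ C yₖ₊₁^{1/q} (yₖ₊₁ - yₖ)` grows at least like `k^q`. -/
theorem exists_pow_le_of_growth_step {A B μ : ℝ} (hA : 0 < A) (hB : 0 < B) (hμ : 0 < μ) {q : ℕ}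
    (hq : q ≠ 0) :
    ∃ c : ℝ, 0 < c ∧ ∀ (y : ℕ → ℝ) (m : ℕ), μ ≤ y 0 → (∀ k < m, ∀ S : ℕ, 1 ≤ S →
      A * y (k + 1) ≤ (S : ℝ) ^ q → y k ≤ B * (S * (y (k + 1) - y k))) →
      (c * m) ^ q ≤ y m := by
  obtain ⟨α, hα, hαq⟩ : ∃ α : ℝ, 0 < α ∧ α ^ q ≤ μ := by
    refine ⟨min μ 1, lt_min hμ one_pos, ?_⟩
    exact (pow_le_of_le_one (le_min hμ.le zero_le_one) (min_le_right _ _) hq).trans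
      (min_le_left _ _)
  -- The induction shows y_k ≥ (α + ck)^q. If it failed at k + 1, then with t = α + ck the step
  -- would give y_k ≤ E c t^q; the choice of c makes E c < 1, against y_k ≥ t^q.
  set E : ℝ := B * (((A + 1) * 2 + 1 / α) * (q * 2 ^ (q - 1))) with hE
  have hEpos : 0 < E := by
    have : 0 < (q : ℝ) := by exact_mod_cast Nat.pos_of_ne_zero hq
    positivity
  set c : ℝ := min α (1 / (2 * E)) with hc
  have hcpos : 0 < c := lt_min hα (by positivity)
  have hcα : c ≤ α := min_le_left _ _
  have hcE : E * c < 1 := by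
    calc E * c ≤ E * (1 / (2 * E)) := by gcongr; exact min_le_right _ _
      _ = 1 / 2 := by field_simp
      _ < 1 := by norm_num
  refine ⟨c, hcpos, fun y m h0 hstep => ?_⟩
  have key : ∀ k, k ≤ m → (α + c * k) ^ q ≤ y k := by
    intro k
    induction k with
    | zero => intro _; simpa using hαq.trans h0
    | succ k ih =>
      intro hk
      have hyk := ih (by omega)
      set t : ℝ := α + c * k with ht
      have htα : α ≤ t := by rw [ht]; have : 0 ≤ c * k := by positivity
                             linarith
      have htpos : 0 < t := hα.trans_le htα
      have hnext : α + c * (k + 1 : ℕ) = t + c := by rw [ht]; push_cast; ring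
      rw [hnext]
      by_contra hlt
      rw [not_le] at hlt
      -- Since c ≤ α ≤ t, the assumed failure bounds y_{k+1} by (2t)^q, so an S of order t is
      -- admissible.
      have hz : y (k + 1) ≤ (2 * t) ^ q :=
        hlt.le.trans (pow_le_pow_left₀ (by positivity) (by linarith) q)
      obtain ⟨S, hS1, hSq, hSt⟩ := exists_nat_pow_ge hA.le hq (by positivity : 0 < 2 * t)
      have hs := hstep k (by omega) S hS1
        ((mul_le_mul_of_nonneg_left hz hA.le).trans hSq)
      have hS' : (S : ℝ) ≤ ((A + 1) * 2 + 1 / α) * t := by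
        have : 1 ≤ 1 / α * t := by
          rw [one_div, inv_mul_eq_div]
          exact (one_le_div hα).2 htα
        linarith
      have hdiff : (t + c) ^ q - t ^ q ≤ c * q * (2 * t) ^ (q - 1) := by
        have h1 := abs_pow_sub_pow_le (t + c) t q
        rw [add_sub_cancel_left, abs_of_pos hcpos, abs_of_pos htpos,
          abs_of_pos (by linarith : 0 < t + c), max_eq_left (by linarith)] at h1
        refine (le_abs_self _).trans (h1.trans ?_)
        gcongr
        linarith
      have hgap : y (k + 1) - y k ≤ c * q * (2 * t) ^ (q - 1) := by linarith
      have hgap0 : 0 ≤ c * q * (2 * t) ^ (q - 1) := by positivity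
      have htq : t * (2 * t) ^ (q - 1) = 2 ^ (q - 1) * t ^ q := by
        obtain ⟨q', rfl⟩ := Nat.exists_eq_succ_of_ne_zero hq
        simp only [Nat.succ_sub_one, Nat.succ_eq_add_one, mul_pow, pow_succ]
        ring
      have : y k ≤ E * c * t ^ q := by
        calc y k ≤ B * (S * (y (k + 1) - y k)) := hs
          _ ≤ B * (S * (c * q * (2 * t) ^ (q - 1))) := by gcongr
          _ ≤ B * ((((A + 1) * 2 + 1 / α) * t) * (c * q * (2 * t) ^ (q - 1))) := by gcongr
          _ = B * (((A + 1) * 2 + 1 / α) * (c * q * (t * (2 * t) ^ (q - 1)))) := by ring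
          _ = _ := by rw [htq, hE]; ring
      have htq0 : 0 < t ^ q := by positivity
      nlinarith
  refine le_trans ?_ (key m le_rfl)
  exact pow_le_pow_left₀ (by positivity) (by linarith) q

/-- The lower density estimate for super-level sets. -/
theorem exists_volume_superlevel_ge (hn : 1 ≤ n) (P : StructuralConstants) {K μ₀ θ₀ : ℝ}
    (hK : 0 < K) (hμ : 0 < μ₀) (hθ : 0 < θ₀) (hθ1 : θ₀ < 1) :
    ∃ c : ℝ, 0 < c ∧ ∃ r₀ : ℝ, 0 < r₀ ∧ ∀ F : Heis n → ℝ → ℝ, IsDoubleWell P F →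
      ∀ Ω u G, SatisfiesCaccioppoli F Ω u G → ∀ (ξ : Heis n) (θ : ℝ), -θ₀ ≤ θ → θ ≤ θ₀ →
      ENNReal.ofReal μ₀ ≤ volume (ball ξ K ∩ {η | θ ≤ u η}) →
      ∀ r : ℝ, r₀ ≤ r → ball ξ r ⊆ Ω →
        ENNReal.ofReal (c * r ^ homDim n) ≤ volume (ball ξ r ∩ {η | θ ≤ u η}) := by
  obtain ⟨C, hC, hbd⟩ := exists_potentialBounds P hθ hθ1
  obtain ⟨A, B, hA, hB, hstep⟩ := exists_growth_step hn hθ hθ1 hC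
  obtain ⟨c₁, hc₁, hen⟩ := exists_lintegral_ball_le n P one_pos
  have hQ : homDim n ≠ 0 := by simp [homDim]
  obtain ⟨c, hc, hgrow⟩ := exists_pow_le_of_growth_step hA hB hμ hQ
  set κ : ℝ := (c / 4) ^ homDim n with hκ
  have hκpos : 0 < κ := by positivity
  -- The number m of steps of size 2 starting at radius K satisfies m ≥ r/4 once r ≥ 2(3 + K), so
  -- the density has mass at least κ r^Q. For r ≥ 2c₁/κ the potential accounts for at most half of
  -- it.
  refine ⟨κ / 2, by positivity, 4 + 2 * (3 + K) + 2 * c₁ / κ, by positivity, ?_⟩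
  intro F hF Ω u G h ξ θ h1 h2 hμK r hr hball
  have hr1 : 4 + 2 * (3 + K) ≤ r := by
    have : 0 ≤ 2 * c₁ / κ := by positivity
    linarith
  have hr2 : 2 * c₁ / κ ≤ r := by linarith
  have hrpos : 0 < r := by linarith
  set w := density F u θ with hw
  set m : ℕ := ⌊(r - 1 - K) / 2⌋₊ with hm
  have hm1 : (m : ℝ) ≤ (r - 1 - K) / 2 := Nat.floor_le (by linarith)
  have hm2 : (r - 1 - K) / 2 < m + 1 := Nat.lt_floor_add_one _
  set R : ℕ → ℝ := fun k => K + 2 * k with hR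
  -- The last radius stays 1 below r, the room that the energy bound with δ = 1 needs inside B_r.
  -- The constants thus do not involve the δ of the theorem.
  have hRm : R m + 1 ≤ r := by simp only [hR]; linarith
  have hRk : ∀ k ≤ m, R k ≤ R m := fun k hk => by
    simp only [hR]
    have : (k : ℝ) ≤ m := by exact_mod_cast hk
    linarith
  have hR0 : ∀ k, 0 ≤ R k := fun k => by simp only [hR]; positivity
  have hsub : ∀ k ≤ m, ball ξ (R k) ⊆ Ω := fun k hk =>
    (ball_subset_ball (by linarith [hRk k hk])).trans hball
  have hfin : ∀ T, T ⊆ ball ξ (R m) → ∫⁻ ξ in T, w ξ ≠ ⊤ := by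
    intro T hT
    rw [lintegral_density hF h.measurable]
    refine ENNReal.add_ne_top.2 ⟨?_, ?_⟩
    · refine ne_top_of_le_ne_top h.lintegral_ne_top
        ((lintegral_mono_set (hT.trans (hsub m le_rfl))).trans (lintegral_mono fun ξ => ?_))
      exact ENNReal.ofReal_le_ofReal (by linarith [sq_nonneg ‖G ξ‖])
    · exact ne_top_of_le_ne_top (isCompact_ball ξ (hR0 m)).measure_lt_top.ne
        (measure_mono (inter_subset_left.trans hT))
  have hfink : ∀ k ≤ m, ∫⁻ ξ in ball ξ (R k), w ξ ≠ ⊤ := fun k hk =>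
    hfin _ (ball_subset_ball (hRk k hk))
  have hy := hgrow (fun k => (∫⁻ ξ in ball ξ (R k), w ξ).toReal) m ?_ ?_
  rotate_left
  · refine (ENNReal.ofReal_le_iff_le_toReal (hfink 0 (Nat.zero_le m))).1 (hμK.trans ?_)
    rw [lintegral_density hF h.measurable]
    have : R 0 = K := by simp [hR]
    rw [this]
    exact le_add_self
  · intro k hk S hS hAS
    have hsucc : R (k + 1) = R k + 2 := by simp only [hR]; push_cast; ring
    have hk1 := hfink (k + 1) hk
    have hk0 := hfink k hk.le
    have hincl : ball ξ (R k) ⊆ ball ξ (R (k + 1)) := ball_subset_ball (by linarith)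
    have hsplit : ∫⁻ ξ in ball ξ (R (k + 1)), w ξ = (∫⁻ ξ in ball ξ (R k), w ξ)
        + ∫⁻ ξ in ball ξ (R (k + 1)) \ ball ξ (R k), w ξ := by
      rw [← lintegral_inter_add_sdiff _ _ (measurableSet_ball ξ (hR0 k)),
        inter_eq_self_of_subset_right hincl]
    have hshell : ∫⁻ ξ in ball ξ (R (k + 1)) \ ball ξ (R k), w ξ ≠ ⊤ :=
      hfin _ (sdiff_subset.trans (ball_subset_ball (hRk (k + 1) hk)))
    have hs := hstep P F hF (hbd n F hF) Ω u G h ξ θ h1 h2 (R k) (hR0 k)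
      (hsucc ▸ hsub (k + 1) hk) S hS
    rw [← hsucc] at hs
    have hs' := hs (by
      rw [← ENNReal.ofReal_toReal hk1, ← ENNReal.ofReal_mul hA.le, ← ENNReal.ofReal_natCast,
        ← ENNReal.ofReal_pow (by positivity)]
      exact ENNReal.ofReal_le_ofReal hAS)
    have hs'' := ENNReal.toReal_mono (by finiteness) hs'
    have hdiff : (∫⁻ ξ in ball ξ (R (k + 1)) \ ball ξ (R k), w ξ).toReal
        = (∫⁻ ξ in ball ξ (R (k + 1)), w ξ).toReal - (∫⁻ ξ in ball ξ (R k), w ξ).toReal := by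
      rw [hsplit, ENNReal.toReal_add hk0 hshell]
      ring
    rw [ENNReal.toReal_mul, ENNReal.toReal_mul, ENNReal.toReal_ofReal hB.le,
      ENNReal.toReal_natCast, hdiff] at hs''
    exact hs''
  have hmr : r / 4 ≤ m := by linarith
  have hylow : κ * r ^ homDim n ≤ (∫⁻ ξ in ball ξ (R m), w ξ).toReal := by
    refine le_trans ?_ hy
    rw [hκ, ← mul_pow]
    refine pow_le_pow_left₀ (by positivity) ?_ _
    calc c / 4 * r = c * (r / 4) := by ring
      _ ≤ c * m := by gcongr
  have hpot : ∫⁻ ξ in ball ξ (R m), ENNReal.ofReal (F ξ (u ξ))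
      ≤ ENNReal.ofReal (κ / 2 * r ^ homDim n) := by
    have hRm1 : 1 ≤ R m := by simp only [hR]; linarith
    refine (le_add_self.trans (hen F hF Ω u G h ξ (R m) hRm1
      ((ball_subset_ball hRm).trans hball))).trans (ENNReal.ofReal_le_ofReal ?_)
    have e1 : r ^ homDim n = r * r ^ (homDim n - 1) := by
      rw [← pow_succ', Nat.sub_add_cancel (Nat.one_le_iff_ne_zero.2 hQ)]
    have e2 : R m ^ (homDim n - 1) ≤ r ^ (homDim n - 1) :=
      pow_le_pow_left₀ (hR0 m) (by linarith) _
    have e3 : c₁ ≤ κ / 2 * r := by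
      rw [div_le_iff₀ hκpos] at hr2
      linarith
    calc c₁ * R m ^ (homDim n - 1) ≤ (κ / 2 * r) * r ^ (homDim n - 1) := by
          gcongr
      _ = _ := by rw [e1]; ring
  have htotal : ENNReal.ofReal (κ / 2 * r ^ homDim n) + ENNReal.ofReal (κ / 2 * r ^ homDim n)
      ≤ ENNReal.ofReal (κ / 2 * r ^ homDim n) + volume (ball ξ (R m) ∩ {η | θ ≤ u η}) := by
    calc _ = ENNReal.ofReal (κ * r ^ homDim n) := by
          rw [← ENNReal.ofReal_add (by positivity) (by positivity)]
          congr 1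
          ring
      _ ≤ ∫⁻ ξ in ball ξ (R m), w ξ :=
          (ENNReal.ofReal_le_iff_le_toReal (hfink m le_rfl)).2 hylow
      _ ≤ _ := by
          rw [lintegral_density hF h.measurable]
          gcongr
  refine ((ENNReal.add_le_add_iff_left ENNReal.ofReal_ne_top).1 htotal).trans ?_
  exact measure_mono (inter_subset_inter_left _ (ball_subset_ball (by linarith)))

/-! ### Return to the given minimizer, and the reflection u ↦ -u. -/

theorem volume_inter_congr {Ω B : Set (Heis n)} (hB : MeasurableSet B) (hBΩ : B ⊆ Ω)
    {u v : Heis n → ℝ} (h : u =ᵐ[volume.restrict Ω] v) (θ : ℝ) :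
    volume (B ∩ {η | θ ≤ u η}) = volume (B ∩ {η | θ ≤ v η}) := by
  refine measure_congr ?_
  have := ae_restrict_of_ae_restrict_of_subset hBΩ h
  rw [ae_restrict_iff' hB] at this
  filter_upwards [this] with ξ hξ
  refine propext ⟨fun hx => ⟨hx.1, ?_⟩, fun hx => ⟨hx.1, ?_⟩⟩
  · have h2 : θ ≤ u ξ := hx.2
    change θ ≤ v ξ
    rwa [← hξ hx.1]
  · have h2 : θ ≤ v ξ := hx.2
    change θ ≤ u ξ
    rwa [hξ hx.1]

/-- The potential reflected at the origin is again a double well. -/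
theorem IsDoubleWell.reflect {P : StructuralConstants} {F : Heis n → ℝ → ℝ}
    (hF : IsDoubleWell P F) : IsDoubleWell P fun ξ t => F ξ (-t) := by
  have hmaps : MapsTo (fun t : ℝ => -t) (Ioo (-1) 1) (Ioo (-1) 1) := fun t ht =>
    ⟨by linarith [ht.2], by linarith [ht.1]⟩
  have hderiv' : ∀ ξ t, deriv (fun t => F ξ (-t)) t = -deriv (F ξ) (-t) := fun ξ t =>
    deriv_comp_neg (F ξ) t
  refine
    { measurable := hF.measurable.comp (measurable_fst.prodMk measurable_snd.neg)
      nonneg := fun ξ t => hF.nonneg ξ _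
      le_bound := fun ξ t ht => hF.le_bound ξ _ (by rwa [abs_neg])
      one := fun ξ => hF.neg_one ξ
      neg_one := fun ξ => by rw [neg_neg]; exact hF.one ξ
      gamma_le := fun θ hθ ξ t ht => hF.gamma_le θ hθ ξ _ (by rwa [abs_neg])
      growth := fun ξ t h1 h2 => by
        have := hF.growth ξ (-t) (by rwa [abs_neg]) (by rwa [abs_neg])
        rwa [abs_neg] at this
      continuousOn := fun ξ => (hF.continuousOn ξ).comp continuous_neg.continuousOn hmaps
      locallyLipschitzOn := fun ξ => ?_
      differentiableOn := fun hd ξ =>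
        (hF.differentiableOn hd ξ).comp differentiable_neg.differentiableOn hmaps
      continuousOn_deriv := fun hd ξ => ?_
      le_deriv := fun hd ξ s h0 h1 => ?_
      deriv_le := fun hd ξ s h0 h1 => ?_
      continuousOn_Icc := fun hd ξ =>
        (hF.continuousOn_Icc hd ξ).comp continuous_neg.continuousOn fun t ht =>
          ⟨by linarith [ht.2], by linarith [ht.1]⟩
      monotoneOn_left := fun hd ξ s hs t ht hst => ?_
      monotoneOn_right := fun hd ξ s hs t ht hst => ?_ }
  · intro t ht
    obtain ⟨C, U, hU, hL⟩ := hF.locallyLipschitzOn ξ (hmaps ht)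
    refine ⟨C, (fun t : ℝ => -t) ⁻¹' U, ?_, fun s hs t ht => ?_⟩
    · exact (continuous_neg.continuousWithinAt.tendsto_nhdsWithin hmaps) hU
    · simpa [edist_neg_neg] using hL hs ht
  · rw [funext (hderiv' ξ)]
    exact ((hF.continuousOn_deriv hd ξ).comp continuous_neg.continuousOn hmaps).neg
  · rw [hderiv', neg_add, neg_neg, ← sub_eq_add_neg]
    linarith [hF.deriv_le hd ξ s h0 h1]
  · rw [hderiv', neg_sub, sub_eq_neg_add]
    linarith [hF.le_deriv hd ξ s h0 h1]
  · rw [hderiv', hderiv', neg_le_neg_iff]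
    exact hF.monotoneOn_right hd ξ ⟨by linarith [ht.2], by linarith [ht.1]⟩
      ⟨by linarith [hs.2], by linarith [hs.1]⟩ (by linarith)
  · rw [hderiv', hderiv', neg_le_neg_iff]
    exact hF.monotoneOn_left hd ξ ⟨by linarith [ht.2], by linarith [ht.1]⟩
      ⟨by linarith [hs.2], by linarith [hs.1]⟩ (by linarith)

theorem energy_reflect_le (F : Heis n → ℝ → ℝ) (A : Set (Heis n)) (u : Heis n → ℝ) :
    energy (fun ξ t => F ξ (-t)) A (-u) ≤ energy F A u := by
  refine le_iInf₂ fun G hG => (iInf₂_le (-G) hG.neg).trans (le_of_eq ?_)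
  simp

theorem energy_reflect (F : Heis n → ℝ → ℝ) (A : Set (Heis n)) (u : Heis n → ℝ) :
    energy (fun ξ t => F ξ (-t)) A (-u) = energy F A u := by
  refine le_antisymm (energy_reflect_le F A u) ?_
  simpa using energy_reflect_le (fun ξ t => F ξ (-t)) A (-u)

theorem IsPerturbation.neg {Ω : Set (Heis n)} {φ : Heis n → ℝ} (h : IsPerturbation Ω φ) :
    IsPerturbation Ω (-φ) := by
  have hsupp : tsupport (-φ) = tsupport φ := by simp [tsupport, Function.support_neg]
  obtain ⟨C, hC⟩ := h.bounded
  obtain ⟨G, hG, hG2⟩ := h.grad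
  exact ⟨by simpa [HasCompactSupport, hsupp] using h.hasCompactSupport,
    hsupp ▸ h.tsupport_subset, ⟨C, fun ξ => by simpa using hC ξ⟩, -G, hG.neg, hG2.neg⟩

theorem IsLocalMinimizer.reflect {F : Heis n → ℝ → ℝ} {Ω : Set (Heis n)} {u : Heis n → ℝ}
    (h : IsLocalMinimizer F Ω u) : IsLocalMinimizer (fun ξ t => F ξ (-t)) Ω (-u) := by
  refine ⟨by rw [energy_reflect]; exact h.energy_ne_top, fun φ hφ => ?_⟩
  have : -u + φ = -(u + -φ) := by rw [neg_add, neg_neg]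
  rw [this, energy_reflect, energy_reflect]
  exact h.le_energy_add _ hφ.neg

/-- The energy over A is an infimum over weak gradients in the interior of A, and the restriction of
G is one of them; an upper bound needs no more. -/
theorem SatisfiesCaccioppoli.energy_le {P : StructuralConstants} {F : Heis n → ℝ → ℝ}
    (hF : IsDoubleWell P F) {Ω A : Set (Heis n)} {u u₀ : Heis n → ℝ}
    {G : Heis n → EuclideanSpace ℝ (Fin n ⊕ Fin n)} (h : SatisfiesCaccioppoli F Ω u G)
    (hu : u₀ =ᵐ[volume.restrict Ω] u) (hA : A ⊆ Ω) :
    energy F A u₀ ≤ (∫⁻ ξ in A, ENNReal.ofReal (‖G ξ‖ ^ 2))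
      + ∫⁻ ξ in A, ENNReal.ofReal (F ξ (u ξ)) := by
  have hw : IsWeakGrad (interior A) u₀ G :=
    (h.isWeakGrad.congr hu.symm (Filter.EventuallyEq.refl _ _)).mono (interior_subset.trans hA)
  refine (iInf₂_le G hw).trans (le_of_eq ?_)
  rw [← lintegral_add_left (h.measurable_grad.norm.pow_const 2).ennreal_ofReal]
  refine lintegral_congr_ae ?_
  filter_upwards [ae_restrict_of_ae_restrict_of_subset hA hu] with ξ hξ
  rw [hξ, ENNReal.ofReal_add (sq_nonneg _) (hF.nonneg _ _)]

/-- The lower density estimate for local minimizers. -/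
theorem exists_volume_superlevel_ge_of_isLocalMinimizer (hn : 1 ≤ n) (P : StructuralConstants)
    {K μ₀ θ₀ : ℝ} (hK : 0 < K) (hμ : 0 < μ₀) (hθ : 0 < θ₀) (hθ1 : θ₀ < 1) :
    ∃ c : ℝ, 0 < c ∧ ∃ r₀ : ℝ, 0 < r₀ ∧ ∀ F : Heis n → ℝ → ℝ, IsDoubleWell P F →
      ∀ (Ω : Set (Heis n)) (u : Heis n → ℝ), IsOpen Ω → IsLocalMinimizer F Ω u →
      (∀ᵐ ξ ∂(volume.restrict Ω), |u ξ| ≤ 1) → ∀ (ξ : Heis n) (θ : ℝ), -θ₀ ≤ θ → θ ≤ θ₀ →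
      ENNReal.ofReal μ₀ ≤ volume (ball ξ K ∩ {η | θ ≤ u η}) →
      ∀ r : ℝ, r₀ ≤ r → ball ξ r ⊆ Ω →
        ENNReal.ofReal (c * r ^ homDim n) ≤ volume (ball ξ r ∩ {η | θ ≤ u η}) := by
  obtain ⟨c, hc, r₀, hr₀, hmain⟩ := exists_volume_superlevel_ge hn P hK hμ hθ hθ1
  -- With r ≥ K the ball B_K lies in Ω, where u₀ may be exchanged for its representative in the
  -- hypothesis on B_K.
  refine ⟨c, hc, max r₀ K, lt_max_of_lt_left hr₀, ?_⟩
  intro F hF Ω u₀ hΩ hmin hb ξ θ h1 h2 hμK r hr hball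
  obtain ⟨u, G, huu, h⟩ := hmin.exists_satisfiesCaccioppoli hF hΩ hb
  have hKr : K ≤ r := (le_max_right _ _).trans hr
  rw [volume_inter_congr (measurableSet_ball ξ hK.le) ((ball_subset_ball hKr).trans hball) huu]
    at hμK
  rw [volume_inter_congr (measurableSet_ball ξ (hK.le.trans hKr)) hball huu]
  exact hmain F hF Ω u G h ξ θ h1 h2 hμK r ((le_max_left _ _).trans hr) hball

end Heis

theorem theorem1p1 (n : ℕ) (hn : 1 ≤ n) (P : Heis.StructuralConstants) :
    (∀ δ : ℝ, 0 < δ →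
      ∃ c : ℝ, 0 < c ∧ ∃ r₀ : ℝ, 0 < r₀ ∧
        ∀ F : Heis n → ℝ → ℝ, Heis.IsDoubleWell P F →
        ∀ (Ω : Set (Heis n)) (u : Heis n → ℝ), IsOpen Ω → IsConnected Ω →
          Heis.IsLocalMinimizer F Ω u → (∀ᵐ ξ ∂(volume.restrict Ω), |u ξ| ≤ 1) →
        ∀ (ξ : Heis n) (r : ℝ), r₀ ≤ r → Heis.ball ξ (r + δ) ⊆ Ω →
          Heis.energy F (Heis.ball ξ r) u ≤ ENNReal.ofReal (c * r ^ (Heis.homDim n - 1))) ∧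
    (∀ K μ₀ θ₀ : ℝ, 0 < K → 0 < μ₀ → 0 < θ₀ → θ₀ < 1 →
      ∃ cstar : ℝ, 0 < cstar ∧ ∃ r₀ : ℝ, 0 < r₀ ∧
        ∀ δ : ℝ, 0 < δ →
        ∀ F : Heis n → ℝ → ℝ, Heis.IsDoubleWell P F →
        ∀ (Ω : Set (Heis n)) (u : Heis n → ℝ), IsOpen Ω → IsConnected Ω →
          Heis.IsLocalMinimizer F Ω u → (∀ᵐ ξ ∂(volume.restrict Ω), |u ξ| ≤ 1) →
        ∀ (ξ : Heis n) (θ : ℝ), -θ₀ ≤ θ → θ ≤ θ₀ →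
          (ENNReal.ofReal μ₀ ≤ volume (Heis.ball ξ K ∩ {η | θ ≤ u η}) →
            ∀ r : ℝ, r₀ ≤ r → Heis.ball ξ (r + δ) ⊆ Ω →
              ENNReal.ofReal (cstar * r ^ Heis.homDim n) ≤
                volume (Heis.ball ξ r ∩ {η | θ ≤ u η})) ∧
          (ENNReal.ofReal μ₀ ≤ volume (Heis.ball ξ K ∩ {η | u η ≤ θ}) →
            ∀ r : ℝ, r₀ ≤ r → Heis.ball ξ (r + δ) ⊆ Ω →
              ENNReal.ofReal (cstar * r ^ Heis.homDim n) ≤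
                volume (Heis.ball ξ r ∩ {η | u η ≤ θ}))) := by
  refine ⟨fun δ hδ => ?_, fun K μ₀ θ₀ hK hμ hθ hθ1 => ?_⟩
  · obtain ⟨c, hc, hmain⟩ := Heis.exists_lintegral_ball_le n P hδ
    refine ⟨c, hc, 1, one_pos, fun F hF Ω u₀ hΩ _ hmin hb ξ r hr hball => ?_⟩
    obtain ⟨u, G, huu, h⟩ := hmin.exists_satisfiesCaccioppoli hF hΩ hb
    exact (h.energy_le hF huu ((Heis.ball_subset_ball (by linarith)).trans hball)).trans
      (hmain F hF Ω u G h ξ r hr hball)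
  · obtain ⟨c, hc, r₀, hr₀, hmain⟩ :=
      Heis.exists_volume_superlevel_ge_of_isLocalMinimizer hn P hK hμ hθ hθ1
    refine ⟨c, hc, r₀, hr₀, fun δ hδ F hF Ω u hΩ _ hmin hb ξ θ h1 h2 => ⟨?_, ?_⟩⟩
    · intro hμK r hr hball
      exact hmain F hF Ω u hΩ hmin hb ξ θ h1 h2 hμK r hr
        ((Heis.ball_subset_ball (by linarith)).trans hball)
    · intro hμK r hr hball
      -- The sublevel set is a superlevel set of -u at level -θ. The function -u is a local
      -- minimizer for the reflected potential, which has the same structural constants, and the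
      -- range of θ is symmetric.
      have hset : {η | u η ≤ θ} = {η | -θ ≤ (-u) η} := by
        ext η
        change u η ≤ θ ↔ -θ ≤ -u η
        exact neg_le_neg_iff.symm
      rw [hset] at hμK ⊢
      exact hmain _ hF.reflect Ω (-u) hΩ hmin.reflect (by simpa using hb) ξ (-θ) (by linarith)
        (by linarith) hμK r hr ((Heis.ball_subset_ball (by linarith)).trans hball)
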